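/- Let $d\ge 0$, let $\mu$ be a locally finite Borel measure on $\mathbb{R}^d$ with Euclidean norm $\|\cdot\|$, and let $X$ be a determinantal point process on $(\mathbb{R}^d,\mu)$ with bounded kernel $K:\mathbb{R}^d\times\mathbb{R}^d\to\mathbb{R}$. That is, $K$ is measurable, symmetric and locally square integrable; the integral operator $\mathcal K f(x)=\int K(x,y)f(y)\,d\mu(y)$ is locally of trace class with eigenvalues in $[0,1]$ (i.e. this holds on $L^2(D,\mu)$ for every bounded Borel set $D$); and $X$ is a simple locally finite point process whose $n$-th order intensity function with respect to $\mu^n$ is $(x_1,\dots,x_n)\mapsto\det(K(x_i,x_j))_{1\le i,j\le n}$ (in particular, this function is non-negative) for every $n$. Put $\|K\|_\infty=\sup_{x,y}|K(x,y)|$ and $\omega(r)=\sup_{\|y-x\|\ge r}|K(x,y)|$. For sub-$\sigma$-algebras $\mathscr A,\mathscr B$ let $\beta(\mathscr A,\mathscr B)$ be the total variation distance between $\mathbb P_{\mathscr A\otimes\mathscr B}$ and $\mathbb P_{\mathscr A}\otimes\mathbb P_{\mathscr B}$ on $\mathscr A\otimes\mathscr B$, where $\mathbb P_{\mathscr A\otimes\mathscr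 B}(A\times B)=\mathbb P(A\cap B)$ and the distance of two probability measures is $\sup_S|P(S)-Q(S)|$. Let $\mathcal E(A)$ be the $\sigma$-algebra generated by $X\cap A$, and for $p,q,r\ge 0$ let $$\beta_{p,q}(r)=\sup\{\beta(\mathcal E(A),\mathcal E(B)) : A,B\subset\mathbb{R}^d\text{ Borel},\ \mu(A)\le p,\ \mu(B)\le q,\ \mathrm{dist}(A,B)>r\}.$$ The process $X$ is called $\beta$-mixing if $\beta_{p,q}(r)\to 0$ as $r\to\infty$ for all $p,q>0$. Then: 1. if $\omega(r)\to 0$ as $r\to\infty$, then $X$ is $\beta$-mixing; 2. for all $p,q,r\ge 0$, $$\beta_{p,q}(r)\le 4pq\,(1+2p\|K\|_\infty)(1+2q\|K\|_\infty)\,e^{2\|K\|_\infty(p+q)}\,\omega(r)^2;$$ 3. if $N\in\mathbb{N}$ and $\mathcal K$, as an operator on $L^2(\mathbb{R}^d,\mu)$, has rank at most $N$, then for all $p,q,r\ge 0$, $$\beta_{p,q}(r)\le 4pqN^2\,9^N\,\omega(r)^2.$$ -/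

import Mathlib

open MeasureTheory Filter Topology
open scoped NNReal ENNReal

noncomputable section

namespace PointProcess

/-- The Euclidean space `ℝᵈ`. -/
abbrev E (d : ℕ) : Type := EuclideanSpace ℝ (Fin d)

/-! ### Point configurations and simple point processes -/

/-- Locally finite point configurations in `ℝᵈ` (sets, hence without multiple points). -/
def Config (d : ℕ) : Type :=
  {s : Set (E d) // ∀ B : Set (E d), Bornology.IsBounded B → (s ∩ B).Finite}

/-- The number of points of a configuration in `C`. -/
def Config.count {d : ℕ} (C : Set (E d)) (s : Config d) : ℕ∞ := (s.1 ∩ C).encard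

/-- The usual `σ`-algebra on configurations, generated by the counts of points in Borel sets.
A simple point process is a measurable map into `Config d`. -/
instance Config.instMeasurableSpace (d : ℕ) : MeasurableSpace (Config d) :=
  ⨆ C : {C : Set (E d) // MeasurableSet C}, MeasurableSpace.comap (Config.count C.1) ⊤

/-- The configuration `s ∩ A`. -/
def Config.restrict {d : ℕ} (A : Set (E d)) (s : Config d) : Config d :=
  ⟨s.1 ∩ A, fun B hB => (s.2 B hB).subset
    (fun _ hx => ⟨hx.1.1, hx.2⟩)⟩

theorem Config.measurable_restrict {d : ℕ} {A : Set (E d)} (hA : MeasurableSet A) :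
    Measurable (Config.restrict A) := by
  have key : ∀ C : {C : Set (E d) // MeasurableSet C},
      MeasurableSpace.comap (Config.count C.1) ⊤ ≤ Config.instMeasurableSpace d :=
    fun C => le_iSup (fun C : {C : Set (E d) // MeasurableSet C} =>
      MeasurableSpace.comap (Config.count C.1) ⊤) C
  refine Measurable.of_comap_le ?_
  rw [Config.instMeasurableSpace, MeasurableSpace.comap_iSup]
  refine iSup_le fun C => ?_
  rw [MeasurableSpace.comap_comp]
  have h : Config.count C.1 ∘ Config.restrict A = Config.count (A ∩ C.1) := by
    ext1 s
    simp [Config.restrict, Config.count, Set.inter_assoc]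
  rw [h]
  exact key ⟨A ∩ C.1, hA.inter C.2⟩

/-- The `σ`-algebra `ℰ(A)` generated by `X ∩ A`. -/
abbrev localSigma {d : ℕ} {Ω : Type*} (X : Ω → Config d) (A : Set (E d)) : MeasurableSpace Ω :=
  MeasurableSpace.comap (fun w => (X w).restrict A) inferInstance

theorem localSigma_le {d : ℕ} {Ω : Type*} [mΩ : MeasurableSpace Ω] {X : Ω → Config d}
    (hX : Measurable X) {A : Set (E d)} (hA : MeasurableSet A) : localSigma X A ≤ mΩ :=
  ((Config.measurable_restrict hA).comp hX).comap_le

/-! ### Mixing coefficients -/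

/-- Total variation distance of two probability measures, `sup_S |μ S - ν S|`
(half of the total mass of `|μ - ν|`). -/
def tvDist {α : Type*} [MeasurableSpace α] (μ ν : Measure α) : ℝ :=
  ⨆ S : {S : Set α // MeasurableSet S}, |μ.real S.1 - ν.real S.1|

/-- The `β`-mixing (absolute regularity) coefficient of two sub-`σ`-algebras `𝒜`, `ℬ`:
the total variation distance, on the product `σ`-algebra `𝒜 ⊗ ℬ`, between the image of `P` under
`w ↦ (w, w)`, which gives mass `P (A ∩ B)` to `A ×ˢ B`, and the product of the restrictions of `P`
to `𝒜` and `ℬ`. -/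
def betaCoeff {Ω : Type*} [mΩ : MeasurableSpace Ω] (P : Measure Ω) (𝒜 ℬ : MeasurableSpace Ω) : ℝ :=
  @tvDist (Ω × Ω) (𝒜.prod ℬ)
    (@Measure.map Ω (Ω × Ω) mΩ (𝒜.prod ℬ) (fun w => (w, w)) P)
    (@Measure.prod Ω Ω 𝒜 ℬ (@Measure.map Ω Ω mΩ 𝒜 id P) (@Measure.map Ω Ω mΩ ℬ id P))

/-- The distance `inf {‖y - x‖ : x ∈ A, y ∈ B}` of two sets (`∞` if one of them is empty). -/
def setDist {d : ℕ} (A B : Set (E d)) : ℝ≥0∞ := ⨅ x ∈ A, ⨅ y ∈ B, edist x y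

/-- The coefficient `β_{p,q}(r)` of a point process `X` on `(ℝᵈ, μ)`. It is a supremum of a
non-empty set of numbers in `[0, 1]`. -/
def betaMix {d : ℕ} {Ω : Type*} [MeasurableSpace Ω] (P : Measure Ω) (μ : Measure (E d))
    (X : Ω → Config d) (p q r : ℝ≥0) : ℝ :=
  sSup {b : ℝ | ∃ A B : Set (E d), MeasurableSet A ∧ MeasurableSet B ∧
    μ A ≤ p ∧ μ B ≤ q ∧ (r : ℝ≥0∞) < setDist A B ∧
    b = betaCoeff P (localSigma X A) (localSigma X B)}

/-- `X` is `β`-mixing. -/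
def IsBetaMixing {d : ℕ} {Ω : Type*} [MeasurableSpace Ω] (P : Measure Ω) (μ : Measure (E d))
    (X : Ω → Config d) : Prop :=
  ∀ p q : ℝ≥0, 0 < p → 0 < q → Tendsto (fun r : ℝ≥0 => betaMix P μ X p q r) atTop (𝓝 0)

/-! ### Intensity functions and determinantal point processes -/

/-- `ρ` is the `n`-th order intensity function of `X`: it is non-negative, measurable, and
`𝔼 [∑ f (x₁, …, xₙ)] = ∫ f ρ dμⁿ`, the sum being over `n`-tuples of pairwise distinct points
of `X`. -/
structure IsIntensity {d : ℕ} {Ω : Type*} [MeasurableSpace Ω] (P : Measure Ω) (μ : Measure (E d))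
    (X : Ω → Config d) (n : ℕ) (ρ : (Fin n → E d) → ℝ) : Prop where
  nonneg : ∀ x, 0 ≤ ρ x
  measurable : Measurable ρ
  integral_eq : ∀ f : (Fin n → E d) → ℝ≥0∞, Measurable f →
    ∫⁻ w, ∑' x : {x : Fin n → E d // Function.Injective x ∧ ∀ i, x i ∈ (X w).1}, f x.1 ∂P =
      ∫⁻ x, f x * ENNReal.ofReal (ρ x) ∂(Measure.pi fun _ => μ)

/-- `T` is the integral operator `f ↦ ∫ K(·, y) f(y) dν(y)` on `L²(ν)`. -/
def IsIntegralOperator {d : ℕ} (K : E d → E d → ℝ) (ν : Measure (E d))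
    (T : Lp ℝ 2 ν →L[ℝ] Lp ℝ 2 ν) : Prop :=
  ∀ f : Lp ℝ 2 ν, (∀ᵐ x ∂ν, Integrable (fun y => K x y * f y) ν) ∧
    T f =ᵐ[ν] fun x => ∫ y, K x y * f y ∂ν

/-- The symmetric operator `T` is of trace class with eigenvalues in `[0, 1]`: there is a Hilbert
basis of eigenvectors, and the eigenvalues lie in `[0, 1]` and have a finite sum. -/
def IsTraceClassUnit {H : Type} [NormedAddCommGroup H] [InnerProductSpace ℝ H]
    (T : H →L[ℝ] H) : Prop :=
  ∃ (ι : Type) (b : HilbertBasis ι ℝ H) (l : ι → ℝ),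
    (∀ i, T (b i) = l i • b i) ∧ (∀ i, l i ∈ Set.Icc (0 : ℝ) 1) ∧ Summable l

/-- Admissible kernels: measurable, symmetric, locally square integrable, with an integral operator
that is locally (that is, compressed to `L²(D)` for every bounded `D`) of trace class with
eigenvalues in `[0, 1]`. -/
structure IsDPPKernel {d : ℕ} (μ : Measure (E d)) (K : E d → E d → ℝ) : Prop where
  measurable : Measurable (Function.uncurry K)
  symm : ∀ x y, K x y = K y x
  locallySquareIntegrable : ∀ D : Set (E d), Bornology.IsBounded D → MeasurableSet D →
    MemLp (Function.uncurry K) 2 ((μ.restrict D).prod (μ.restrict D))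
  locallyTraceClass : ∀ D : Set (E d), Bornology.IsBounded D → MeasurableSet D →
    ∃ T : Lp ℝ 2 (μ.restrict D) →L[ℝ] Lp ℝ 2 (μ.restrict D),
      IsIntegralOperator K (μ.restrict D) T ∧ IsTraceClassUnit T

/-- `X` is a determinantal point process on `(ℝᵈ, μ)` with kernel `K`: a simple point process
with `n`-th order intensity function `det (K(xᵢ, xⱼ))` for all `n`. -/
structure IsDPP {d : ℕ} {Ω : Type*} [MeasurableSpace Ω] (P : Measure Ω) (μ : Measure (E d))
    (X : Ω → Config d) (K : E d → E d → ℝ) : Prop where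
  measurable : Measurable X
  kernel : IsDPPKernel μ K
  intensity : ∀ n : ℕ, IsIntensity P μ X n
    (fun x => (Matrix.of fun i j : Fin n => K (x i) (x j)).det)

/-- The integral operator of `K` on `L²(μ)` has rank at most `N`. -/
def OperatorRankLE {d : ℕ} (μ : Measure (E d)) (K : E d → E d → ℝ) (N : ℕ) : Prop :=
  ∃ T : Lp ℝ 2 μ →L[ℝ] Lp ℝ 2 μ, IsIntegralOperator K μ T ∧
    LinearMap.rank (T : Lp ℝ 2 μ →ₗ[ℝ] Lp ℝ 2 μ) ≤ N

/-- `K` is bounded. -/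
def KernelBounded {d : ℕ} (K : E d → E d → ℝ) : Prop := ∃ M : ℝ, ∀ x y, |K x y| ≤ M

/-- The uniform norm `‖K‖_∞` of a bounded kernel. -/
def kernelNorm {d : ℕ} (K : E d → E d → ℝ) : ℝ := ⨆ z : E d × E d, |K z.1 z.2|

/-- `ω(r) = sup {|K(x, y)| : ‖y - x‖ ≥ r}` for a bounded kernel. -/
def omega {d : ℕ} (K : E d → E d → ℝ) (r : ℝ) : ℝ :=
  sSup {b : ℝ | ∃ x y : E d, r ≤ ‖y - x‖ ∧ b = |K x y|}

end PointProcess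

end

/-! Write `D H` for the iterated differences `altSum H` of a function `H` of point sets along
tuples. By inclusion-exclusion (`hasSum_tsum_altSum`) a bounded function of a finite random set has
the expectation `∑ₙ 1/n! ∫ D H · ρₙ`, where the `ρₙ` are the intensity functions
(`HasIntensities.hasSum_integral`). Let `A` and `B` be disjoint sets of finite measure. For
`H(X ∩ (A ∪ B))` the weights are the determinants of `K`; if the parts in `A` and in `B` are taken
from two independent copies of `X`, they are the determinants of the kernel obtained from `K` by
deleting the entries between `A` and `B` (`HasIntensities.hasSum_prod`, `blockKernel`). Since
`|D H| ≤ 2ⁿ`, the `β`-mixing coefficient is at most `∑ₙ 2ⁿ/n! ∫ |det K - det K_block|`.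

A quantitative Fischer inequality (`det_fromBlocks_bounds`) bounds the difference of the
determinants at `x ∈ Aᵏ`, `y ∈ Bˡ` by `k l ω² · tr adj K(x) · tr adj K(y)`, so that the series
factors into a contribution of `A` and one of `B` (`tsum_lintegral_kernelDet_sub_le`). The trace of
the adjugate is the sum of the principal minors of order `k - 1`, and what remains is to bound the
integrals of determinants: by Hadamard's inequality for a bounded kernel, and for a sum
`∑ Φᵢ(x) Φᵢ(y)` over `N` orthogonal functions of norm at most one by
`∫ det K dμⁿ ≤ N (N - 1) ⋯ (N - n + 1)`, whence the factors `exp` and `3 ^ N`.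

An operator of finite rank determines `K` only almost everywhere for the product measure, hence in
general not on the diagonal, and `K` itself need not be such a sum. With the eigenfunctions of the
operator one finds a kernel `K₀` of finite rank that agrees with `K`
almost everywhere and satisfies `K₀(x, x) ≤ K(x, x)` (`IsDPP.exists_isOffDiagonalVersion_of_rank`).
The excess `c(x) = K(x, x) - K₀(x, x)` amounts to an independent Poisson process of intensity `c`
that is superposed in both situations. Averaging over this process replaces `H` by another function
bounded by one, so the estimate holds with `K₀` in place of `K` (`enorm_sub_le_of_hasSum`,
`IsDPP.enorm_sub_le`). -/

/-! ### Determinants of positive semidefinite matrices -/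

namespace PointProcess

open Matrix

variable {ι κ : Type*} [Fintype ι] [Fintype κ] [DecidableEq ι] [DecidableEq κ]

theorem det_add_diagonal (M : Matrix ι ι ℝ) (t : ι → ℝ) :
    (M + diagonal t).det = ∑ S : Finset ι, (∏ i ∈ Sᶜ, t i) *
      (M.submatrix (Subtype.val : S → ι) (Subtype.val : S → ι)).det := by
  have h1 : (M + diagonal t).det =
      (detRowAlternating : (ι → ℝ) [⋀^ι]→ₗ[ℝ] ℝ) ((fun i => M i) + fun i => diagonal t i) := rfl
  rw [h1, AlternatingMap.map_add_univ]
  refine Finset.sum_congr rfl fun S _ => ?_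
  rw [← det_piecewise_one_eq_submatrix_det]
  have h2 : S.piecewise (fun i => M i) (fun i => diagonal t i) =
      fun i => (if i ∈ S then 1 else t i) • (S.piecewise M.row (1 : Matrix ι ι ℝ).row) i := by
    funext i j
    by_cases hi : i ∈ S
    · simp [hi, Matrix.row, Finset.piecewise]
    · by_cases hij : i = j
      · subst hij; simp [hi, Matrix.row, Finset.piecewise]
      · simp [hi, Matrix.row, hij, Finset.piecewise]
  rw [h2]
  refine (AlternatingMap.map_smul_univ _ _ _).trans ?_
  have h3 : (∏ i : ι, if i ∈ S then (1 : ℝ) else t i) = ∏ i ∈ Sᶜ, t i := by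
    rw [← Finset.prod_mul_prod_compl S]
    rw [Finset.prod_congr rfl (g := fun _ => (1 : ℝ)) (fun i hi => by simp [hi])]
    rw [Finset.prod_congr rfl (s₁ := Sᶜ) (g := t)
      (fun i hi => by simp [Finset.mem_compl.1 hi])]
    simp
  rw [h3]
  rfl

theorem posSemidef_of_principal_minors {M : Matrix ι ι ℝ} (hM : M.IsHermitian)
    (h : ∀ S : Finset ι, 0 ≤ (M.submatrix (Subtype.val : S → ι) (Subtype.val : S → ι)).det) :
    M.PosSemidef := by
  -- If `e < 0` is an eigenvalue, then `det (M - e) = 0`; but the expansion of this determinant has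
  -- non-negative terms, and the term of the empty minor is a power of `-e`.
  rw [hM.posSemidef_iff_eigenvalues_nonneg]
  intro i
  by_contra hi
  have hi' : 0 < - hM.eigenvalues i := by simpa using hi
  set e := hM.eigenvalues i with he
  have hdet : (M + diagonal fun _ => -e).det = 0 := by
    rw [← exists_mulVec_eq_zero_iff]
    refine ⟨(hM.eigenvectorBasis i : EuclideanSpace ℝ ι), ?_, ?_⟩
    · intro h0
      have := hM.eigenvectorBasis.toBasis.ne_zero i
      apply this
      ext j
      simpa using congrFun h0 j
    · rw [add_mulVec, hM.mulVec_eigenvectorBasis]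
      ext j
      simp [← he]
  have hpos : 0 < (M + diagonal fun _ => -e).det := by
    rw [det_add_diagonal]
    refine lt_of_lt_of_le ?_ (Finset.single_le_sum (f := fun S : Finset ι => (∏ i ∈ Sᶜ, -e) *
      (M.submatrix (Subtype.val : S → ι) (Subtype.val : S → ι)).det) (fun S _ => ?_)
      (Finset.mem_univ ∅))
    · simpa using pow_pos hi' _
    · exact mul_nonneg (Finset.prod_nonneg fun _ _ => hi'.le) (h S)
  exact hpos.ne' hdet

/-- The eigenvalues `vᵢ` of `1 - W` lie in `[0, 1]`, and `1 - ∏ vᵢ ≤ ∑ (1 - vᵢ)` for such numbers. -/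
theorem one_sub_trace_le_det_one_sub {W : Matrix ι ι ℝ} (hW : W.PosSemidef)
    (hV : (1 - W).PosSemidef) : 1 - W.trace ≤ (1 - W).det ∧ (1 - W).det ≤ 1 := by
  have h0 := hV.eigenvalues_nonneg
  have h1 : ∀ i, hV.1.eigenvalues i ≤ 1 := by
    intro i
    set v : EuclideanSpace ℝ ι := hV.1.eigenvectorBasis i
    have hv : (WithLp.ofLp v) ⬝ᵥ (WithLp.ofLp v) = 1 := by
      have h := hV.1.eigenvectorBasis.orthonormal.1 i
      have h2 : ‖v‖ ^ 2 = 1 := by rw [h]; norm_num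
      rw [EuclideanSpace.norm_sq_eq] at h2
      simpa [dotProduct, sq] using h2
    have h := hV.1.mulVec_eigenvectorBasis i
    have h3 : hV.1.eigenvalues i = v ⬝ᵥ ((1 - W) *ᵥ v) := by
      rw [h, dotProduct_smul, hv]; simp
    have h4 : 0 ≤ v ⬝ᵥ (W *ᵥ v) := by simpa using hW.dotProduct_mulVec_nonneg v
    rw [h3, sub_mulVec, dotProduct_sub, one_mulVec, hv]
    linarith
  have hdet : (1 - W).det = ∏ i, hV.1.eigenvalues i := by
    simpa using hV.1.det_eq_prod_eigenvalues
  have htr : (1 - W).trace = ∑ i, hV.1.eigenvalues i := by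
    simpa using hV.1.trace_eq_sum_eigenvalues
  have htr' : W.trace = ∑ i, (1 - hV.1.eigenvalues i) := by
    rw [Finset.sum_sub_distrib, ← htr, trace_sub, trace_one]; simp
  rw [hdet, htr']
  refine ⟨?_, Finset.prod_le_one (fun i _ => h0 i) fun i _ => h1 i⟩
  have key : ∀ s : Finset ι, 1 - ∑ i ∈ s, (1 - hV.1.eigenvalues i) ≤
      ∏ i ∈ s, hV.1.eigenvalues i := by
    intro s
    induction s using Finset.induction_on with
    | empty => simp
    | insert a s ha ih =>
      rw [Finset.sum_insert ha, Finset.prod_insert ha]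
      have hp : ∏ i ∈ s, hV.1.eigenvalues i ≤ 1 :=
        Finset.prod_le_one (fun i _ => h0 i) fun i _ => h1 i
      nlinarith [h0 a, h1 a]
  exact key _

/-- The Hilbert-Schmidt norm is submultiplicative. -/
theorem sum_sq_mul_le {l m n : Type*} [Fintype l] [Fintype m] [Fintype n]
    (X : Matrix l m ℝ) (Y : Matrix m n ℝ) :
    ∑ i, ∑ j, (X * Y) i j ^ 2 ≤ (∑ i, ∑ k, X i k ^ 2) * ∑ k, ∑ j, Y k j ^ 2 := by
  rw [Finset.sum_mul]
  refine Finset.sum_le_sum fun i _ => ?_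
  rw [Finset.sum_comm (f := fun k j => Y k j ^ 2), Finset.mul_sum]
  refine Finset.sum_le_sum fun j _ => ?_
  rw [mul_apply]
  exact Finset.sum_mul_sq_le_sq_mul_sq _ _ _

theorem trace_transpose_mul_self {m n : Type*} [Fintype m] [Fintype n] (X : Matrix m n ℝ) :
    (X * Xᵀ).trace = ∑ i, ∑ j, X i j ^ 2 := by
  simp [trace, mul_apply, sq]

open scoped MatrixOrder in
theorem exists_eq_transpose_mul_self {A : Matrix ι ι ℝ} (hA : A.PosSemidef) :
    ∃ R : Matrix ι ι ℝ, A = Rᵀ * R := by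
  obtain ⟨B, hB⟩ := CStarAlgebra.nonneg_iff_eq_star_mul_self.mp hA.nonneg
  exact ⟨B, by simpa [star_eq_conjTranspose, conjTranspose_eq_transpose_of_trivial] using hB⟩

theorem trace_adjugate_of_posDef {A : Matrix ι ι ℝ} (hA : A.PosDef) :
    A.adjugate.trace = A.det * A⁻¹.trace := by
  rw [inv_def, trace_smul, smul_eq_mul, ← mul_assoc, Ring.mul_inverse_cancel _
    (isUnit_iff_ne_zero.2 hA.det_pos.ne'), one_mul]

theorem det_fromBlocks_bounds_of_posDef {A : Matrix ι ι ℝ} {B : Matrix κ κ ℝ} {C : Matrix ι κ ℝ}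
    (hA : A.PosDef) (hB : B.PosDef) (hM : (fromBlocks A C Cᵀ B).PosSemidef) :
    (fromBlocks A C Cᵀ B).det ≤ A.det * B.det ∧
      A.det * B.det - (fromBlocks A C Cᵀ B).det ≤
        A.adjugate.trace * B.adjugate.trace * ∑ i, ∑ j, C i j ^ 2 := by
  have hAu : IsUnit A := hA.isUnit
  let _ : Invertible A := hAu.invertible
  have hQ : (B - Cᵀ * A⁻¹ * C).PosSemidef := by
    have := (PosDef.fromBlocks₁₁ C B hA).1
      (by rwa [conjTranspose_eq_transpose_of_trivial])
    rwa [conjTranspose_eq_transpose_of_trivial] at this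
  have hdet : (fromBlocks A C Cᵀ B).det = A.det * (B - Cᵀ * A⁻¹ * C).det := by
    rw [det_fromBlocks₁₁, invOf_eq_nonsing_inv]
  -- With `A⁻¹ = SᵀS`, `B⁻¹ = RᵀR` and `W = (R Cᵀ Sᵀ)(R Cᵀ Sᵀ)ᵀ`, the determinant of the Schur
  -- complement is `det B * det (1 - W)`.
  obtain ⟨S, hS⟩ := exists_eq_transpose_mul_self hA.inv.posSemidef
  obtain ⟨R, hR⟩ := exists_eq_transpose_mul_self hB.inv.posSemidef
  have hBu : IsUnit B.det := isUnit_iff_ne_zero.2 hB.det_pos.ne'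
  have hRB : R * B * Rᵀ = 1 := by
    have h : Rᵀ * (R * B) = 1 := by
      rw [← mul_assoc, ← hR, nonsing_inv_mul _ hBu]
    exact mul_eq_one_comm.1 h
  set Q := Cᵀ * A⁻¹ * C with hQdef
  set W := R * Q * Rᵀ with hWdef
  have hWfac : W = (R * Cᵀ * Sᵀ) * (R * Cᵀ * Sᵀ)ᵀ := by
    rw [hWdef, hQdef, hS]
    simp [Matrix.mul_assoc]
  have hW : W.PosSemidef := by
    rw [hWfac, ← conjTranspose_eq_transpose_of_trivial]
    exact posSemidef_self_mul_conjTranspose _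
  have h1W : 1 - W = R * (B - Q) * Rᵀ := by
    rw [mul_sub, sub_mul, hRB]
  have hV : (1 - W).PosSemidef := by
    rw [h1W, ← conjTranspose_eq_transpose_of_trivial]
    exact hQ.mul_mul_conjTranspose_same R
  obtain ⟨hlow, hup⟩ := one_sub_trace_le_det_one_sub hW hV
  have hdetB : (B - Q).det = B.det * (1 - W).det := by
    have h1 : R.det * B.det * R.det = 1 := by
      have := congrArg det hRB
      simpa using this
    rw [h1W]
    simp only [det_mul, det_transpose]
    linear_combination (-(B - Q).det) * h1
  have htr : W.trace ≤ A⁻¹.trace * B⁻¹.trace * ∑ i, ∑ j, C i j ^ 2 := by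
    have hSt : A⁻¹.trace = ∑ i, ∑ j, Sᵀ i j ^ 2 := by
      rw [← trace_transpose_mul_self, hS, transpose_transpose]
    have hRt : B⁻¹.trace = ∑ i, ∑ j, R i j ^ 2 := by
      rw [← trace_transpose_mul_self, hR, trace_mul_comm]
    have hCt : ∑ i, ∑ j, C i j ^ 2 = ∑ i, ∑ j, Cᵀ i j ^ 2 := Finset.sum_comm
    rw [hWfac, trace_transpose_mul_self, hSt, hRt, hCt]
    calc _ ≤ (∑ i, ∑ j, (R * Cᵀ) i j ^ 2) * ∑ i, ∑ j, Sᵀ i j ^ 2 := sum_sq_mul_le _ _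
      _ ≤ ((∑ i, ∑ j, R i j ^ 2) * ∑ i, ∑ j, Cᵀ i j ^ 2) * ∑ i, ∑ j, Sᵀ i j ^ 2 := by
        gcongr
        exact sum_sq_mul_le _ _
      _ = _ := by ring
  rw [hdet, hdetB, trace_adjugate_of_posDef hA, trace_adjugate_of_posDef hB]
  have hAB : 0 < A.det * B.det := mul_pos hA.det_pos hB.det_pos
  constructor
  · nlinarith
  · have : A.det * B.det * W.trace ≤ A.det * B.det * (A⁻¹.trace * B⁻¹.trace *
        ∑ i, ∑ j, C i j ^ 2) := by gcongr
    nlinarith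

/-- A quantitative Fischer inequality: for a positive semidefinite block matrix, the product of
the determinants of the diagonal blocks exceeds the determinant, and the excess is of second order
in the off-diagonal block. -/
theorem det_fromBlocks_bounds {A : Matrix ι ι ℝ} {B : Matrix κ κ ℝ} {C : Matrix ι κ ℝ}
    (hM : (fromBlocks A C Cᵀ B).PosSemidef) :
    (fromBlocks A C Cᵀ B).det ≤ A.det * B.det ∧
      A.det * B.det - (fromBlocks A C Cᵀ B).det ≤
        A.adjugate.trace * B.adjugate.trace * ∑ i, ∑ j, C i j ^ 2 := by
  have hA : A.PosSemidef := hM.submatrix Sum.inl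
  have hB : B.PosSemidef := hM.submatrix Sum.inr
  -- The invertible case applies to `M + ε`, and both sides are continuous in `ε`.
  have hfb : ∀ ε : ℝ, fromBlocks (A + ε • 1) C Cᵀ (B + ε • 1) = fromBlocks A C Cᵀ B + ε • 1 := by
    intro ε
    rw [← fromBlocks_one, fromBlocks_smul, fromBlocks_add]
    simp
  have key : ∀ ε : ℝ, 0 < ε → _ := fun ε hε => by
    have h1 : ∀ {α : Type _} [Fintype α] [DecidableEq α], (ε • (1 : Matrix α α ℝ)).PosDef :=
      fun {α} _ _ => PosDef.one.smul hε
    exact det_fromBlocks_bounds_of_posDef (A := A + ε • 1) (B := B + ε • 1) (C := C)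
      (h1.posSemidef_add hA) (PosDef.posSemidef_add hB (PosDef.one.smul hε))
      (by rw [hfb]; exact hM.add (PosSemidef.one.smul hε.le))
  have hcA : Continuous fun ε : ℝ => A + ε • (1 : Matrix ι ι ℝ) := by fun_prop
  have hcB : Continuous fun ε : ℝ => B + ε • (1 : Matrix κ κ ℝ) := by fun_prop
  have hcM : Continuous fun ε : ℝ => fromBlocks (A + ε • 1) C Cᵀ (B + ε • 1) := by
    simp_rw [hfb]; fun_prop
  have hmem : ∀ᶠ ε : ℝ in 𝓝[>] 0, 0 < ε := eventually_mem_nhdsWithin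
  have lim : ∀ f : ℝ → ℝ, Continuous f → Tendsto f (𝓝[>] 0) (𝓝 (f 0)) :=
    fun f hf => hf.continuousAt.tendsto.mono_left nhdsWithin_le_nhds
  constructor
  · have := le_of_tendsto_of_tendsto (lim _ hcM.matrix_det)
      (lim _ (hcA.matrix_det.mul hcB.matrix_det)) (hmem.mono fun ε hε => (key ε hε).1)
    simpa using this
  · have := le_of_tendsto_of_tendsto
      (lim _ ((hcA.matrix_det.mul hcB.matrix_det).sub hcM.matrix_det))
      (lim _ ((hcA.matrix_adjugate.matrix_trace.mul hcB.matrix_adjugate.matrix_trace).mul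
        continuous_const)) (hmem.mono fun ε hε => (key ε hε).2)
    simpa using this

theorem det_le_prod_diag_fin {n : ℕ} {M : Matrix (Fin n) (Fin n) ℝ} (hM : M.PosSemidef) :
    M.det ≤ ∏ i, M i i := by
  induction n with
  | zero => simp
  | succ n ih =>
    let e : Fin n ⊕ Fin 1 ≃ Fin (n + 1) := finSumFinEquiv
    have h := hM.submatrix e
    have hfb : M.submatrix e e = fromBlocks (M.submatrix (e ∘ Sum.inl) (e ∘ Sum.inl))
        (M.submatrix (e ∘ Sum.inl) (e ∘ Sum.inr)) (M.submatrix (e ∘ Sum.inl) (e ∘ Sum.inr))ᵀ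
        (M.submatrix (e ∘ Sum.inr) (e ∘ Sum.inr)) := by
      ext (i | i) (j | j)
      · rfl
      · rfl
      · have := hM.1.apply (e (Sum.inl j)) (e (Sum.inr i))
        simpa using this
      · rfl
    have h1 := (det_fromBlocks_bounds (hfb ▸ h)).1
    rw [← hfb, det_submatrix_equiv_self] at h1
    refine h1.trans ?_
    rw [Fin.prod_univ_castSucc, det_unique (n := Fin 1)]
    have h2 := ih (hM.submatrix (e ∘ Sum.inl))
    have h3 : 0 ≤ M (Fin.last n) (Fin.last n) := hM.diag_nonneg
    exact mul_le_mul_of_nonneg_right h2 h3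

/-- Hadamard's inequality. -/
theorem det_le_prod_diag {M : Matrix ι ι ℝ} (hM : M.PosSemidef) : M.det ≤ ∏ i, M i i := by
  let e := (Fintype.equivFin ι).symm
  have h := det_le_prod_diag_fin (hM.submatrix e)
  rw [det_submatrix_equiv_self] at h
  exact h.trans_eq (e.prod_comp fun i => M i i)

/-- The trace of the adjugate is the sum of the principal minors of corank one. -/
theorem trace_adjugate_fin {n : ℕ} (M : Matrix (Fin (n + 1)) (Fin (n + 1)) ℝ) :
    M.adjugate.trace = ∑ i, (M.submatrix (Fin.succAbove i) (Fin.succAbove i)).det := by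
  refine Finset.sum_congr rfl fun i _ => ?_
  rw [diag_apply, adjugate_fin_succ_eq_det_submatrix, ← two_mul, pow_mul]
  simp

end PointProcess

/-! ### Alternating sums over subtuples -/

namespace PointProcess

section AltSum

variable {α ι κ : Type*} [Fintype ι] [Fintype κ]

/-- The iterated difference `∑_v (-1)^(|ι| - |v|) H {zᵢ : i ∈ v}` of a set function `H` along a
tuple `z`, the sum being over all sets `v` of indices. -/
def altSum (H : Set α → ℝ) (z : ι → α) : ℝ :=
  ∑ v : Finset ι, (-1) ^ (Fintype.card ι + v.card) * H (z '' v)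

theorem altSum_comp_equiv (H : Set α → ℝ) (z : ι → α) (e : κ ≃ ι) :
    altSum H (z ∘ e) = altSum H z := by
  unfold altSum
  refine Fintype.sum_equiv e.finsetCongr _ _ fun v => ?_
  simp [Fintype.card_congr e, Set.image_image]

theorem abs_altSum_le {H : Set α → ℝ} {z : ι → α} (hH : ∀ v : Finset ι, |H (z '' v)| ≤ 1) :
    |altSum H z| ≤ 2 ^ Fintype.card ι := by
  refine (Finset.abs_sum_le_sum_abs _ _).trans ?_
  calc _ ≤ ∑ v : Finset ι, (1 : ℝ) := Finset.sum_le_sum fun v _ => by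
        simpa [abs_mul] using hH v
    _ = _ := by simp

theorem altSum_sumElim (H : Set α → ℝ) (x : ι → α) (y : κ → α) :
    altSum H (Sum.elim x y) = ∑ v : Finset ι, (-1) ^ (Fintype.card ι + v.card) *
      altSum (fun s => H (x '' v ∪ s)) y := by
  unfold altSum
  rw [← Finset.sumEquiv.symm.toEquiv.sum_comp, Fintype.sum_prod_type]
  refine Finset.sum_congr rfl fun v _ => ?_
  rw [Finset.mul_sum]
  refine Finset.sum_congr rfl fun w _ => ?_
  have h : Sum.elim x y '' ((Finset.sumEquiv.symm (v, w) : Finset (ι ⊕ κ)) : Set (ι ⊕ κ)) =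
      x '' v ∪ y '' w := by
    ext a
    simp [Finset.sumEquiv]
  have h2 : (Finset.sumEquiv.symm (v, w) : Finset (ι ⊕ κ)).card = v.card + w.card := by
    simp [Finset.sumEquiv]
  rw [OrderIso.coe_toEquiv, h, h2, Fintype.card_sum]
  ring

end AltSum

section Tuples

variable {α : Type*}

/-- The `n`-tuples of pairwise distinct points of `S`. -/
abbrev Tuples (n : ℕ) (S : Set α) : Type _ :=
  {x : Fin n → α // Function.Injective x ∧ ∀ i, x i ∈ S}

/-- Tuples of distinct points of `S` are embeddings into `S`. -/
def embeddingEquivTuples (n : ℕ) (S : Set α) : (Fin n ↪ S) ≃ Tuples n S where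
  toFun e := ⟨fun i => e i, Subtype.val_injective.comp e.injective, fun i => (e i).2⟩
  invFun x := ⟨fun i => ⟨x.1 i, x.2.2 i⟩, fun _ _ h => x.2.1 (congrArg Subtype.val h)⟩
  left_inv _ := rfl
  right_inv _ := rfl

instance finite_tuples (n : ℕ) (S : Set α) [Finite S] : Finite (Tuples n S) :=
  Finite.of_equiv _ (embeddingEquivTuples n S)

theorem card_tuples_image_eq [DecidableEq α] {n : ℕ} {t : Finset α} (ht : t.card = n) :
    Nat.card {x : Fin n → α // Function.Injective x ∧ Finset.univ.image x = t} = n.factorial := by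
  have hmem : ∀ (x : {x : Fin n → α // Function.Injective x ∧ Finset.univ.image x = t})
      (i : Fin n), x.1 i ∈ t := fun x i =>
    x.2.2.le (Finset.mem_image_of_mem _ (Finset.mem_univ i))
  have e : (Fin n ≃ t) ≃ {x : Fin n → α // Function.Injective x ∧ Finset.univ.image x = t} :=
    { toFun := fun e => ⟨fun i => e i, Subtype.val_injective.comp e.injective, by
        ext a
        simp only [Finset.mem_image, Finset.mem_univ, true_and]
        exact ⟨fun ⟨i, hi⟩ => hi ▸ (e i).2, fun ha => ⟨e.symm ⟨a, ha⟩, by simp⟩⟩⟩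
      invFun := fun x => Equiv.ofBijective
        (fun i => (⟨x.1 i, hmem x i⟩ : t))
        ⟨fun i j h => x.2.1 (congrArg Subtype.val h), fun a => by
          obtain ⟨a, ha⟩ := a
          have ha' := ha
          rw [← x.2.2] at ha'
          obtain ⟨i, -, hi⟩ := Finset.mem_image.1 ha'
          exact ⟨i, Subtype.ext hi⟩⟩
      left_inv := fun e => by ext; rfl
      right_inv := fun x => rfl }
  rw [← Nat.card_congr e, Nat.card_eq_fintype_card,
    Fintype.card_equiv (Fintype.equivOfCardEq (by simp [ht])), Fintype.card_fin]

theorem tsum_tuples_image [DecidableEq α] (n : ℕ) (s : Finset α) (g : Finset α → ℝ) :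
    ∑' x : Tuples n (s : Set α), g (Finset.univ.image x.1) =
      n.factorial * ∑ t ∈ s.powersetCard n, g t := by
  classical
  have := Fintype.ofFinite (Tuples n (s : Set α))
  rw [tsum_fintype]
  have hmap : ∀ x ∈ (Finset.univ : Finset (Tuples n (s : Set α))),
      Finset.univ.image x.1 ∈ s.powersetCard n := by
    intro x _
    rw [Finset.mem_powersetCard]
    refine ⟨fun a ha => ?_, ?_⟩
    · obtain ⟨i, -, hi⟩ := Finset.mem_image.1 ha
      exact hi ▸ x.2.2 i
    · rw [Finset.card_image_of_injective _ x.2.1, Finset.card_univ, Fintype.card_fin]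
  rw [← Finset.sum_fiberwise_of_maps_to hmap, Finset.mul_sum]
  refine Finset.sum_congr rfl fun t ht => ?_
  rw [Finset.mem_powersetCard] at ht
  rw [Finset.sum_congr rfl (g := fun _ => g t)
    (fun x hx => by rw [(Finset.mem_filter.1 hx).2]), Finset.sum_const, nsmul_eq_mul,
    ← card_tuples_image_eq ht.2]
  congr 2
  rw [← Fintype.card_coe, ← Nat.card_eq_fintype_card]
  refine Nat.card_congr
    { toFun := fun x => ⟨x.1.1, x.1.2.1, (Finset.mem_filter.1 x.2).2⟩
      invFun := fun x => ⟨⟨x.1, x.2.1, fun i => ht.1 ?_⟩, ?_⟩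
      left_inv := fun _ => rfl
      right_inv := fun _ => rfl }
  · exact x.2.2.le (Finset.mem_image_of_mem _ (Finset.mem_univ i))
  · simp [x.2.2]

theorem sum_powerset_alternating [DecidableEq α] (s : Finset α) (h : Finset α → ℝ) :
    ∑ t ∈ s.powerset, ∑ u ∈ t.powerset, (-1) ^ (t.card + u.card) * h u = h s := by
  induction s using Finset.induction_on generalizing h with
  | empty => simp
  | insert a s ha ih =>
    rw [Finset.sum_powerset_insert ha, ih, add_comm, ← eq_sub_iff_add_eq]
    have : ∀ t ∈ s.powerset,
        ∑ u ∈ (insert a t).powerset, (-1) ^ ((insert a t).card + u.card) * h u =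
        ∑ u ∈ t.powerset, (-1) ^ (t.card + u.card) * (h (insert a u) - h u) := by
      intro t ht
      have hat : a ∉ t := fun h => ha (Finset.mem_powerset.1 ht h)
      rw [Finset.sum_powerset_insert hat, ← Finset.sum_add_distrib]
      refine Finset.sum_congr rfl fun u hu => ?_
      have hau : a ∉ u := fun h => hat (Finset.mem_powerset.1 hu h)
      rw [Finset.card_insert_of_notMem hat, Finset.card_insert_of_notMem hau]
      ring
    rw [Finset.sum_congr rfl this, ih (fun u => h (insert a u) - h u)]

theorem altSum_of_injective [DecidableEq α] {n : ℕ} (H : Set α → ℝ) {x : Fin n → α}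
    (hx : Function.Injective x) :
    altSum H x = ∑ u ∈ (Finset.univ.image x).powerset,
      (-1) ^ ((Finset.univ.image x).card + u.card) * H u := by
  have him : Finset.univ.image x = Finset.univ.map ⟨x, hx⟩ := (Finset.map_eq_image ⟨x, hx⟩ _).symm
  rw [him, Finset.card_map, Finset.card_univ]
  refine Finset.sum_bij (fun v _ => v.map ⟨x, hx⟩) (fun v _ => ?_) (fun v _ w _ h => ?_)
    (fun u hu => ?_) fun v _ => ?_
  · simp [Finset.map_subset_map]
  · exact Finset.map_injective _ h
  · obtain ⟨v, -, rfl⟩ := Finset.subset_map_iff.1 (Finset.mem_powerset.1 hu)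
    exact ⟨v, Finset.mem_univ _, rfl⟩
  · simp

/-- Inclusion-exclusion: a function of a finite set is recovered from its iterated differences
along the tuples of distinct points of the set. -/
theorem hasSum_tsum_altSum {S : Set α} (hS : S.Finite) (H : Set α → ℝ) :
    HasSum (fun n : ℕ => (n.factorial : ℝ)⁻¹ * ∑' x : Tuples n S, altSum H x.1) (H S) := by
  classical
  obtain ⟨s, rfl⟩ := hS.exists_finset_coe
  have hterm : ∀ n : ℕ, (n.factorial : ℝ)⁻¹ * ∑' x : Tuples n (s : Set α), altSum H x.1 =
      ∑ t ∈ s.powersetCard n, ∑ u ∈ t.powerset, (-1) ^ (t.card + u.card) * H u := by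
    intro n
    rw [tsum_congr (fun x : Tuples n (s : Set α) => altSum_of_injective H x.2.1),
      tsum_tuples_image n s (fun t => ∑ u ∈ t.powerset, (-1) ^ (t.card + u.card) * H u),
      inv_mul_cancel_left₀ (by positivity)]
  simp_rw [hterm]
  have h := hasSum_sum_of_ne_finset_zero (L := .unconditional ℕ) (s := Finset.range (s.card + 1))
    (f := fun n => ∑ t ∈ s.powersetCard n, ∑ u ∈ t.powerset, (-1) ^ (t.card + u.card) * H u)
    (fun n hn => by
      rw [Finset.powersetCard_eq_empty.2 (by simpa [Nat.lt_succ_iff] using hn), Finset.sum_empty])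
  rwa [← Finset.sum_powerset, sum_powerset_alternating s (fun u => H u)] at h

end Tuples

end PointProcess

/-! ### Splitting product measures -/

namespace PointProcess

section Split

variable {α : Type*} [MeasurableSpace α] {ι κ₁ κ₂ : Type*}

/-- Two tuples, glued to one along a decomposition of the index set. -/
def glueEquiv (α : Type*) [MeasurableSpace α] (e : κ₁ ⊕ κ₂ ≃ ι) :
    ((κ₁ → α) × (κ₂ → α)) ≃ᵐ (ι → α) :=
  (MeasurableEquiv.sumPiEquivProdPi fun _ => α).symm.trans
    (MeasurableEquiv.piCongrLeft (fun _ => α) e)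

theorem glueEquiv_apply (e : κ₁ ⊕ κ₂ ≃ ι) (p : (κ₁ → α) × (κ₂ → α)) :
    glueEquiv α e p = Sum.elim p.1 p.2 ∘ e.symm := by
  funext i
  obtain ⟨a, rfl⟩ := e.surjective i
  have : glueEquiv α e p (e a) =
      Equiv.piCongrLeft (fun _ => α) e ((Equiv.sumPiEquivProdPi fun _ => α).symm p) (e a) := rfl
  rw [this, Equiv.piCongrLeft_apply_apply]
  cases a <;> simp

variable [Fintype ι] [Fintype κ₁] [Fintype κ₂]

theorem measurePreserving_glueEquiv (e : κ₁ ⊕ κ₂ ≃ ι) (ν : ι → Measure α)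
    [∀ i, SigmaFinite (ν i)] :
    MeasurePreserving (glueEquiv α e)
      ((Measure.pi fun i => ν (e (Sum.inl i))).prod (Measure.pi fun i => ν (e (Sum.inr i))))
      (Measure.pi ν) :=
  (measurePreserving_sumPiEquivProdPi_symm fun i => ν (e i)).trans
    (measurePreserving_piCongrLeft ν e)

theorem pi_add (ν₁ ν₂ : Measure α) [SigmaFinite ν₁] [SigmaFinite ν₂] [DecidableEq ι] :
    Measure.pi (fun _ : ι => ν₁ + ν₂) =
      ∑ u : Finset ι, Measure.pi fun i => if i ∈ u then ν₁ else ν₂ := by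
  have : ∀ (u : Finset ι) i, SigmaFinite (if i ∈ u then ν₁ else ν₂) := by
    intro u i; split_ifs <;> infer_instance
  refine Measure.pi_eq fun s _ => ?_
  rw [Measure.coe_finsetSum, Finset.sum_apply]
  simp_rw [Measure.pi_pi, Measure.add_apply]
  rw [Finset.prod_add, Finset.powerset_univ]
  refine Finset.sum_congr rfl fun u _ => ?_
  rw [← Finset.prod_mul_prod_compl u, Finset.compl_eq_univ_sdiff]
  congr 1 <;> refine Finset.prod_congr rfl fun i hi => ?_
  · rw [if_pos hi]
  · rw [if_neg (Finset.mem_sdiff.1 hi).2]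

theorem sum_finset_card_compl {M : Type*} [AddCommMonoid M] (n : ℕ) (f : ℕ → ℕ → M) :
    ∑ u : Finset (Fin n), f u.card uᶜ.card =
      ∑ p ∈ Finset.HasAntidiagonal.antidiagonal n, n.choose p.1 • f p.1 p.2 := by
  rw [Finset.Nat.sum_antidiagonal_eq_sum_range_succ_mk]
  have h := Finset.sum_powerset_apply_card (fun k => f k (n - k)) (x := (Finset.univ : Finset (Fin n)))
  rw [Finset.powerset_univ, Finset.card_univ, Fintype.card_fin] at h
  rw [← h]
  refine Finset.sum_congr rfl fun u _ => ?_
  rw [Finset.card_compl, Fintype.card_fin]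

/-- The product of `ν₁ + ν₂` splits according to the set of coordinates that are governed by `ν₁`.
The bound `τ k l` has to hold for every way of interlacing `k` and `l` coordinates. -/
theorem lintegral_pi_add_le (ν₁ ν₂ : Measure α) [SigmaFinite ν₁] [SigmaFinite ν₂] {n : ℕ}
    (g : (Fin n → α) → ℝ≥0∞) (τ : ℕ → ℕ → ℝ≥0∞)
    (h : ∀ (k l : ℕ) (e : Fin k ⊕ Fin l ≃ Fin n),
      ∫⁻ p, g (Sum.elim p.1 p.2 ∘ e.symm)
        ∂(Measure.pi fun _ : Fin k => ν₁).prod (Measure.pi fun _ : Fin l => ν₂) ≤ τ k l) :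
    ∫⁻ z, g z ∂(Measure.pi fun _ : Fin n => ν₁ + ν₂) ≤
      ∑ p ∈ Finset.HasAntidiagonal.antidiagonal n, n.choose p.1 • τ p.1 p.2 := by
  rw [pi_add, lintegral_finsetSum_measure, ← sum_finset_card_compl]
  refine Finset.sum_le_sum fun u _ => ?_
  have : ∀ i, SigmaFinite (if i ∈ u then ν₁ else ν₂) := by
    intro i; split_ifs <;> infer_instance
  have hm := measurePreserving_glueEquiv (finSumEquivOfFinset (s := u) rfl rfl)
    (fun i => if i ∈ u then ν₁ else ν₂)
  have hl : ∀ i, finSumEquivOfFinset (s := u) rfl rfl (Sum.inl i) ∈ u := fun i => by simp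
  have hr : ∀ i, finSumEquivOfFinset (s := u) rfl rfl (Sum.inr i) ∉ u := fun i => by
    rw [finSumEquivOfFinset_inr]
    exact Finset.mem_compl.1 (Finset.orderEmbOfFin_mem _ _ _)
  simp only [hl, hr, if_true, if_false] at hm
  rw [← hm.map_eq, lintegral_map_equiv]
  simp_rw [glueEquiv_apply]
  exact h _ _ _

theorem integral_pi_add (ν₁ ν₂ : Measure α) [IsFiniteMeasure ν₁] [IsFiniteMeasure ν₂] {n : ℕ}
    (g : (Fin n → α) → ℝ) (hg : Integrable g (Measure.pi fun _ : Fin n => ν₁ + ν₂))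
    (τ : ℕ → ℕ → ℝ)
    (h : ∀ (k l : ℕ) (e : Fin k ⊕ Fin l ≃ Fin n),
      ∫ p, g (Sum.elim p.1 p.2 ∘ e.symm)
        ∂(Measure.pi fun _ : Fin k => ν₁).prod (Measure.pi fun _ : Fin l => ν₂) = τ k l) :
    ∫ z, g z ∂(Measure.pi fun _ : Fin n => ν₁ + ν₂) =
      ∑ p ∈ Finset.HasAntidiagonal.antidiagonal n, n.choose p.1 • τ p.1 p.2 := by
  have hg' : ∀ u ∈ (Finset.univ : Finset (Finset (Fin n))),
      Integrable g (Measure.pi fun i => if i ∈ u then ν₁ else ν₂) := by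
    rw [pi_add, integrable_finsetSum_measure] at hg
    exact hg
  rw [pi_add, integral_finsetSum_measure hg', ← sum_finset_card_compl]
  refine Finset.sum_congr rfl fun u _ => ?_
  have : ∀ i, SigmaFinite (if i ∈ u then ν₁ else ν₂) := by
    intro i; split_ifs <;> infer_instance
  have hm := measurePreserving_glueEquiv (finSumEquivOfFinset (s := u) rfl rfl)
    (fun i => if i ∈ u then ν₁ else ν₂)
  have hl : ∀ i, finSumEquivOfFinset (s := u) rfl rfl (Sum.inl i) ∈ u := fun i => by simp
  have hr : ∀ i, finSumEquivOfFinset (s := u) rfl rfl (Sum.inr i) ∉ u := fun i => by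
    rw [finSumEquivOfFinset_inr]
    exact Finset.mem_compl.1 (Finset.orderEmbOfFin_mem _ _ _)
  simp only [hl, hr, if_true, if_false] at hm
  rw [← hm.integral_comp']
  simp_rw [glueEquiv_apply]
  exact h _ _ _

/-- The integral of a sum over sets `S` of coordinates, if the terms depend only on the number of
coordinates inside and outside `S`. -/
theorem integral_sum_finset (ν : Measure α) [IsFiniteMeasure ν] {n : ℕ}
    (g : Finset (Fin n) → (Fin n → α) → ℝ) (hg : ∀ S, Integrable (g S) (Measure.pi fun _ => ν))
    (τ : ℕ → ℕ → ℝ)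
    (h : ∀ (S : Finset (Fin n)) (k l : ℕ) (e : Fin k ⊕ Fin l ≃ Fin n),
      (∀ i, e (Sum.inl i) ∈ S) → (∀ i, e (Sum.inr i) ∉ S) →
      ∫ p, g S (Sum.elim p.1 p.2 ∘ e.symm)
        ∂(Measure.pi fun _ : Fin k => ν).prod (Measure.pi fun _ : Fin l => ν) = τ k l) :
    ∫ z, ∑ S, g S z ∂(Measure.pi fun _ : Fin n => ν) =
      ∑ p ∈ Finset.HasAntidiagonal.antidiagonal n, n.choose p.1 • τ p.1 p.2 := by
  rw [integral_finsetSum _ fun S _ => hg S, ← sum_finset_card_compl]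
  refine Finset.sum_congr rfl fun u _ => ?_
  have hm := measurePreserving_glueEquiv (finSumEquivOfFinset (s := u) rfl rfl) (fun _ => ν)
  rw [← hm.integral_comp']
  simp_rw [glueEquiv_apply]
  refine h u _ _ _ (fun i => by simp) fun i => ?_
  rw [finSumEquivOfFinset_inr]
  exact Finset.mem_compl.1 (Finset.orderEmbOfFin_mem _ _ _)

theorem ae_pi_pair (ν : Measure α) [SigmaFinite ν] {p : α → α → Prop}
    (hp : ∀ᵐ q ∂ν.prod ν, p q.1 q.2) :
    ∀ᵐ z ∂(Measure.pi fun _ : ι => ν), ∀ i j, i ≠ j → p (z i) (z j) := by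
  classical
  simp_rw [ae_all_iff]
  intro i j hij
  obtain ⟨Q, hi, hj⟩ : ∃ Q : ι → Prop, Q i ∧ ¬ Q j := ⟨fun k => k = i, rfl, hij.symm⟩
  have h1 := measurePreserving_piEquivPiSubtypeProd (fun _ : ι => ν) Q
  have h2 := QuasiMeasurePreserving.prodMap
    (Measure.quasiMeasurePreserving_eval (fun _ : Subtype Q => ν) ⟨i, hi⟩)
    (Measure.quasiMeasurePreserving_eval (fun _ : {k // ¬ Q k} => ν) ⟨j, hj⟩)
  exact (h2.comp h1.quasiMeasurePreserving).ae hp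

theorem inv_factorial_mul_choose {n k l : ℕ} (h : k + l = n) :
    (n.factorial : ℝ)⁻¹ * n.choose k = (k.factorial : ℝ)⁻¹ * (l.factorial : ℝ)⁻¹ := by
  subst h
  have h : ((k + l).choose k : ℝ) * k.factorial * l.factorial = (k + l).factorial := by
    rw [Nat.choose_symm_add]
    exact_mod_cast Nat.add_choose_mul_factorial_mul_factorial k l
  rw [← h]
  have : ((k + l).choose k : ℝ) ≠ 0 := by exact_mod_cast (Nat.choose_pos (Nat.le_add_right k l)).ne'
  field_simp

end Split

end PointProcess

/-! ### Expectations of functions of a random finite set -/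

namespace PointProcess

/-- A summand of a measurable function is almost everywhere measurable as soon as the lower
integrals of the two summands add up: measurable minorants with the same integrals then add up to the sum. -/
theorem aemeasurable_of_lintegral_add {Ω : Type*} [MeasurableSpace Ω] {P : Measure Ω}
    {h h' : Ω → ℝ≥0∞} (hm : AEMeasurable (h + h') P) (hfin : ∫⁻ w, (h + h') w ∂P ≠ ∞)
    (heq : ∫⁻ w, h w ∂P + ∫⁻ w, h' w ∂P = ∫⁻ w, (h + h') w ∂P) : AEMeasurable h P := by
  obtain ⟨g, hg, hgh, hgi⟩ := exists_measurable_le_lintegral_eq P h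
  obtain ⟨g', hg', hgh', hgi'⟩ := exists_measurable_le_lintegral_eq P h'
  have hle : g + g' ≤ h + h' := add_le_add hgh hgh'
  have hint : ∫⁻ w, (g + g') w ∂P = ∫⁻ w, (h + h') w ∂P := by
    simp only [Pi.add_apply] at heq ⊢
    rw [lintegral_add_left hg, ← hgi, ← hgi', heq]
  have hae : g + g' =ᵐ[P] h + h' :=
    ae_eq_of_ae_le_of_lintegral_le (ae_of_all _ hle) (hint ▸ hfin) hm hint.ge
  refine ⟨g, hg, ?_⟩
  filter_upwards [hae, ae_lt_top' hm hfin] with w hw hwt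
  refine le_antisymm ?_ (hgh w)
  by_contra hlt
  rw [not_le] at hlt
  simp only [Pi.add_apply] at hw hwt
  have h1 : g w + g' w < h w + h' w :=
    ENNReal.add_lt_add_of_lt_of_le ((le_trans (hgh' w) (le_add_left le_rfl)).trans_lt hwt).ne
      hlt (hgh' w)
  exact h1.ne hw

theorem tsum_toReal {α : Type*} {n : ℕ} {T : Set α} (hT : T.Finite) (f : (Fin n → α) → ℝ) :
    ∑' x : Tuples n T, f x.1 = (∑' x : Tuples n T, ENNReal.ofReal (f x.1)).toReal -
      (∑' x : Tuples n T, ENNReal.ofReal (-f x.1)).toReal := by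
  have : Finite T := hT
  have := Fintype.ofFinite (Tuples n T)
  rw [tsum_fintype, tsum_fintype, tsum_fintype, ENNReal.toReal_sum (by simp),
    ENNReal.toReal_sum (by simp), ← Finset.sum_sub_distrib]
  refine Finset.sum_congr rfl fun x _ => ?_
  rw [ENNReal.toReal_ofReal', ENNReal.toReal_ofReal']
  rcases le_total 0 (f x.1) with h0 | h0
  · rw [max_eq_left h0, max_eq_right (by linarith)]; ring
  · rw [max_eq_right h0, max_eq_left (by linarith)]; ring

variable {α : Type*} [MeasurableSpace α] {Ω : Type*} [MeasurableSpace Ω]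

/-- The random set `S` has the `n`-th order intensity functions `ρ n` with respect to `ν`, and
`0 ≤ ρ n ≤ Mⁿ`. -/
structure HasIntensities (P : Measure Ω) (ν : Measure α) (S : Ω → Set α)
    (ρ : ∀ n : ℕ, (Fin n → α) → ℝ) (M : ℝ) : Prop where
  measurable_encard : Measurable[_, ⊤] fun w => (S w).encard
  nonneg : ∀ n x, 0 ≤ ρ n x
  le_pow : ∀ n x, ρ n x ≤ M ^ n
  bound_nonneg : 0 ≤ M
  measurable : ∀ n, Measurable (ρ n)
  lintegral_tuples : ∀ (n : ℕ) (f : (Fin n → α) → ℝ≥0∞), Measurable f →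
    ∫⁻ w, ∑' x : Tuples n (S w), f x.1 ∂P =
      ∫⁻ x, f x * ENNReal.ofReal (ρ n x) ∂(Measure.pi fun _ => ν)

namespace HasIntensities

variable {P : Measure Ω} {ν : Measure α} [IsFiniteMeasure ν]
  {S : Ω → Set α} {ρ : ∀ n : ℕ, (Fin n → α) → ℝ} {M : ℝ}

theorem lintegral_le (h : HasIntensities P ν S ρ M) (n : ℕ) :
    ∫⁻ x, ENNReal.ofReal (ρ n x) ∂(Measure.pi fun _ => ν) ≤
      ENNReal.ofReal ((M * ν.real Set.univ) ^ n) := by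
  calc _ ≤ ∫⁻ x : Fin n → α, ENNReal.ofReal (M ^ n) ∂(Measure.pi fun _ => ν) :=
        lintegral_mono fun x => ENNReal.ofReal_le_ofReal (h.le_pow n x)
    _ = _ := by
        rw [lintegral_const, Measure.pi_univ, mul_pow, ENNReal.ofReal_mul (pow_nonneg h.bound_nonneg _),
          ENNReal.ofReal_pow measureReal_nonneg, ofReal_measureReal]
        simp

theorem ae_finite (h : HasIntensities P ν S ρ M) : ∀ᵐ w ∂P, (S w).Finite := by
  have hms : MeasurableSet {w | (S w).encard = ⊤} :=
    h.measurable_encard (t := {⊤}) trivial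
  have h1 := h.lintegral_tuples 1 (fun _ => 1) measurable_const
  simp only [one_mul] at h1
  have h2 : ∫⁻ w, ∑' x : Tuples 1 (S w), (1 : ℝ≥0∞) ∂P ≠ ∞ := by
    rw [h1]
    exact ((h.lintegral_le 1).trans_lt ENNReal.ofReal_lt_top).ne
  have h3 : ∞ * P {w | (S w).encard = ⊤} ≤ ∫⁻ w, ∑' x : Tuples 1 (S w), (1 : ℝ≥0∞) ∂P := by
    rw [← lintegral_indicator_const hms]
    refine lintegral_mono fun w => ?_
    by_cases hw : (S w).encard = ⊤
    · have hinf : Infinite (S w) := Set.infinite_coe_iff.2 (Set.encard_eq_top_iff.1 hw)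
      have : Infinite (Tuples 1 (S w)) := by
        have e : (Fin 1 ↪ S w) ≃ S w :=
          { toFun := fun f => f 0
            invFun := fun a => ⟨fun _ => a, fun _ _ _ => Subsingleton.elim _ _⟩
            left_inv := fun f => by ext i; rw [Subsingleton.elim i 0]; rfl
            right_inv := fun a => rfl }
        exact Infinite.of_injective _ ((e.symm.trans (embeddingEquivTuples 1 (S w))).injective)
      simp
    · rw [Set.indicator_of_notMem (by exact hw)]
      exact zero_le
  have h4 : P {w | (S w).encard = ⊤} = 0 := by
    by_contra h0
    rw [ENNReal.top_mul h0, top_le_iff] at h3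
    exact h2 h3
  have : ∀ᵐ w ∂P, ¬ (S w).encard = ⊤ := by rw [ae_iff]; simpa using h4
  filter_upwards [this] with w hw
  exact Set.encard_ne_top_iff.1 hw

theorem aemeasurable_tsum_const (h : HasIntensities P ν S ρ M) (n : ℕ) (C : ℝ≥0∞) :
    AEMeasurable (fun w => ∑' _ : Tuples n (S w), C) P := by
  refine ⟨fun w => ((S w).encard.toNat.descFactorial n : ℝ≥0∞) * C, ?_, ?_⟩
  · have hg : Measurable[⊤] fun k : ℕ∞ => (k.toNat.descFactorial n : ℝ≥0∞) * C :=
      measurable_from_top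
    exact hg.comp h.measurable_encard
  · filter_upwards [h.ae_finite] with w hw
    have : Finite (S w) := hw
    have := Fintype.ofFinite (S w)
    have := Fintype.ofFinite (Tuples n (S w))
    rw [tsum_fintype, Finset.sum_const, Finset.card_univ,
      ← Fintype.card_congr (embeddingEquivTuples n (S w)), Fintype.card_embedding_eq,
      Fintype.card_fin, nsmul_eq_mul, ← Nat.card_eq_fintype_card, Nat.card_coe_set_eq]
    rfl

theorem lintegral_tsum_const_lt_top (h : HasIntensities P ν S ρ M) (n : ℕ) {C : ℝ≥0∞} (hC : C ≠ ∞) :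
    ∫⁻ w, ∑' _ : Tuples n (S w), C ∂P < ∞ := by
  rw [h.lintegral_tuples n (fun _ => C) measurable_const, lintegral_const_mul' _ _ hC]
  exact ENNReal.mul_lt_top hC.lt_top ((h.lintegral_le n).trans_lt ENNReal.ofReal_lt_top)

/-- The sum of a bounded function over the tuples of points is almost everywhere measurable.
Its lower integral is known; so is that of the complementary sum, and the two add up to the
integral of a function of the number of points. -/
theorem aemeasurable_tsum (h : HasIntensities P ν S ρ M) {n : ℕ} {f : (Fin n → α) → ℝ≥0∞}
    (hf : Measurable f) {C : ℝ≥0∞} (hC : C ≠ ∞) (hfC : ∀ x, f x ≤ C) :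
    AEMeasurable (fun w => ∑' x : Tuples n (S w), f x.1) P := by
  have hadd : (fun w => ∑' x : Tuples n (S w), f x.1) +
      (fun w => ∑' x : Tuples n (S w), (C - f x.1)) = fun w => ∑' _ : Tuples n (S w), C := by
    funext w
    simp only [Pi.add_apply]
    rw [← ENNReal.tsum_add]
    simp only [add_tsub_cancel_of_le (hfC _)]
  refine aemeasurable_of_lintegral_add (h' := fun w => ∑' x : Tuples n (S w), (C - f x.1)) ?_ ?_ ?_
  · rw [hadd]; exact h.aemeasurable_tsum_const n C
  · rw [hadd]; exact (h.lintegral_tsum_const_lt_top n hC).ne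
  · rw [hadd, h.lintegral_tuples n f hf, h.lintegral_tuples n (fun x => C - f x) (by fun_prop),
      h.lintegral_tuples n (fun _ => C) measurable_const,
      ← lintegral_add_left (show Measurable fun x => f x * ENNReal.ofReal (ρ n x) from
        hf.mul (h.measurable n).ennreal_ofReal)]
    simp only [← add_mul, add_tsub_cancel_of_le (hfC _)]

theorem integrable_tsum (h : HasIntensities P ν S ρ M) {n : ℕ} {f : (Fin n → α) → ℝ}
    (hf : Measurable f) {C : ℝ} (hfC : ∀ x, |f x| ≤ C) :
    Integrable (fun w => ∑' x : Tuples n (S w), f x.1) P ∧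
    ∫ w, ∑' x : Tuples n (S w), f x.1 ∂P = ∫ x, f x * ρ n x ∂(Measure.pi fun _ => ν) := by
  have hpos : ∀ x, ENNReal.ofReal (f x) ≤ ENNReal.ofReal C := fun x =>
    ENNReal.ofReal_le_ofReal ((le_abs_self _).trans (hfC x))
  have hneg : ∀ x, ENNReal.ofReal (-f x) ≤ ENNReal.ofReal C := fun x =>
    ENNReal.ofReal_le_ofReal ((neg_le_abs _).trans (hfC x))
  have m1 := h.aemeasurable_tsum hf.ennreal_ofReal ENNReal.ofReal_ne_top hpos
  have m2 : AEMeasurable (fun w => ∑' x : Tuples n (S w), ENNReal.ofReal (-f x.1)) P :=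
    h.aemeasurable_tsum hf.neg.ennreal_ofReal ENNReal.ofReal_ne_top hneg
  have f1 : ∫⁻ w, ∑' x : Tuples n (S w), ENNReal.ofReal (f x.1) ∂P < ∞ :=
    (lintegral_mono fun w => ENNReal.tsum_le_tsum fun x : Tuples n (S w) => hpos x.1).trans_lt
      (h.lintegral_tsum_const_lt_top n ENNReal.ofReal_ne_top)
  have f2 : ∫⁻ w, ∑' x : Tuples n (S w), ENNReal.ofReal (-f x.1) ∂P < ∞ :=
    (lintegral_mono fun w => ENNReal.tsum_le_tsum fun x : Tuples n (S w) => hneg x.1).trans_lt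
      (h.lintegral_tsum_const_lt_top n ENNReal.ofReal_ne_top)
  have hae : (fun w => ∑' x : Tuples n (S w), f x.1) =ᵐ[P] fun w =>
      (∑' x : Tuples n (S w), ENNReal.ofReal (f x.1)).toReal -
      (∑' x : Tuples n (S w), ENNReal.ofReal (-f x.1)).toReal := by
    filter_upwards [h.ae_finite] with w hw using tsum_toReal hw f
  have i1 := integrable_toReal_of_lintegral_ne_top m1 f1.ne
  have i2 := integrable_toReal_of_lintegral_ne_top m2 f2.ne
  refine ⟨(i1.sub i2).congr hae.symm, ?_⟩
  have hint : Integrable (fun x => f x * ρ n x) (Measure.pi fun _ : Fin n => ν) := by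
    refine Integrable.of_bound (C := C * M ^ n) (hf.mul (h.measurable n)).aestronglyMeasurable
      (ae_of_all _ fun x => ?_)
    rw [Real.norm_eq_abs, abs_mul, abs_of_nonneg (h.nonneg n x)]
    exact mul_le_mul (hfC x) (h.le_pow n x) (h.nonneg n x) ((abs_nonneg _).trans (hfC x))
  rw [integral_congr_ae hae, integral_sub i1 i2,
    integral_toReal m1 (ae_lt_top' m1 f1.ne), integral_toReal m2 (ae_lt_top' m2 f2.ne),
    h.lintegral_tuples n (fun x => ENNReal.ofReal (f x)) hf.ennreal_ofReal,
    h.lintegral_tuples n (fun x => ENNReal.ofReal (-f x)) hf.neg.ennreal_ofReal,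
    integral_eq_lintegral_pos_part_sub_lintegral_neg_part hint]
  simp only [← neg_mul, ENNReal.ofReal_mul' (h.nonneg n _)]

theorem integral_norm_tsum_le (h : HasIntensities P ν S ρ M) {n : ℕ} {f : (Fin n → α) → ℝ}
    (hf : Measurable f) {C : ℝ} (hfC : ∀ x, |f x| ≤ C) (hC : 0 ≤ C) :
    ∫ w, ‖∑' x : Tuples n (S w), f x.1‖ ∂P ≤ C * (M * ν.real Set.univ) ^ n := by
  have h1 := h.integrable_tsum (n := n) (f := fun _ => C) measurable_const
    (C := C) (fun _ => (abs_of_nonneg hC).le)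
  calc _ ≤ ∫ w, ∑' _ : Tuples n (S w), C ∂P := by
        refine integral_mono_ae (h.integrable_tsum hf hfC).1.norm h1.1 ?_
        filter_upwards [h.ae_finite] with w hw
        have : Finite (S w) := hw
        have := Fintype.ofFinite (Tuples n (S w))
        rw [tsum_fintype, tsum_fintype]
        exact (norm_sum_le _ _).trans (Finset.sum_le_sum fun x _ => hfC _)
    _ = C * ∫ x, ρ n x ∂(Measure.pi fun _ => ν) := by rw [h1.2, integral_const_mul]
    _ ≤ _ := by
        refine mul_le_mul_of_nonneg_left ?_ hC
        rw [integral_eq_lintegral_of_nonneg_ae (ae_of_all _ (h.nonneg n))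
          (h.measurable n).aestronglyMeasurable]
        exact ENNReal.toReal_le_of_le_ofReal (pow_nonneg
          (mul_nonneg h.bound_nonneg measureReal_nonneg) _) (h.lintegral_le n)

/-- The expectation of a bounded function of a random finite set, expanded in the intensity
functions. -/
theorem hasSum_integral (h : HasIntensities P ν S ρ M) {H : Set α → ℝ} (hH : ∀ s, |H s| ≤ 1)
    (hHm : ∀ n, Measurable fun x : Fin n → α => altSum H x) :
    HasSum (fun n : ℕ => (n.factorial : ℝ)⁻¹ *
      ∫ x, altSum H x * ρ n x ∂(Measure.pi fun _ => ν)) (∫ w, H (S w) ∂P) := by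
  have hb : ∀ n (x : Fin n → α), |altSum H x| ≤ 2 ^ n := fun n x => by
    simpa using abs_altSum_le (z := x) fun _ => hH _
  have hi := fun n => h.integrable_tsum (hHm n) (hb n)
  have hs := hasSum_integral_of_summable_integral_norm (μ := P)
    (F := fun (n : ℕ) w => (n.factorial : ℝ)⁻¹ * ∑' x : Tuples n (S w), altSum H x.1)
    (fun n => (hi n).1.const_mul _) ?_
  · have h2 : ∫ w, ∑' n : ℕ, (n.factorial : ℝ)⁻¹ * ∑' x : Tuples n (S w), altSum H x.1 ∂P =
        ∫ w, H (S w) ∂P := by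
      refine integral_congr_ae ?_
      filter_upwards [h.ae_finite] with w hw using (hasSum_tsum_altSum hw H).tsum_eq
    rw [h2] at hs
    refine hs.congr_fun fun n => ?_
    rw [integral_const_mul, (hi n).2]
  · refine Summable.of_nonneg_of_le (fun n => integral_nonneg fun w => norm_nonneg _) (fun n => ?_)
      (Real.summable_pow_div_factorial (2 * (M * ν.real Set.univ)))
    simp_rw [norm_mul]
    rw [integral_const_mul, Real.norm_of_nonneg (by positivity), mul_pow, div_eq_inv_mul]
    exact mul_le_mul_of_nonneg_left (h.integral_norm_tsum_le (hHm n) (hb n) (by positivity))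
      (by positivity)

end HasIntensities

end PointProcess

noncomputable section

/-! ### Determinants of kernels -/

namespace PointProcess

open Matrix

variable {α : Type*} {ι κ : Type*} [Fintype ι] [Fintype κ] [DecidableEq ι] [DecidableEq κ]

/-- The matrix `L(zᵢ, zⱼ)`. -/
abbrev kernelMatrix (L : α → α → ℝ) (z : ι → α) : Matrix ι ι ℝ :=
  Matrix.of fun i j => L (z i) (z j)

/-- `det L(zᵢ, zⱼ)`. -/
def kernelDet (L : α → α → ℝ) (z : ι → α) : ℝ := (kernelMatrix L z).det

theorem kernelDet_comp_equiv (L : α → α → ℝ) (z : ι → α) (e : κ ≃ ι) :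
    kernelDet L (z ∘ e) = kernelDet L z :=
  det_submatrix_equiv_self e (kernelMatrix L z)

theorem measurable_kernelDet [MeasurableSpace α] {L : α → α → ℝ}
    (hL : Measurable (Function.uncurry L)) : Measurable fun z : ι → α => kernelDet L z := by
  unfold kernelDet
  simp only [det_apply]
  refine Finset.measurable_fun_sum _ fun σ _ => Measurable.const_smul ?_ _
  refine Finset.measurable_fun_prod _ fun i _ => ?_
  have h := (measurable_pi_apply (σ i)).prodMk (measurable_pi_apply (X := fun _ => α) i)
  exact hL.comp h

/-- All matrices `L(zᵢ, zⱼ)` are positive semidefinite. -/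
def IsPSDKernel (L : α → α → ℝ) : Prop :=
  ∀ (n : ℕ) (z : Fin n → α), (kernelMatrix L z).PosSemidef

namespace IsPSDKernel

variable {L : α → α → ℝ}

theorem posSemidef {τ : Type*} [Fintype τ] (hL : IsPSDKernel L) (z : τ → α) :
    (kernelMatrix L z).PosSemidef := by
  have h := hL _ (z ∘ (Fintype.equivFin τ).symm)
  have h2 := h.submatrix (Fintype.equivFin τ)
  convert h2
  ext i j
  simp

theorem symm (hL : IsPSDKernel L) (x y : α) : L x y = L y x := by
  have h := (hL 2 ![x, y]).1.apply 1 0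
  simpa using h

theorem diag_nonneg (hL : IsPSDKernel L) (x : α) : 0 ≤ L x x :=
  (hL 1 fun _ => x).diag_nonneg (i := 0)

theorem kernelDet_nonneg (hL : IsPSDKernel L) (z : ι → α) : 0 ≤ kernelDet L z :=
  (hL.posSemidef z).det_nonneg

theorem kernelDet_le (hL : IsPSDKernel L) {M : ℝ} (hM : ∀ x, L x x ≤ M) (z : ι → α) :
    kernelDet L z ≤ M ^ Fintype.card ι := by
  refine (det_le_prod_diag (hL.posSemidef z)).trans ?_
  refine (Finset.prod_le_prod (fun i _ => hL.diag_nonneg (z i)) fun i _ => hM (z i)).trans_eq ?_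
  simp

theorem add_sub_nonneg (hL : IsPSDKernel L) (x y : α) : 0 ≤ L x x + L y y - 2 * L x y := by
  have h := (hL 2 ![x, y]).dotProduct_mulVec_nonneg ![1, -1]
  have h1 := hL.symm x y
  simp [Matrix.mulVec, dotProduct, Fin.sum_univ_two] at h
  linarith

end IsPSDKernel

open scoped Classical in
/-- The kernel `L` with the entries between `A` and its complement replaced by `0`. -/
def blockKernel (A : Set α) (L : α → α → ℝ) (x y : α) : ℝ :=
  if (x ∈ A ↔ y ∈ A) then L x y else 0

theorem blockKernel_self (A : Set α) (L : α → α → ℝ) (x : α) : blockKernel A L x x = L x x := by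
  simp [blockKernel]

theorem measurable_blockKernel [MeasurableSpace α] {A : Set α} (hA : MeasurableSet A)
    {L : α → α → ℝ} (hL : Measurable (Function.uncurry L)) :
    Measurable (Function.uncurry (blockKernel A L)) := by
  have hs : MeasurableSet {p : α × α | p.1 ∈ A ↔ p.2 ∈ A} :=
    (measurable_fst hA).iff (measurable_snd hA)
  exact Measurable.ite hs hL measurable_const

theorem IsPSDKernel.blockKernel {L : α → α → ℝ} (hL : IsPSDKernel L) (A : Set α) :
    IsPSDKernel (blockKernel A L) := by
  classical
  intro n z
  let a : Fin n → ℝ := fun i => if z i ∈ A then 1 else 0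
  let b : Fin n → ℝ := fun i => if z i ∈ A then 0 else 1
  have hP : (vecMulVec a (star a) + vecMulVec b (star b)).PosSemidef :=
    (posSemidef_vecMulVec_self_star a).add (posSemidef_vecMulVec_self_star b)
  have h := (hL n z).hadamard hP
  have heq : kernelMatrix (PointProcess.blockKernel A L) z =
      kernelMatrix L z ⊙ (vecMulVec a (star a) + vecMulVec b (star b)) := ?_
  · rw [heq]; exact h
  ext i j
  by_cases hi : z i ∈ A <;> by_cases hj : z j ∈ A <;>
    simp [PointProcess.blockKernel, vecMulVec, a, b, hi, hj]

theorem kernelDet_blockKernel {A : Set α} (L : α → α → ℝ) {x : ι → α} {y : κ → α}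
    (hx : ∀ i, x i ∈ A) (hy : ∀ i, y i ∉ A) :
    kernelDet (blockKernel A L) (Sum.elim x y) = kernelDet L x * kernelDet L y := by
  have h : kernelMatrix (blockKernel A L) (Sum.elim x y) =
      fromBlocks (kernelMatrix L x) 0 0 (kernelMatrix L y) := by
    ext (i | i) (j | j) <;> simp [blockKernel, hx, hy]
  rw [kernelDet, h, det_fromBlocks_zero₂₁]
  rfl

theorem IsPSDKernel.kernelDet_sumElim_bounds {L : α → α → ℝ} (hL : IsPSDKernel L)
    (x : ι → α) (y : κ → α) :
    kernelDet L (Sum.elim x y) ≤ kernelDet L x * kernelDet L y ∧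
      kernelDet L x * kernelDet L y - kernelDet L (Sum.elim x y) ≤
        (kernelMatrix L x).adjugate.trace * (kernelMatrix L y).adjugate.trace *
          ∑ i, ∑ j, L (x i) (y j) ^ 2 := by
  have h : kernelMatrix L (Sum.elim x y) = fromBlocks (kernelMatrix L x)
      (Matrix.of fun i j => L (x i) (y j)) (Matrix.of fun i j => L (x i) (y j))ᵀ
      (kernelMatrix L y) := by
    ext (i | i) (j | j) <;> simp
    exact hL.symm _ _
  have hp := hL.posSemidef (Sum.elim x y)
  rw [h] at hp
  have := det_fromBlocks_bounds hp
  rw [← h] at this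
  exact this

theorem IsPSDKernel.trace_adjugate_nonneg {L : α → α → ℝ} (hL : IsPSDKernel L) {n : ℕ}
    (x : Fin n → α) : 0 ≤ (kernelMatrix L x).adjugate.trace := by
  cases n with
  | zero => simp [trace]
  | succ n =>
    rw [trace_adjugate_fin]
    exact Finset.sum_nonneg fun i _ => hL.kernelDet_nonneg (x ∘ Fin.succAbove i)

/-- If `K = L + diag c` along the tuple `z`, then `det K(z)` is a sum over all subtuples. -/
theorem kernelDet_eq_sum {K L : α → α → ℝ} {c : α → ℝ} {z : ι → α}
    (hd : ∀ i, K (z i) (z i) = L (z i) (z i) + c (z i))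
    (ho : ∀ i j, i ≠ j → K (z i) (z j) = L (z i) (z j)) :
    kernelDet K z = ∑ S : Finset ι, (∏ i ∈ Sᶜ, c (z i)) *
      kernelDet L (fun i : S => z i) := by
  have h : kernelMatrix K z = kernelMatrix L z + diagonal fun i => c (z i) := by
    ext i j
    by_cases hij : i = j
    · subst hij; simp [hd]
    · simp [ho i j hij, hij]
  rw [kernelDet, h, det_add_diagonal]
  rfl

/-- All principal minors are intensities, hence non-negative. -/
theorem IsDPP.isPSDKernel {d : ℕ} {Ω : Type*} [MeasurableSpace Ω] {P : Measure Ω}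
    {μ : Measure (E d)} {X : Ω → Config d} {K : E d → E d → ℝ} (hX : IsDPP P μ X K) :
    IsPSDKernel K := by
  intro n z
  refine posSemidef_of_principal_minors ?_ fun S => ?_
  · ext i j
    simp [hX.kernel.symm (z j) (z i)]
  · have h := (hX.intensity _).nonneg ((fun i : S => z i) ∘ (Fintype.equivFin S).symm)
    have h2 := kernelDet_comp_equiv K (fun i : S => z i) (Fintype.equivFin S).symm
    change 0 ≤ kernelDet K _ at h
    rw [h2] at h
    exact h

theorem tsum_tuples_inter {β : Type*} (T D : Set β) {n : ℕ} (f : (Fin n → β) → ℝ≥0∞) :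
    ∑' x : Tuples n (T ∩ D), f x.1 =
      ∑' x : Tuples n T, (Set.univ.pi fun _ : Fin n => D).indicator f x.1 := by
  have h1 := tsum_subtype {x : Fin n → β | Function.Injective x ∧ ∀ i, x i ∈ T ∩ D} f
  have h2 := tsum_subtype {x : Fin n → β | Function.Injective x ∧ ∀ i, x i ∈ T}
    ((Set.univ.pi fun _ : Fin n => D).indicator f)
  refine h1.trans (Eq.trans ?_ h2.symm)
  refine tsum_congr fun x => ?_
  rw [Set.indicator_indicator]
  congr 1
  ext y
  simp only [Set.mem_ofPred_eq, Set.mem_inter_iff, Set.mem_pi, Set.mem_univ, true_imp_iff,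
    forall_and, and_assoc]

theorem IsDPP.hasIntensities {d : ℕ} {Ω : Type*} [MeasurableSpace Ω] {P : Measure Ω}
    {μ : Measure (E d)} [SigmaFinite μ] {X : Ω → Config d} {K : E d → E d → ℝ}
    (hX : IsDPP P μ X K) {M : ℝ} (hM0 : 0 ≤ M) (hM : ∀ x, K x x ≤ M)
    {D : Set (E d)} (hD : MeasurableSet D) :
    HasIntensities P (μ.restrict D) (fun w => (X w).1 ∩ D) (fun _ x => kernelDet K x) M where
  measurable_encard := by
    have h : Measurable[_, ⊤] (Config.count D) := by
      refine Measurable.of_comap_le ?_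
      exact le_iSup (fun C : {C : Set (E d) // MeasurableSet C} =>
        MeasurableSpace.comap (Config.count C.1) ⊤) ⟨D, hD⟩
    exact h.comp hX.measurable
  nonneg _ x := hX.isPSDKernel.kernelDet_nonneg x
  le_pow n x := by simpa using hX.isPSDKernel.kernelDet_le hM x
  bound_nonneg := hM0
  measurable _ := measurable_kernelDet hX.kernel.measurable
  lintegral_tuples n f hf := by
    have hDn : MeasurableSet (Set.univ.pi fun _ : Fin n => D) :=
      MeasurableSet.univ_pi fun _ => hD
    have h := (hX.intensity n).integral_eq _ (hf.indicator hDn)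
    simp_rw [tsum_tuples_inter]
    refine h.trans ?_
    rw [← Measure.restrict_pi_pi, ← lintegral_indicator hDn]
    refine lintegral_congr fun x => ?_
    by_cases hx : x ∈ Set.univ.pi fun _ : Fin n => D
    · rw [Set.indicator_of_mem hx, Set.indicator_of_mem hx]; rfl
    · rw [Set.indicator_of_notMem hx, Set.indicator_of_notMem hx, zero_mul]

end PointProcess

end

noncomputable section

/-! ### Expectations over two independent copies -/

namespace PointProcess

variable {α : Type*} [MeasurableSpace α] {ι κ : Type*}

/-- `H` is measurable as a function of the tuples that enumerate a set. -/
def TupleMeasurable (H : Set α → ℝ) : Prop :=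
  ∀ n, Measurable fun x : Fin n → α => H (Set.range x)

namespace TupleMeasurable

variable {H : Set α → ℝ}

theorem range [Fintype ι] (hH : TupleMeasurable H) : Measurable fun x : ι → α => H (Set.range x) := by
  have h : (fun x : ι → α => H (Set.range x)) =
      (fun y : Fin (Fintype.card ι) → α => H (Set.range y)) ∘
        fun x => x ∘ (Fintype.equivFin ι).symm := by
    funext x
    simp [Set.range_comp]
  rw [h]
  exact (hH _).comp (measurable_pi_lambda _ fun i => measurable_pi_apply _)

theorem image (hH : TupleMeasurable H) (v : Finset ι) :
    Measurable fun x : ι → α => H (x '' v) := by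
  simp_rw [Set.image_eq_range]
  exact (hH.range (ι := v)).comp (measurable_pi_lambda _ fun i => measurable_pi_apply i.1)

theorem altSum [Fintype ι] (hH : TupleMeasurable H) : Measurable fun x : ι → α => altSum H x :=
  Finset.measurable_fun_sum _ fun v _ => (hH.image v).const_mul _

theorem measurable_sumElim :
    Measurable fun p : (ι → α) × (κ → α) => (Sum.elim p.1 p.2 : ι ⊕ κ → α) := by
  refine measurable_pi_lambda _ fun i => ?_
  cases i
  · exact (measurable_pi_apply _).comp measurable_fst
  · exact (measurable_pi_apply _).comp measurable_snd

theorem altSum_sumElim [Fintype ι] [Fintype κ] (hH : TupleMeasurable H) :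
    Measurable fun p : (ι → α) × (κ → α) => PointProcess.altSum H (Sum.elim p.1 p.2) :=
  hH.altSum.comp measurable_sumElim

theorem image_union (hH : TupleMeasurable H) (x : ι → α) (v : Finset ι) :
    TupleMeasurable fun s => H (x '' v ∪ s) := by
  intro n
  have h : (fun y : Fin n → α => H (x '' v ∪ Set.range y)) =
      (fun z : v ⊕ Fin n → α => H (Set.range z)) ∘ fun y => Sum.elim (fun i : v => x i) y := by
    funext y
    simp [Set.Sum.elim_range, Set.image_eq_range]
  rw [h]
  exact hH.range.comp (measurable_sumElim.comp measurable_prodMk_left)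

end TupleMeasurable

theorem abs_integral_le_mul {β : Type*} [MeasurableSpace β] (ν : Measure β) [IsFiniteMeasure ν]
    {f : β → ℝ} {C : ℝ} (hf : ∀ w, |f w| ≤ C) : |∫ w, f w ∂ν| ≤ C * ν.real Set.univ :=
  norm_integral_le_of_norm_le_const (μ := ν) (f := f) (C := C) (ae_of_all _ hf)

theorem abs_integral_le_one {Ω : Type*} [MeasurableSpace Ω] {P : Measure Ω}
    [IsProbabilityMeasure P] {f : Ω → ℝ} (hf : ∀ w, |f w| ≤ 1) : |∫ w, f w ∂P| ≤ 1 := by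
  simpa using abs_integral_le_mul P hf

theorem HasIntensities.abs_apply_le {Ω : Type*} [MeasurableSpace Ω] {P : Measure Ω}
    {ν : Measure α} {S : Ω → Set α} {ρ : ∀ n : ℕ, (Fin n → α) → ℝ} {M : ℝ}
    (h : HasIntensities P ν S ρ M) (n : ℕ) (x : Fin n → α) : |ρ n x| ≤ M ^ n := by
  rw [abs_of_nonneg (h.nonneg n x)]
  exact h.le_pow n x

theorem measureReal_pi_univ [Fintype ι] (ν : Measure α) [IsFiniteMeasure ν] :
    (Measure.pi fun _ : ι => ν).real Set.univ = ν.real Set.univ ^ Fintype.card ι := by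
  simp [measureReal_def, Measure.pi_univ, ENNReal.toReal_pow]

variable {ν₁ ν₂ : Measure α} [IsFiniteMeasure ν₁] [IsFiniteMeasure ν₂]
  {ρ₁ ρ₂ : ∀ n : ℕ, (Fin n → α) → ℝ} {M : ℝ}

/-- The double expansion of `H` along pairs of tuples converges absolutely. If `G s` is the
expansion of `t ↦ H (s ∪ t)` along tuples with weights `ρ₂`, then the double expansion of `H` is
the expansion of `G` along tuples with weights `ρ₁`. -/
theorem summable_and_hasSum_altSum_sumElim (hM : 0 ≤ M) (hm₁ : ∀ n, Measurable (ρ₁ n))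
    (hm₂ : ∀ n, Measurable (ρ₂ n)) (hb₁ : ∀ n x, |ρ₁ n x| ≤ M ^ n) (hb₂ : ∀ n x, |ρ₂ n x| ≤ M ^ n)
    {H G : Set α → ℝ} (hH : ∀ s, |H s| ≤ 1) (hHm : TupleMeasurable H)
    (hG : ∀ (m : ℕ) (x : Fin m → α) (v : Finset (Fin m)), HasSum (fun n : ℕ => (n.factorial : ℝ)⁻¹ *
      ∫ y, altSum (fun s => H (x '' v ∪ s)) y * ρ₂ n y ∂(Measure.pi fun _ => ν₂)) (G (x '' v))) :
    Summable (fun p : ℕ × ℕ => (p.1.factorial : ℝ)⁻¹ * (p.2.factorial : ℝ)⁻¹ *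
      ∫ q : (Fin p.1 → α) × (Fin p.2 → α), altSum H (Sum.elim q.1 q.2) * (ρ₁ _ q.1 * ρ₂ _ q.2)
        ∂(Measure.pi fun _ => ν₁).prod (Measure.pi fun _ => ν₂)) ∧
    (∀ m : ℕ, Measurable fun x : Fin m → α => altSum G x) ∧
    ∀ m : ℕ, HasSum (fun n : ℕ => (m.factorial : ℝ)⁻¹ * (n.factorial : ℝ)⁻¹ *
      ∫ q : (Fin m → α) × (Fin n → α), altSum H (Sum.elim q.1 q.2) * (ρ₁ _ q.1 * ρ₂ _ q.2)
        ∂(Measure.pi fun _ => ν₁).prod (Measure.pi fun _ => ν₂))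
      ((m.factorial : ℝ)⁻¹ * ∫ x, altSum G x * ρ₁ m x ∂(Measure.pi fun _ => ν₁)) := by
  set V₁ := ν₁.real Set.univ with hV₁
  set V₂ := ν₂.real Set.univ with hV₂
  have hV₁0 : 0 ≤ V₁ := measureReal_nonneg
  have hV₂0 : 0 ≤ V₂ := measureReal_nonneg
  have hbound : ∀ m n (q : (Fin m → α) × (Fin n → α)),
      |altSum H (Sum.elim q.1 q.2) * (ρ₁ m q.1 * ρ₂ n q.2)| ≤ (2 * M) ^ m * (2 * M) ^ n := by
    intro m n q
    rw [abs_mul, abs_mul, mul_pow, mul_pow]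
    have h2 := abs_altSum_le (z := Sum.elim q.1 q.2) fun _ => hH _
    rw [Fintype.card_sum, Fintype.card_fin, Fintype.card_fin, pow_add] at h2
    calc _ ≤ (2 ^ m * 2 ^ n) * (M ^ m * M ^ n) := by
          gcongr
          · exact hb₁ m _
          · exact hb₂ n _
      _ = _ := by ring
  have hmeas : ∀ m n, Measurable fun q : (Fin m → α) × (Fin n → α) =>
      altSum H (Sum.elim q.1 q.2) * (ρ₁ m q.1 * ρ₂ n q.2) := fun m n =>
    hHm.altSum_sumElim.mul (((hm₁ m).comp measurable_fst).mul
      ((hm₂ n).comp measurable_snd))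
  have hint : ∀ m n, Integrable (fun q : (Fin m → α) × (Fin n → α) =>
      altSum H (Sum.elim q.1 q.2) * (ρ₁ m q.1 * ρ₂ n q.2))
      ((Measure.pi fun _ => ν₁).prod (Measure.pi fun _ => ν₂)) := fun m n =>
    Integrable.of_bound (hmeas m n).aestronglyMeasurable _ (ae_of_all _ (hbound m n))
  let F : ∀ m : ℕ, ℕ → (Fin m → α) → ℝ := fun m n x => (n.factorial : ℝ)⁻¹ *
    ∫ y, altSum H (Sum.elim x y) * ρ₂ n y ∂(Measure.pi fun _ => ν₂)
  have hsec : ∀ {m n} (x : Fin m → α), Integrable (fun y : Fin n → α =>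
      altSum H (Sum.elim x y) * ρ₂ n y) (Measure.pi fun _ => ν₂) := by
    intro m n x
    refine Integrable.of_bound (C := 2 ^ (m + n) * M ^ n)
      ((hHm.altSum_sumElim.comp measurable_prodMk_left).mul
        (hm₂ n)).aestronglyMeasurable (ae_of_all _ fun y => ?_)
    have h2 := abs_altSum_le (z := Sum.elim x y) fun _ => hH _
    rw [Fintype.card_sum, Fintype.card_fin, Fintype.card_fin] at h2
    rw [Real.norm_eq_abs, abs_mul]
    exact mul_le_mul h2 (hb₂ n y) (abs_nonneg _) (by positivity)
  have hFsum : ∀ m (x : Fin m → α), HasSum (fun n => F m n x) (altSum G x) := by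
    intro m x
    have h : ∀ v : Finset (Fin m), HasSum (fun n : ℕ => (-1) ^ (Fintype.card (Fin m) + v.card) *
        ((n.factorial : ℝ)⁻¹ * ∫ y, altSum (fun s => H (x '' v ∪ s)) y * ρ₂ n y
          ∂(Measure.pi fun _ => ν₂))) ((-1) ^ (Fintype.card (Fin m) + v.card) * G (x '' v)) :=
      fun v => (hG m x v).mul_left _
    have h' := hasSum_sum (s := Finset.univ) fun v _ => h v
    refine h'.congr_fun fun n => ?_
    simp only [F]
    rw [← integral_const_mul]
    simp_rw [← integral_const_mul]
    rw [← integral_finsetSum]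
    · refine integral_congr_ae (ae_of_all _ fun y => ?_)
      simp only [PointProcess.altSum_sumElim]
      rw [Finset.sum_mul, Finset.mul_sum]
      exact Finset.sum_congr rfl fun v _ => by ring
    · intro v _
      refine Integrable.const_mul (Integrable.const_mul ?_ _) _
      refine Integrable.of_bound (C := 2 ^ n * M ^ n)
        ((hHm.image_union x v).altSum.mul (hm₂ n)).aestronglyMeasurable
        (ae_of_all _ fun y => ?_)
      rw [Real.norm_eq_abs, abs_mul]
      refine mul_le_mul ?_ (hb₂ n y) (abs_nonneg _) (by positivity)
      simpa using abs_altSum_le (H := fun s => H (x '' v ∪ s)) (z := y) fun _ => hH _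
  have hFmeas : ∀ m n, Measurable (F m n) := fun m n => by
    have h : Measurable fun q : (Fin m → α) × (Fin n → α) =>
      altSum H (Sum.elim q.1 q.2) * ρ₂ n q.2 :=
      hHm.altSum_sumElim.mul ((hm₂ n).comp measurable_snd)
    exact (h.stronglyMeasurable.integral_prod_right.measurable).const_mul _
  have hGm : ∀ m, Measurable fun x : Fin m → α => altSum G x := fun m =>
    measurable_of_tendsto_metrizable
      (fun N => Finset.measurable_fun_sum (Finset.range N) fun n _ => hFmeas m n)
      (tendsto_pi_nhds.2 fun x => (hFsum m x).tendsto_sum_nat)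
  have hFbound : ∀ m n (x : Fin m → α), |F m n x| ≤
      2 ^ m * ((2 * M * V₂) ^ n / n.factorial) := by
    intro m n x
    simp only [F]
    rw [abs_mul, abs_of_nonneg (by positivity)]
    have h3 : |∫ y, altSum H (Sum.elim x y) * ρ₂ n y ∂(Measure.pi fun _ : Fin n => ν₂)| ≤
        (2 ^ (m + n) * M ^ n) * (Measure.pi fun _ : Fin n => ν₂).real Set.univ := by
      refine abs_integral_le_mul _ fun y => ?_
      have h2 := abs_altSum_le (z := Sum.elim x y) fun _ => hH _
      rw [Fintype.card_sum, Fintype.card_fin, Fintype.card_fin] at h2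
      rw [abs_mul]
      exact mul_le_mul h2 (hb₂ n y) (abs_nonneg _) (by positivity)
    rw [measureReal_pi_univ, Fintype.card_fin] at h3
    calc _ ≤ (n.factorial : ℝ)⁻¹ * (2 ^ (m + n) * M ^ n * V₂ ^ n) := by gcongr
      _ = _ := by rw [mul_pow, mul_pow, pow_add]; ring
  -- For fixed `m` the sum over `n` may be integrated term by term.
  have hinner : ∀ m, HasSum (fun n : ℕ => (m.factorial : ℝ)⁻¹ * (n.factorial : ℝ)⁻¹ *
      ∫ q : (Fin m → α) × (Fin n → α), altSum H (Sum.elim q.1 q.2) * (ρ₁ _ q.1 * ρ₂ _ q.2)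
        ∂(Measure.pi fun _ => ν₁).prod (Measure.pi fun _ => ν₂))
      ((m.factorial : ℝ)⁻¹ * ∫ x, altSum G x * ρ₁ m x ∂(Measure.pi fun _ => ν₁)) := by
    intro m
    have hb2 : ∀ n (x : Fin m → α), |F m n x * ρ₁ m x| ≤
        2 ^ m * ((2 * M * V₂) ^ n / n.factorial) * M ^ m := fun n x => by
      rw [abs_mul]
      exact mul_le_mul (hFbound m n x) (hb₁ m x) (abs_nonneg _) (by positivity)
    have hs := hasSum_integral_of_summable_integral_norm
      (μ := (Measure.pi fun _ : Fin m => ν₁)) (F := fun n x => F m n x * ρ₁ m x)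
      (fun n => Integrable.of_bound ((hFmeas m n).mul (hm₁ m)).aestronglyMeasurable _
        (ae_of_all _ (hb2 n))) ?_
    · have h2 : ∀ x : Fin m → α, ∑' n, F m n x * ρ₁ m x = altSum G x * ρ₁ m x := fun x =>
        ((hFsum m x).mul_right _).tsum_eq
      simp_rw [h2] at hs
      refine (hs.mul_left _).congr_fun fun n => ?_
      rw [mul_assoc, integral_prod _ (hint m n), ← integral_const_mul]
      congr 1
      refine integral_congr_ae (ae_of_all _ fun x => ?_)
      simp only [F]
      rw [mul_assoc, ← integral_mul_const]
      congr 1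
      refine integral_congr_ae (ae_of_all _ fun y => ?_)
      simp only
      ring
    · refine Summable.of_nonneg_of_le (fun n => integral_nonneg fun w => norm_nonneg _)
        (fun n => ?_) (((Real.summable_pow_div_factorial (2 * M * V₂)).mul_left (2 ^ m)).mul_right
          (M ^ m * (Measure.pi fun _ : Fin m => ν₁).real Set.univ))
      have := (abs_le.1 (abs_integral_le_mul (Measure.pi fun _ : Fin m => ν₁)
        (f := fun x => ‖F m n x * ρ₁ m x‖) (fun x => by
          rw [abs_norm]; exact hb2 n x))).2
      rw [← mul_assoc]
      exact this
  have hsummable : Summable (fun p : ℕ × ℕ => (p.1.factorial : ℝ)⁻¹ * (p.2.factorial : ℝ)⁻¹ *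
      ∫ q : (Fin p.1 → α) × (Fin p.2 → α), altSum H (Sum.elim q.1 q.2) * (ρ₁ _ q.1 * ρ₂ _ q.2)
        ∂(Measure.pi fun _ => ν₁).prod (Measure.pi fun _ => ν₂)) := by
    refine Summable.of_norm_bounded (Summable.mul_of_nonneg
      (Real.summable_pow_div_factorial (2 * M * V₁))
      (Real.summable_pow_div_factorial (2 * M * V₂)) (fun _ => by positivity)
      (fun _ => by positivity)) fun p => ?_
    rw [norm_mul, Real.norm_of_nonneg (by positivity)]
    have h3 := abs_integral_le_mul
      ((Measure.pi fun _ : Fin p.1 => ν₁).prod (Measure.pi fun _ : Fin p.2 => ν₂)) (hbound p.1 p.2)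
    rw [← Set.univ_prod_univ, measureReal_prod_prod, measureReal_pi_univ, measureReal_pi_univ,
      Fintype.card_fin, Fintype.card_fin] at h3
    calc _ ≤ _ := mul_le_mul_of_nonneg_left h3 (by positivity)
      _ = _ := by simp only [mul_pow]; ring
  exact ⟨hsummable, hGm, hinner⟩

/-- The expectation of a bounded function of the union of two independent random finite sets,
expanded in the intensity functions of both. -/
theorem HasIntensities.hasSum_prod {Ω : Type*} [MeasurableSpace Ω] {P : Measure Ω}
    [IsProbabilityMeasure P] {S₁ S₂ : Ω → Set α} (h₁ : HasIntensities P ν₁ S₁ ρ₁ M)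
    (h₂ : HasIntensities P ν₂ S₂ ρ₂ M) {H : Set α → ℝ} (hH : ∀ s, |H s| ≤ 1)
    (hHm : TupleMeasurable H) :
    HasSum (fun p : ℕ × ℕ => (p.1.factorial : ℝ)⁻¹ * (p.2.factorial : ℝ)⁻¹ *
      ∫ q : (Fin p.1 → α) × (Fin p.2 → α), altSum H (Sum.elim q.1 q.2) * (ρ₁ _ q.1 * ρ₂ _ q.2)
        ∂(Measure.pi fun _ => ν₁).prod (Measure.pi fun _ => ν₂))
      (∫ w, ∫ w', H (S₁ w ∪ S₂ w') ∂P ∂P) := by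
  obtain ⟨hs, hGm, hi⟩ := summable_and_hasSum_altSum_sumElim (ν₁ := ν₁) (ν₂ := ν₂) (ρ₁ := ρ₁)
    (G := fun s => ∫ w', H (s ∪ S₂ w') ∂P) h₁.bound_nonneg h₁.measurable h₂.measurable
    h₁.abs_apply_le h₂.abs_apply_le hH hHm fun m x v =>
      h₂.hasSum_integral (fun s => hH _) fun n => (hHm.image_union x v).altSum
  have houter := h₁.hasSum_integral (H := fun s => ∫ w', H (s ∪ S₂ w') ∂P)
    (fun s => abs_integral_le_one fun w => hH _) hGm
  have h := hs.hasSum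
  rwa [(h.prod_fiberwise hi).unique houter] at h

end PointProcess

end

noncomputable section

/-! ### Smoothing by a Poisson process -/

namespace PointProcess

variable {α : Type*} [MeasurableSpace α] {ν : Measure α} [IsFiniteMeasure ν]

theorem hasSum_antidiagonal {a : ℕ × ℕ → ℝ} {s : ℝ} (h : HasSum a s) :
    HasSum (fun n => ∑ p ∈ Finset.HasAntidiagonal.antidiagonal n, a p) s := by
  have h2 := (Finset.HasAntidiagonal.sigmaAntidiagonalEquivProd (A := ℕ)).hasSum_iff.2 h
  refine (h2.sigma fun n => hasSum_fintype _).congr_fun fun n => ?_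
  exact (Finset.sum_coe_sort (Finset.HasAntidiagonal.antidiagonal n) a).symm

/-- The expansion of `H` along tuples with weights `∏ c` is the expectation of `H` for the Poisson
process of intensity `c`; in particular it is bounded by `1`. -/
theorem exists_hasSum_altSum_prod {c : α → ℝ} (hc : Measurable c) (hc0 : ∀ x, 0 ≤ c x) {M : ℝ}
    (hcM : ∀ x, c x ≤ M) {H : Set α → ℝ} (hH : ∀ s, |H s| ≤ 1) (hHm : TupleMeasurable H) :
    ∃ q : ℝ, |q| ≤ 1 ∧ HasSum (fun n : ℕ => (n.factorial : ℝ)⁻¹ *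
      ∫ y, altSum H y * ∏ i, c (y i) ∂(Measure.pi fun _ : Fin n => ν)) q := by
  set C := ∫ x, c x ∂ν with hC
  -- The expansion is the product of `∑ h j / j!` and `exp (-C)`.
  let h : ℕ → ℝ := fun j => ∫ x, H (Set.range x) * ∏ i, c (x i) ∂(Measure.pi fun _ : Fin j => ν)
  have hcm : ∀ n, Measurable fun y : Fin n → α => ∏ i, c (y i) := fun n =>
    Finset.measurable_fun_prod _ fun i _ => hc.comp (measurable_pi_apply i)
  have hcp : ∀ n (y : Fin n → α), 0 ≤ ∏ i, c (y i) := fun n y =>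
    Finset.prod_nonneg fun i _ => hc0 _
  have hcb : ∀ n (y : Fin n → α), ∏ i, c (y i) ≤ M ^ n := fun n y => by
    refine (Finset.prod_le_prod (fun i _ => hc0 _) fun i _ => hcM (y i)).trans_eq ?_
    simp
  have hcint : ∀ n, Integrable (fun y : Fin n → α => ∏ i, c (y i)) (Measure.pi fun _ => ν) :=
    fun n => Integrable.of_bound (C := M ^ n) (hcm n).aestronglyMeasurable (ae_of_all _ fun y => by
      rw [Real.norm_of_nonneg (hcp n y)]; exact hcb n y)
  have hCpow : ∀ n, ∫ y, ∏ i, c (y i) ∂(Measure.pi fun _ : Fin n => ν) = C ^ n := fun n => by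
    rw [integral_fintype_prod_eq_prod (𝕜 := ℝ) (fun _ : Fin n => c)]
    simp [hC]
  have hterm : ∀ n : ℕ, ∫ y, altSum H y * ∏ i, c (y i) ∂(Measure.pi fun _ : Fin n => ν) =
      ∑ p ∈ Finset.HasAntidiagonal.antidiagonal n, n.choose p.1 • (h p.1 * (-C) ^ p.2) := by
    intro n
    have := integral_sum_finset ν (n := n)
      (fun v z => (-1) ^ (n + v.card) * H (z '' v) * ∏ i, c (z i)) (fun v => ?_)
      (fun j i => h j * (-C) ^ i) ?_
    · rw [← this]
      refine integral_congr_ae (ae_of_all _ fun z => ?_)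
      simp [altSum, Finset.sum_mul]
    · refine Integrable.bdd_mul (c := 1) (hcint n)
        ((hHm.image v).const_mul _).aestronglyMeasurable (ae_of_all _ fun z => ?_)
      simpa [abs_mul] using hH _
    · intro v k l e hl hr
      have hcard : v.card = k := by
        have : v = Finset.univ.map (Function.Embedding.inl.trans e.toEmbedding) := by
          ext i
          obtain ⟨j, rfl⟩ := e.surjective i
          cases j <;> simp [hl, hr]
        rw [this]; simp
      have hn : k + l = n := by simpa using Fintype.card_congr e
      have himg : ∀ (x : Fin k → α) (y : Fin l → α),
          (Sum.elim x y ∘ e.symm) '' v = Set.range x := by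
        intro x y
        ext a
        constructor
        · rintro ⟨i, hi, rfl⟩
          obtain ⟨j, rfl⟩ := e.surjective i
          cases j with
          | inl j => exact ⟨j, by simp⟩
          | inr j => exact absurd hi (hr j)
        · rintro ⟨j, rfl⟩
          exact ⟨e (Sum.inl j), hl j, by simp⟩
      have hprod : ∀ (x : Fin k → α) (y : Fin l → α),
          ∏ i, c ((Sum.elim x y ∘ e.symm) i) = (∏ i, c (x i)) * ∏ i, c (y i) := by
        intro x y
        rw [← e.prod_comp, Fintype.prod_sum_type]
        simp
      simp_rw [himg, hprod, hcard]
      have hsign : (-1 : ℝ) ^ (n + k) = (-1) ^ l := by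
        rw [← hn, show k + l + k = l + 2 * k by ring, pow_add, pow_mul]
        simp
      rw [hsign]
      have := integral_prod_mul (μ := Measure.pi fun _ : Fin k => ν)
        (ν := Measure.pi fun _ : Fin l => ν) (fun x => H (Set.range x) * ∏ i, c (x i))
        (fun y => (-1) ^ l * ∏ i, c (y i))
      rw [integral_const_mul, hCpow, ← mul_pow, neg_one_mul] at this
      rw [← this]
      refine integral_congr_ae (ae_of_all _ fun p => ?_)
      simp only
      ring
  have hhb : ∀ j, |h j| ≤ C ^ j := fun j => by
    rw [← hCpow]
    refine (abs_integral_le_integral_abs).trans (integral_mono_of_nonneg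
      (ae_of_all _ fun x => abs_nonneg _) (hcint j) (ae_of_all _ fun x => ?_))
    simp only
    rw [abs_mul, abs_of_nonneg (hcp j x)]
    exact mul_le_of_le_one_left (hcp j x) (hH _)
  have hC0 : 0 ≤ C := integral_nonneg hc0
  have hexp : HasSum (fun j : ℕ => C ^ j / (j.factorial : ℝ)) (Real.exp C) := by
    rw [Real.exp_eq_exp_ℝ]; exact NormedSpace.expSeries_div_hasSum_exp C
  have hexp' : HasSum (fun j : ℕ => (-C) ^ j / (j.factorial : ℝ)) (Real.exp (-C)) := by
    rw [Real.exp_eq_exp_ℝ]; exact NormedSpace.expSeries_div_hasSum_exp (-C)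
  have hfb : ∀ j, ‖h j / j.factorial‖ ≤ C ^ j / (j.factorial : ℝ) := fun j => by
    rw [norm_div, Real.norm_natCast]
    exact div_le_div_of_nonneg_right (hhb j) (by positivity)
  have hs1 : Summable fun j => ‖h j / (j.factorial : ℝ)‖ :=
    Summable.of_nonneg_of_le (fun _ => norm_nonneg _) hfb hexp.summable
  have hs2 : Summable fun j : ℕ => ‖(-C) ^ j / (j.factorial : ℝ)‖ := hexp'.summable.norm
  refine ⟨(∑' j, h j / (j.factorial : ℝ)) * ∑' j : ℕ, (-C) ^ j / (j.factorial : ℝ), ?_, ?_⟩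
  · rw [hexp'.tsum_eq, abs_mul, abs_of_pos (Real.exp_pos _)]
    have h1 : |∑' j, h j / (j.factorial : ℝ)| ≤ Real.exp C := by
      rw [← hexp.tsum_eq]
      exact (norm_tsum_le_tsum_norm hs1).trans (hs1.tsum_le_tsum hfb hexp.summable)
    calc _ ≤ Real.exp C * Real.exp (-C) := by gcongr
      _ = 1 := by rw [← Real.exp_add]; simp
  · rw [tsum_mul_tsum_eq_tsum_sum_antidiagonal_of_summable_norm hs1 hs2]
    have hs := (summable_norm_sum_mul_antidiagonal_of_summable_norm hs1 hs2).of_norm.hasSum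
    refine hs.congr_fun fun n => ?_
    rw [hterm, Finset.mul_sum]
    refine Finset.sum_congr rfl fun p hp => ?_
    rw [nsmul_eq_mul, ← mul_assoc,
      inv_factorial_mul_choose (Finset.HasAntidiagonal.mem_antidiagonal.1 hp)]
    field_simp

variable {L L' : α → α → ℝ} {M : ℝ} {c : α → ℝ} {H : Set α → ℝ}

/-- A sum over subtuples, integrated over all tuples, becomes a sum over pairs of tuples. -/
theorem integral_altSum_mul_sum (hL : IsPSDKernel L) (hLm : Measurable (Function.uncurry L))
    (hLM : ∀ x, L x x ≤ M) (hc : Measurable c) (hc0 : ∀ x, 0 ≤ c x) (hcM : ∀ x, c x ≤ M)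
    (hH : ∀ s, |H s| ≤ 1) (hHm : TupleMeasurable H) (n : ℕ) :
    (n.factorial : ℝ)⁻¹ * ∫ z, altSum H z * ∑ S : Finset (Fin n), (∏ i ∈ Sᶜ, c (z i)) *
        kernelDet L (fun i : S => z i) ∂(Measure.pi fun _ => ν) =
      ∑ p ∈ Finset.HasAntidiagonal.antidiagonal n,
        (p.1.factorial : ℝ)⁻¹ * (p.2.factorial : ℝ)⁻¹ *
          ∫ q : (Fin p.1 → α) × (Fin p.2 → α),
            altSum H (Sum.elim q.1 q.2) * (kernelDet L q.1 * ∏ i, c (q.2 i))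
          ∂(Measure.pi fun _ => ν).prod (Measure.pi fun _ => ν) := by
  have := integral_sum_finset ν (n := n)
    (fun S z => altSum H z * ((∏ i ∈ Sᶜ, c (z i)) * kernelDet L (fun i : S => z i)))
    (fun S => ?_)
    (fun k l => ∫ q : (Fin k → α) × (Fin l → α),
            altSum H (Sum.elim q.1 q.2) * (kernelDet L q.1 * ∏ i, c (q.2 i))
          ∂(Measure.pi fun _ => ν).prod (Measure.pi fun _ => ν)) ?_
  · simp_rw [Finset.mul_sum]
    rw [this, Finset.mul_sum]
    refine Finset.sum_congr rfl fun p hp => ?_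
    rw [nsmul_eq_mul, ← mul_assoc,
      inv_factorial_mul_choose (Finset.HasAntidiagonal.mem_antidiagonal.1 hp)]
  · refine Integrable.of_bound
      (C := 2 ^ n * (M ^ (Sᶜ : Finset (Fin n)).card * M ^ S.card)) ?_ (ae_of_all _ fun z => ?_)
    · refine (hHm.altSum.mul (Measurable.mul ?_ ?_)).aestronglyMeasurable
      · exact Finset.measurable_fun_prod _ fun i _ => hc.comp (measurable_pi_apply i)
      · exact (measurable_kernelDet hLm).comp (measurable_pi_lambda _ fun i => measurable_pi_apply _)
    · rw [Real.norm_eq_abs, abs_mul, abs_mul,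
        abs_of_nonneg (Finset.prod_nonneg fun i _ => hc0 _), abs_of_nonneg (hL.kernelDet_nonneg _)]
      have h1 : |altSum H z| ≤ 2 ^ n := by simpa using abs_altSum_le (z := z) fun _ => hH _
      have h2 : ∏ i ∈ Sᶜ, c (z i) ≤ M ^ (Sᶜ : Finset (Fin n)).card :=
        (Finset.prod_le_prod (fun i _ => hc0 _) fun i _ => hcM (z i)).trans_eq (by simp)
      have h3 : kernelDet L (fun i : S => z i) ≤ M ^ S.card := by
        simpa using hL.kernelDet_le hLM (fun i : S => z i)
      exact mul_le_mul h1 (mul_le_mul h2 h3 (hL.kernelDet_nonneg _)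
        ((Finset.prod_nonneg fun i _ => hc0 (z i)).trans h2))
        (mul_nonneg (Finset.prod_nonneg fun i _ => hc0 _) (hL.kernelDet_nonneg _)) (by positivity)
  · intro S k l e hl hr
    refine integral_congr_ae (ae_of_all _ fun q => ?_)
    have hS : Finset.univ.map (Function.Embedding.inl.trans e.toEmbedding) = S := by
      ext i
      obtain ⟨j, rfl⟩ := e.surjective i
      cases j <;> simp [hl, hr]
    have hSc : Finset.univ.map (Function.Embedding.inr.trans e.toEmbedding) = Sᶜ := by
      ext i
      obtain ⟨j, rfl⟩ := e.surjective i
      cases j <;> simp [hl, hr]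
    have h1 : altSum H (Sum.elim q.1 q.2 ∘ e.symm) = altSum H (Sum.elim q.1 q.2) :=
      altSum_comp_equiv _ _ _
    have h2 : ∏ i ∈ Sᶜ, c ((Sum.elim q.1 q.2 ∘ e.symm) i) = ∏ i, c (q.2 i) := by
      rw [← hSc, Finset.prod_map]
      simp
    let f : Fin k ≃ S := Equiv.ofBijective (fun j => ⟨e (Sum.inl j), hl j⟩)
      ⟨fun i j h => by simpa using h, fun ⟨i, hi⟩ => by
        rw [← hS] at hi
        obtain ⟨j, -, hj⟩ := Finset.mem_map.1 hi
        exact ⟨j, Subtype.ext hj⟩⟩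
    have h3 : kernelDet L (fun i : S => (Sum.elim q.1 q.2 ∘ e.symm) i) = kernelDet L q.1 := by
      rw [← kernelDet_comp_equiv L _ f]
      congr 1
      funext j
      have hf : (f j : Fin n) = e (Sum.inl j) := rfl
      simp [hf]
    simp only [h1, h2, h3]
    ring

/-- Two expansions that are smoothed by the same Poisson process differ by no more than their
unsmoothed counterparts. -/
theorem enorm_sub_le_of_hasSum
    (hL : IsPSDKernel L) (hLm : Measurable (Function.uncurry L)) (hLM : ∀ x, L x x ≤ M)
    (hL' : IsPSDKernel L') (hLm' : Measurable (Function.uncurry L')) (hLM' : ∀ x, L' x x ≤ M)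
    (hM : 0 ≤ M) (hc : Measurable c) (hc0 : ∀ x, 0 ≤ c x) (hcM : ∀ x, c x ≤ M)
    (hH : ∀ s, |H s| ≤ 1) (hHm : TupleMeasurable H) {e e' : ℝ}
    (he : HasSum (fun n : ℕ => (n.factorial : ℝ)⁻¹ * ∫ z, altSum H z * ∑ S : Finset (Fin n),
      (∏ i ∈ Sᶜ, c (z i)) * kernelDet L (fun i : S => z i) ∂(Measure.pi fun _ => ν)) e)
    (he' : HasSum (fun n : ℕ => (n.factorial : ℝ)⁻¹ * ∫ z, altSum H z * ∑ S : Finset (Fin n),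
      (∏ i ∈ Sᶜ, c (z i)) * kernelDet L' (fun i : S => z i) ∂(Measure.pi fun _ => ν)) e') :
    ‖e - e'‖ₑ ≤ ∑' n : ℕ, ENNReal.ofReal ((n.factorial : ℝ)⁻¹ * 2 ^ n) *
      ∫⁻ x, ‖kernelDet L x - kernelDet L' x‖ₑ ∂(Measure.pi fun _ : Fin n => ν) := by
  classical
  have hQ := fun (m : ℕ) (x : Fin m → α) (v : Finset (Fin m)) =>
    exists_hasSum_altSum_prod (ν := ν) (H := fun s => H (x '' v ∪ s)) hc hc0 hcM (fun s => hH _)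
      (hHm.image_union x v)
  -- `Q s` is the expectation of `H (s ∪ Y)` for a Poisson process `Y` of intensity `c`.
  let Q : Set α → ℝ := fun s => ∑' n : ℕ, (n.factorial : ℝ)⁻¹ *
      ∫ y, altSum (fun t => H (s ∪ t)) y * ∏ i, c (y i) ∂(Measure.pi fun _ : Fin n => ν)
  have hQs : ∀ (m : ℕ) (x : Fin m → α) (v : Finset (Fin m)), |Q (x '' v)| ≤ 1 ∧
      HasSum (fun n : ℕ => (n.factorial : ℝ)⁻¹ * ∫ y, altSum (fun t => H (x '' v ∪ t)) y *
        ∏ i, c (y i) ∂(Measure.pi fun _ : Fin n => ν)) (Q (x '' v)) := by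
    intro m x v
    obtain ⟨q, hq1, hq2⟩ := hQ m x v
    have : Q (x '' v) = q := hq2.tsum_eq
    rw [this]
    exact ⟨hq1, hq2⟩
  have hcm : ∀ n, Measurable fun y : Fin n → α => ∏ i, c (y i) := fun n =>
    Finset.measurable_fun_prod _ fun i _ => hc.comp (measurable_pi_apply i)
  have hcb : ∀ n (y : Fin n → α), |∏ i, c (y i)| ≤ M ^ n := fun n y => by
    rw [abs_of_nonneg (Finset.prod_nonneg fun i _ => hc0 _)]
    refine (Finset.prod_le_prod (fun i _ => hc0 _) fun i _ => hcM (y i)).trans_eq ?_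
    simp
  have hdb : ∀ {J : α → α → ℝ}, IsPSDKernel J → (∀ x, J x x ≤ M) → ∀ n (y : Fin n → α),
      |kernelDet J y| ≤ M ^ n := fun hJ hJM n y => by
    rw [abs_of_nonneg (hJ.kernelDet_nonneg y)]
    simpa using hJ.kernelDet_le hJM y
  have key : ∀ {J : α → α → ℝ} {s : ℝ}, IsPSDKernel J → Measurable (Function.uncurry J) →
      (∀ x, J x x ≤ M) → HasSum (fun n : ℕ => (n.factorial : ℝ)⁻¹ * ∫ z, altSum H z *
        ∑ S : Finset (Fin n), (∏ i ∈ Sᶜ, c (z i)) * kernelDet J (fun i : S => z i)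
          ∂(Measure.pi fun _ => ν)) s →
      (∀ n, Measurable fun x : Fin n → α => altSum Q x) ∧
      HasSum (fun n : ℕ => (n.factorial : ℝ)⁻¹ *
        ∫ x, altSum Q x * kernelDet J x ∂(Measure.pi fun _ : Fin n => ν)) s := by
    intro J s hJ hJm hJM hs
    obtain ⟨h1, h2, h3⟩ := summable_and_hasSum_altSum_sumElim (ν₁ := ν) (ν₂ := ν)
      (ρ₁ := fun _ x => kernelDet J x) (ρ₂ := fun _ y => ∏ i, c (y i)) (G := Q) hM
      (fun _ => measurable_kernelDet hJm) hcm (hdb hJ hJM) hcb hH hHm fun m x v => (hQs m x v).2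
    refine ⟨h2, ?_⟩
    have h4 := h1.hasSum.prod_fiberwise h3
    have h5 := hasSum_antidiagonal h1.hasSum
    simp_rw [integral_altSum_mul_sum hJ hJm hJM hc hc0 hcM hH hHm] at hs
    rwa [h5.unique hs] at h4
  obtain ⟨hQm, h1⟩ := key hL hLm hLM he
  obtain ⟨-, h2⟩ := key hL' hLm' hLM' he'
  rw [← (h1.sub h2).tsum_eq]
  refine enorm_tsum_le_tsum_enorm.trans (ENNReal.tsum_le_tsum fun n => ?_)
  have hQb : ∀ x : Fin n → α, |altSum Q x| ≤ 2 ^ n := fun x => by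
    simpa using abs_altSum_le (z := x) fun v => (hQs n x v).1
  have hi : ∀ {J : α → α → ℝ}, IsPSDKernel J → Measurable (Function.uncurry J) →
      (∀ x, J x x ≤ M) → Integrable (fun x : Fin n → α => altSum Q x * kernelDet J x)
        (Measure.pi fun _ => ν) := fun hJ hJm hJM =>
    Integrable.of_bound (C := 2 ^ n * M ^ n)
      ((hQm n).mul (measurable_kernelDet hJm)).aestronglyMeasurable (ae_of_all _ fun x => by
        rw [Real.norm_eq_abs, abs_mul]
        exact mul_le_mul (hQb x) (hdb hJ hJM n x) (abs_nonneg _) (by positivity))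
  rw [← mul_sub, ← integral_sub (hi hL hLm hLM) (hi hL' hLm' hLM'), enorm_mul,
    ENNReal.ofReal_mul (by positivity), Real.enorm_eq_ofReal (by positivity), mul_assoc]
  gcongr
  refine (enorm_integral_le_lintegral_enorm _).trans ?_
  rw [← lintegral_const_mul' _ _ ENNReal.ofReal_ne_top]
  refine lintegral_mono fun x => ?_
  rw [← mul_sub, enorm_mul]
  gcongr
  rw [Real.enorm_eq_ofReal_abs]
  exact ENNReal.ofReal_le_ofReal (hQb x)

end PointProcess

end

noncomputable section

/-! ### Comparison of a determinantal process with two independent parts -/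

namespace PointProcess

variable {d : ℕ} {Ω : Type*} [MeasurableSpace Ω] {P : Measure Ω} [IsProbabilityMeasure P]
  {μ : Measure (E d)} [SigmaFinite μ] {X : Ω → Config d} {K K₀ : E d → E d → ℝ} {M : ℝ}
  {A B : Set (E d)}

/-- `K₀` is a positive semidefinite kernel that agrees with `K` almost everywhere and is at most
`K` on the diagonal. The diagonal is not determined by the almost everywhere class of `K`: a
Poisson process, for instance, has a kernel supported by the diagonal, and there `K₀ = 0`. -/
structure IsOffDiagonalVersion (μ : Measure (E d)) (K K₀ : E d → E d → ℝ) : Prop where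
  measurable : Measurable (Function.uncurry K₀)
  psd : IsPSDKernel K₀
  diag_le : ∀ x, K₀ x x ≤ K x x
  ae_eq : ∀ᵐ q ∂μ.prod μ, K q.1 q.2 = K₀ q.1 q.2

/-- Off the diagonal `K` is `K₀`, and on the diagonal it is larger by `K(x, x) - K₀(x, x)`. -/
theorem IsOffDiagonalVersion.ae_kernelDet (h : IsOffDiagonalVersion μ K K₀) (n : ℕ)
    (D : Set (E d)) :
    ∀ᵐ z ∂(Measure.pi fun _ : Fin n => μ.restrict D),
      kernelDet K z = ∑ S : Finset (Fin n), (∏ i ∈ Sᶜ, (K (z i) (z i) - K₀ (z i) (z i))) *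
        kernelDet K₀ (fun i : S => z i) ∧
      kernelDet (blockKernel A K) z =
        ∑ S : Finset (Fin n), (∏ i ∈ Sᶜ, (K (z i) (z i) - K₀ (z i) (z i))) *
          kernelDet (blockKernel A K₀) (fun i : S => z i) := by
  have h0 : ∀ᵐ q ∂(μ.restrict D).prod (μ.restrict D), K q.1 q.2 = K₀ q.1 q.2 := by
    rw [Measure.prod_restrict]
    exact ae_restrict_of_ae h.ae_eq
  filter_upwards [ae_pi_pair (μ.restrict D) (p := fun x y => K x y = K₀ x y) h0] with z hz
  refine ⟨kernelDet_eq_sum (c := fun x => K x x - K₀ x x) (fun i => by ring) hz,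
    kernelDet_eq_sum (c := fun x => K x x - K₀ x x) (fun i => ?_) fun i j hij => ?_⟩
  · simp only [blockKernel_self]; ring
  · simp only [blockKernel, hz i j hij]

/-- The expectation of `H`, compared with the one for independent parts in `A` and `B`, in terms of
the determinants of an off-diagonal version of the kernel. The excess of `K` on the diagonal acts as
a Poisson process and does not contribute. -/
theorem IsDPP.enorm_sub_le (hX : IsDPP P μ X K) (hM0 : 0 ≤ M) (hM : ∀ x, K x x ≤ M)
    (h₀ : IsOffDiagonalVersion μ K K₀) (hA : MeasurableSet A) (hB : MeasurableSet B)
    (hAB : Disjoint A B) (hAfin : μ A ≠ ∞) (hBfin : μ B ≠ ∞) {H : Set (E d) → ℝ}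
    (hH : ∀ s, |H s| ≤ 1) (hHm : TupleMeasurable H) :
    ‖∫ w, H ((X w).1 ∩ (A ∪ B)) ∂P - ∫ w, ∫ w', H ((X w).1 ∩ A ∪ (X w').1 ∩ B) ∂P ∂P‖ₑ ≤
      ∑' n : ℕ, ENNReal.ofReal ((n.factorial : ℝ)⁻¹ * 2 ^ n) *
        ∫⁻ x, ‖kernelDet K₀ x - kernelDet (blockKernel A K₀) x‖ₑ
          ∂(Measure.pi fun _ : Fin n => μ.restrict A + μ.restrict B) := by
  have : IsFiniteMeasure (μ.restrict A) := ⟨by simpa using hAfin.lt_top⟩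
  have : IsFiniteMeasure (μ.restrict B) := ⟨by simpa using hBfin.lt_top⟩
  have : IsFiniteMeasure (μ.restrict (A ∪ B)) :=
    ⟨by simpa using ⟨hAfin.lt_top, hBfin.lt_top⟩⟩
  have hν : μ.restrict A + μ.restrict B = μ.restrict (A ∪ B) :=
    (Measure.restrict_union hAB hB).symm
  have hPSD := hX.isPSDKernel
  have hKm := hX.kernel.measurable
  have hdiag : ∀ {J : E d → E d → ℝ}, Measurable (Function.uncurry J) →
      Measurable fun x => J x x := fun hJ => hJ.comp (measurable_id.prodMk measurable_id)
  have hle : ∀ x, K₀ x x ≤ M := fun x => (h₀.diag_le x).trans (hM x)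
  refine enorm_sub_le_of_hasSum (M := M) (c := fun x => K x x - K₀ x x) h₀.psd h₀.measurable hle
    (h₀.psd.blockKernel A) (measurable_blockKernel hA h₀.measurable)
    (fun x => by rw [blockKernel_self]; exact hle x) hM0
    ((hdiag hKm).sub (hdiag h₀.measurable)) (fun x => sub_nonneg.2 (h₀.diag_le x))
    (fun x => by linarith [hM x, h₀.psd.diag_nonneg x]) hH hHm ?_ ?_
  · have h := (hX.hasIntensities hM0 hM (hA.union hB)).hasSum_integral hH fun n => hHm.altSum
    refine h.congr_fun fun n => ?_
    rw [hν]
    congr 1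
    refine integral_congr_ae ?_
    filter_upwards [h₀.ae_kernelDet (A := A) n (A ∪ B)] with z hz
    rw [hz.1]
  · have h := hasSum_antidiagonal ((hX.hasIntensities hM0 hM hA).hasSum_prod
      (hX.hasIntensities hM0 hM hB) hH hHm)
    refine h.congr_fun fun n => ?_
    have hb : ∀ z : Fin n → E d, |kernelDet (blockKernel A K) z| ≤ M ^ n := fun z => by
      rw [abs_of_nonneg ((hPSD.blockKernel A).kernelDet_nonneg z)]
      simpa using (hPSD.blockKernel A).kernelDet_le
        (fun x => by rw [blockKernel_self]; exact hM x) z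
    have hint : Integrable (fun z => altSum H z * kernelDet (blockKernel A K) z)
        (Measure.pi fun _ : Fin n => μ.restrict A + μ.restrict B) := by
      refine Integrable.of_bound (C := 2 ^ n * M ^ n) ((hHm.altSum (ι := Fin n)).mul
        (measurable_kernelDet (measurable_blockKernel hA hKm))).aestronglyMeasurable
        (ae_of_all _ fun z => ?_)
      rw [Real.norm_eq_abs, abs_mul]
      refine mul_le_mul ?_ (hb z) (abs_nonneg _) (by positivity)
      simpa using abs_altSum_le (ι := Fin n) (H := H) (z := z) fun _ => hH _
    have h2 := integral_pi_add (μ.restrict A) (μ.restrict B) _ hint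
      (fun k l => ∫ q : (Fin k → E d) × (Fin l → E d),
        altSum H (Sum.elim q.1 q.2) * (kernelDet K q.1 * kernelDet K q.2)
        ∂(Measure.pi fun _ => μ.restrict A).prod (Measure.pi fun _ => μ.restrict B)) ?_
    · have h3 : ∫ z, altSum H z * ∑ S : Finset (Fin n),
          (∏ i ∈ Sᶜ, (K (z i) (z i) - K₀ (z i) (z i))) *
            kernelDet (blockKernel A K₀) (fun i : S => z i)
            ∂(Measure.pi fun _ => μ.restrict A + μ.restrict B) =
          ∫ z : Fin n → E d, altSum H z * kernelDet (blockKernel A K) z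
            ∂(Measure.pi fun _ => μ.restrict A + μ.restrict B) := by
        rw [hν]
        refine integral_congr_ae ?_
        filter_upwards [h₀.ae_kernelDet (A := A) n (A ∪ B)] with z hz
        rw [hz.2]
      rw [h3, h2, Finset.mul_sum]
      refine Finset.sum_congr rfl fun p hp => ?_
      rw [nsmul_eq_mul, ← mul_assoc,
        inv_factorial_mul_choose (Finset.HasAntidiagonal.mem_antidiagonal.1 hp)]
    · intro k l e
      refine integral_congr_ae ?_
      have hA' : ∀ᵐ x ∂(Measure.pi fun _ : Fin k => μ.restrict A), ∀ i, x i ∈ A :=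
        ae_all_iff.2 fun i => (Measure.quasiMeasurePreserving_eval _ i).ae
          (ae_restrict_mem hA)
      have hB' : ∀ᵐ x ∂(Measure.pi fun _ : Fin l => μ.restrict B), ∀ i, x i ∈ B :=
        ae_all_iff.2 fun i => (Measure.quasiMeasurePreserving_eval _ i).ae
          (ae_restrict_mem hB)
      filter_upwards [Measure.quasiMeasurePreserving_fst.ae hA',
        Measure.quasiMeasurePreserving_snd.ae hB'] with q hq1 hq2
      rw [altSum_comp_equiv, kernelDet_comp_equiv, kernelDet_blockKernel K hq1
        fun i hi => hAB.le_bot ⟨hi, hq2 i⟩]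

/-- The trace of the adjugate, weighted with the number of points. More than `N` points have weight
zero; this is for kernels of rank at most `N`. -/
def adjWeight (N : ℕ∞) (L : E d → E d → ℝ) {n : ℕ} (x : Fin n → E d) : ℝ≥0∞ :=
  if (n : ℕ∞) ≤ N then ENNReal.ofReal (n * (kernelMatrix L x).adjugate.trace) else 0

theorem tsum_sum_antidiagonal_ennreal (f : ℕ → ℝ≥0∞) (g : ℕ → ℝ≥0∞) :
    ∑' n, ∑ p ∈ Finset.HasAntidiagonal.antidiagonal n, f p.1 * g p.2 =
      (∑' n, f n) * ∑' n, g n := by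
  have h1 : (∑' n, f n) * ∑' n, g n = ∑' p : ℕ × ℕ, f p.1 * g p.2 := by
    rw [ENNReal.tsum_prod', ← ENNReal.tsum_mul_right]
    simp_rw [ENNReal.tsum_mul_left]
  rw [h1, ← (Finset.HasAntidiagonal.sigmaAntidiagonalEquivProd (A := ℕ)).tsum_eq,
    ENNReal.tsum_sigma']
  refine tsum_congr fun n => ?_
  rw [tsum_fintype]
  exact (Finset.sum_coe_sort (Finset.HasAntidiagonal.antidiagonal n)
    fun p => f p.1 * g p.2).symm

theorem measurable_adjWeight {N : ℕ∞} {L : E d → E d → ℝ} (hL : Measurable (Function.uncurry L))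
    (n : ℕ) : Measurable fun x : Fin n → E d => adjWeight N L x := by
  unfold adjWeight
  split_ifs
  · refine (Measurable.const_mul ?_ _).ennreal_ofReal
    cases n with
    | zero => simp [Matrix.trace]
    | succ n =>
      simp_rw [trace_adjugate_fin]
      refine Finset.measurable_fun_sum _ fun i _ => ?_
      exact (measurable_kernelDet (ι := Fin n) hL).comp
        (measurable_pi_lambda (fun (x : Fin (n + 1) → E d) j => x (i.succAbove j))
          fun j => measurable_pi_apply _)
  · exact measurable_const

/-- The Fischer inequality separates the contributions of `A` and `B`: the off-diagonal block of
`k + l` points has `k l` entries, each at most `ω` in absolute value. -/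
theorem tsum_lintegral_kernelDet_sub_le {ω : ℝ} {N : ℕ∞} (h₀ : IsOffDiagonalVersion μ K K₀)
    (hN : ∀ n : ℕ, N < n → ∀ z : Fin n → E d, kernelDet K₀ z = 0)
    (hA : MeasurableSet A) (hB : MeasurableSet B)
    (hAB : Disjoint A B) (hω : ∀ x ∈ A, ∀ y ∈ B, |K x y| ≤ ω) :
    ∑' n : ℕ, ENNReal.ofReal ((n.factorial : ℝ)⁻¹ * 2 ^ n) *
        ∫⁻ x, ‖kernelDet K₀ x - kernelDet (blockKernel A K₀) x‖ₑ
          ∂(Measure.pi fun _ : Fin n => μ.restrict A + μ.restrict B) ≤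
      ENNReal.ofReal (ω ^ 2) *
        ((∑' n : ℕ, ENNReal.ofReal ((n.factorial : ℝ)⁻¹ * 2 ^ n) *
          ∫⁻ x, adjWeight N K₀ x ∂(Measure.pi fun _ : Fin n => μ.restrict A)) *
        ∑' n : ℕ, ENNReal.ofReal ((n.factorial : ℝ)⁻¹ * 2 ^ n) *
          ∫⁻ x, adjWeight N K₀ x ∂(Measure.pi fun _ : Fin n => μ.restrict B)) := by
  rw [← tsum_sum_antidiagonal_ennreal, ← ENNReal.tsum_mul_left]
  refine ENNReal.tsum_le_tsum fun n => ?_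
  have key := lintegral_pi_add_le (μ.restrict A) (μ.restrict B) (n := n)
    (fun x => ‖kernelDet K₀ x - kernelDet (blockKernel A K₀) x‖ₑ)
    (fun k l => ENNReal.ofReal (ω ^ 2) *
      ((∫⁻ x, adjWeight N K₀ x ∂(Measure.pi fun _ : Fin k => μ.restrict A)) *
      ∫⁻ x, adjWeight N K₀ x ∂(Measure.pi fun _ : Fin l => μ.restrict B))) ?_
  · refine (mul_le_mul_right key _).trans_eq ?_
    rw [Finset.mul_sum, Finset.mul_sum]
    refine Finset.sum_congr rfl fun p hp => ?_
    have hp' := Finset.HasAntidiagonal.mem_antidiagonal.1 hp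
    have hfac : ENNReal.ofReal ((n.factorial : ℝ)⁻¹ * 2 ^ n) * (n.choose p.1 : ℝ≥0∞) =
        ENNReal.ofReal ((p.1.factorial : ℝ)⁻¹ * 2 ^ p.1) *
          ENNReal.ofReal ((p.2.factorial : ℝ)⁻¹ * 2 ^ p.2) := by
      rw [← ENNReal.ofReal_natCast, ← ENNReal.ofReal_mul (by positivity),
        ← ENNReal.ofReal_mul (by positivity)]
      congr 1
      have h1 := inv_factorial_mul_choose hp'
      have h2 : (2 : ℝ) ^ n = 2 ^ p.1 * 2 ^ p.2 := by rw [← pow_add, hp']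
      rw [h2]
      linear_combination (2 : ℝ) ^ p.1 * 2 ^ p.2 * h1
    rw [nsmul_eq_mul, ← mul_assoc, hfac]
    ring
  · intro k l e
    rw [← lintegral_prod_mul (measurable_adjWeight h₀.measurable k).aemeasurable
      (measurable_adjWeight h₀.measurable l).aemeasurable,
      ← lintegral_const_mul' _ _ ENNReal.ofReal_ne_top]
    refine lintegral_mono_ae ?_
    have hA' : ∀ᵐ x ∂(Measure.pi fun _ : Fin k => μ.restrict A), ∀ i, x i ∈ A :=
      ae_all_iff.2 fun i => (Measure.quasiMeasurePreserving_eval _ i).ae (ae_restrict_mem hA)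
    have hB' : ∀ᵐ x ∂(Measure.pi fun _ : Fin l => μ.restrict B), ∀ i, x i ∈ B :=
      ae_all_iff.2 fun i => (Measure.quasiMeasurePreserving_eval _ i).ae (ae_restrict_mem hB)
    have h0 : ∀ᵐ q ∂(μ.restrict A).prod (μ.restrict B), K q.1 q.2 = K₀ q.1 q.2 := by
      rw [Measure.prod_restrict]
      exact ae_restrict_of_ae h₀.ae_eq
    have h1 : ∀ᵐ q ∂(Measure.pi fun _ : Fin k => μ.restrict A).prod
        (Measure.pi fun _ : Fin l => μ.restrict B), ∀ i j, K (q.1 i) (q.2 j) = K₀ (q.1 i) (q.2 j) :=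
      ae_all_iff.2 fun i => ae_all_iff.2 fun j => by
        have hm := QuasiMeasurePreserving.prodMap
          (Measure.quasiMeasurePreserving_eval (fun _ : Fin k => μ.restrict A) i)
          (Measure.quasiMeasurePreserving_eval (fun _ : Fin l => μ.restrict B) j)
        exact hm.ae h0
    filter_upwards [Measure.quasiMeasurePreserving_fst.ae hA',
      Measure.quasiMeasurePreserving_snd.ae hB', h1] with q hq1 hq2 hq
    rw [kernelDet_comp_equiv, kernelDet_comp_equiv, kernelDet_blockKernel K₀ hq1
      fun i hi => hAB.le_bot ⟨hi, hq2 i⟩]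
    obtain ⟨hb1, hb2⟩ := h₀.psd.kernelDet_sumElim_bounds q.1 q.2
    have hnn := h₀.psd.kernelDet_nonneg (Sum.elim q.1 q.2)
    by_cases hkl : (k : ℕ∞) ≤ N ∧ (l : ℕ∞) ≤ N
    · rw [adjWeight, adjWeight, if_pos hkl.1, if_pos hkl.2,
        ← ENNReal.ofReal_mul (mul_nonneg (by positivity) (h₀.psd.trace_adjugate_nonneg _)),
        ← ENNReal.ofReal_mul (sq_nonneg _), Real.enorm_eq_ofReal_abs]
      refine ENNReal.ofReal_le_ofReal ?_
      rw [abs_sub_comm, abs_of_nonneg (sub_nonneg.2 hb1)]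
      refine hb2.trans ?_
      have hsum : ∑ i, ∑ j, K₀ (q.1 i) (q.2 j) ^ 2 ≤ ∑ i : Fin k, ∑ j : Fin l, ω ^ 2 := by
        refine Finset.sum_le_sum fun i _ => Finset.sum_le_sum fun j _ => ?_
        rw [← hq i j, ← sq_abs]
        exact pow_le_pow_left₀ (abs_nonneg _) (hω _ (hq1 i) _ (hq2 j)) 2
      calc _ ≤ _ := mul_le_mul_of_nonneg_left hsum (mul_nonneg
            (h₀.psd.trace_adjugate_nonneg _) (h₀.psd.trace_adjugate_nonneg _))
        _ = _ := by simp; ring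
    · have hzero : kernelDet K₀ q.1 * kernelDet K₀ q.2 = 0 := by
        rw [not_and_or, not_le, not_le] at hkl
        rcases hkl with hkl | hkl
        · rw [hN k hkl, zero_mul]
        · rw [hN l hkl, mul_zero]
      rw [hzero] at hb1 ⊢
      rw [le_antisymm hb1 hnn]
      simp

end PointProcess

end

noncomputable section

/-! ### The series of weights -/

namespace PointProcess

variable {d : ℕ} {ν : Measure (E d)} [IsFiniteMeasure ν] {L : E d → E d → ℝ} {N : ℕ∞}

theorem lintegral_adjWeight_succ_le (hL : IsPSDKernel L) (hLm : Measurable (Function.uncurry L))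
    (n : ℕ) :
    ∫⁻ x, adjWeight N L x ∂(Measure.pi fun _ : Fin (n + 1) => ν) ≤
      ((n : ℝ≥0∞) + 1) ^ 2 * ν Set.univ *
        ∫⁻ x, ENNReal.ofReal (kernelDet L x) ∂(Measure.pi fun _ : Fin n => ν) := by
  have h1 : ∀ x : Fin (n + 1) → E d, adjWeight N L x ≤
      ((n : ℝ≥0∞) + 1) * ∑ i : Fin (n + 1), ENNReal.ofReal (kernelDet L fun j => x (i.succAbove j)) := by
    intro x
    unfold adjWeight
    split_ifs
    · rw [trace_adjugate_fin, ENNReal.ofReal_mul (by positivity), ENNReal.ofReal_natCast,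
        ENNReal.ofReal_sum_of_nonneg fun i _ => hL.kernelDet_nonneg (x ∘ i.succAbove)]
      push_cast
      exact le_rfl
    · exact zero_le
  have h2 : ∀ i : Fin (n + 1), ∫⁻ x, ENNReal.ofReal (kernelDet L fun j => x (i.succAbove j))
      ∂(Measure.pi fun _ : Fin (n + 1) => ν) =
      ν Set.univ * ∫⁻ x, ENNReal.ofReal (kernelDet L x) ∂(Measure.pi fun _ : Fin n => ν) := by
    intro i
    have hm := measurePreserving_piFinSuccAbove (fun _ : Fin (n + 1) => ν) i
    have hk : Measurable fun y : Fin n → E d => ENNReal.ofReal (kernelDet L y) :=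
      (measurable_kernelDet hLm).ennreal_ofReal
    have h3 := hm.lintegral_comp (f := fun q => ENNReal.ofReal (kernelDet L q.2))
      (hk.comp measurable_snd)
    refine h3.trans ?_
    rw [lintegral_prod (fun q : E d × (Fin n → E d) => ENNReal.ofReal (kernelDet L q.2))
      (hk.comp measurable_snd).aemeasurable]
    exact (lintegral_const (∫⁻ x, ENNReal.ofReal (kernelDet L x)
      ∂(Measure.pi fun _ : Fin n => ν))).trans (mul_comm _ _)
  calc _ ≤ _ := lintegral_mono h1
    _ = _ := by
      rw [lintegral_const_mul' _ _ (by finiteness), lintegral_finsetSum]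
      · simp_rw [h2]
        simp
        ring
      · intro i _
        exact ((measurable_kernelDet (ι := Fin n) hLm).comp
          (measurable_pi_lambda (fun (x : Fin (n + 1) → E d) j => x (i.succAbove j))
            fun j => measurable_pi_apply _)).ennreal_ofReal

/-- The factor `(n + 1)²` of `lintegral_adjWeight_succ_le` is cancelled up to `n + 1` by the
factorial `(n + 1)!`. -/
theorem tsum_lintegral_adjWeight_le (hL : IsPSDKernel L) (hLm : Measurable (Function.uncurry L))
    {p : ℝ} (hp0 : 0 ≤ p) (hp : ν Set.univ ≤ ENNReal.ofReal p) {R : ℕ → ℝ} (hR0 : ∀ n, 0 ≤ R n)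
    (hR : ∀ n, ∫⁻ x, ENNReal.ofReal (kernelDet L x) ∂(Measure.pi fun _ : Fin n => ν) ≤
      ENNReal.ofReal (R n)) {s : ℝ}
    (hs : HasSum (fun n : ℕ => if ((n + 1 : ℕ) : ℕ∞) ≤ N then
      (n + 1) * (2 ^ n * R n / n.factorial) else 0) s) :
    ∑' n : ℕ, ENNReal.ofReal ((n.factorial : ℝ)⁻¹ * 2 ^ n) *
      ∫⁻ x, adjWeight N L x ∂(Measure.pi fun _ : Fin n => ν) ≤ ENNReal.ofReal (2 * p * s) := by
  rw [tsum_eq_zero_add' ENNReal.summable]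
  have h0 : ∫⁻ x, adjWeight N L x ∂(Measure.pi fun _ : Fin 0 => ν) = 0 := by
    simp [adjWeight]
  rw [h0, mul_zero, zero_add, ← (hs.mul_left (2 * p)).tsum_eq,
    ENNReal.ofReal_tsum_of_nonneg _ (hs.mul_left (2 * p)).summable]
  · refine ENNReal.tsum_le_tsum fun n => ?_
    split_ifs with hn
    · calc _ ≤ ENNReal.ofReal (((n + 1).factorial : ℝ)⁻¹ * 2 ^ (n + 1)) *
            (((n : ℝ≥0∞) + 1) ^ 2 * ENNReal.ofReal p * ENNReal.ofReal (R n)) := by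
            gcongr
            refine (lintegral_adjWeight_succ_le hL hLm n).trans ?_
            gcongr
            exact hR n
        _ = _ := by
            have : ((n : ℝ≥0∞) + 1) = ENNReal.ofReal (n + 1) := by
              rw [ENNReal.ofReal_add (by positivity) zero_le_one, ENNReal.ofReal_natCast,
                ENNReal.ofReal_one]
            rw [this, ← ENNReal.ofReal_pow (by positivity), ← ENNReal.ofReal_mul (by positivity),
              ← ENNReal.ofReal_mul (by positivity), ← ENNReal.ofReal_mul (by positivity)]
            congr 1
            rw [Nat.factorial_succ]
            push_cast
            field_simp
            ring
    · have : ∀ x : Fin (n + 1) → E d, adjWeight N L x = 0 := fun x => if_neg hn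
      simp [this]
  · intro n
    split_ifs
    · have := hR0 n
      positivity
    · simp

theorem hasSum_succ_mul_pow_div_factorial (x : ℝ) :
    HasSum (fun n : ℕ => ((n : ℝ) + 1) * (x ^ n / n.factorial)) ((1 + x) * Real.exp x) := by
  have hexp : HasSum (fun n : ℕ => x ^ n / (n.factorial : ℝ)) (Real.exp x) := by
    rw [Real.exp_eq_exp_ℝ]; exact NormedSpace.expSeries_div_hasSum_exp x
  have h2 : HasSum (fun n : ℕ => (n : ℝ) * (x ^ n / n.factorial)) (x * Real.exp x) := by
    rw [← hasSum_nat_add_iff' 1]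
    simp only [Finset.sum_range_one, Nat.cast_zero, zero_mul, sub_zero]
    refine (hexp.mul_left x).congr_fun fun n => ?_
    rw [Nat.factorial_succ]
    push_cast
    field_simp
    ring
  have h := h2.add hexp
  rw [show (1 + x) * Real.exp x = x * Real.exp x + Real.exp x by ring]
  exact h.congr_fun fun n => by ring

/-- Bounded kernels: `∫ det L ≤ (M p)ⁿ` by Hadamard's inequality. -/
theorem tsum_lintegral_adjWeight_le_exp (hL : IsPSDKernel L)
    (hLm : Measurable (Function.uncurry L)) {M : ℝ} (hM0 : 0 ≤ M) (hM : ∀ x, L x x ≤ M) {p : ℝ}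
    (hp0 : 0 ≤ p) (hp : ν Set.univ ≤ ENNReal.ofReal p) :
    ∑' n : ℕ, ENNReal.ofReal ((n.factorial : ℝ)⁻¹ * 2 ^ n) *
      ∫⁻ x, adjWeight ⊤ L x ∂(Measure.pi fun _ : Fin n => ν) ≤
        ENNReal.ofReal (2 * p * ((1 + 2 * p * M) * Real.exp (2 * M * p))) := by
  refine tsum_lintegral_adjWeight_le hL hLm hp0 hp (R := fun n => (M * p) ^ n)
    (fun n => by positivity) (fun n => ?_) ?_
  · calc _ ≤ ∫⁻ x : Fin n → E d, ENNReal.ofReal (M ^ n) ∂(Measure.pi fun _ => ν) :=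
          lintegral_mono fun x => ENNReal.ofReal_le_ofReal (by simpa using hL.kernelDet_le hM x)
      _ = ENNReal.ofReal (M ^ n) * ν Set.univ ^ n := by
          rw [lintegral_const, Measure.pi_univ]; simp
      _ ≤ ENNReal.ofReal (M ^ n) * ENNReal.ofReal p ^ n := by gcongr
      _ = _ := by
          rw [← ENNReal.ofReal_pow hp0, ← ENNReal.ofReal_mul (by positivity), mul_pow]
  · have h := hasSum_succ_mul_pow_div_factorial (2 * M * p)
    rw [show 1 + 2 * p * M = 1 + 2 * M * p by ring]
    refine h.congr_fun fun n => ?_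
    rw [if_pos le_top]
    ring

/-- Kernels of rank `N`: the terms are bounded by those of `N ∑ 2ⁿ (N choose n) = N 3ᴺ`. -/
theorem tsum_lintegral_adjWeight_le_of_rank (hL : IsPSDKernel L)
    (hLm : Measurable (Function.uncurry L)) (N : ℕ) {p : ℝ}
    (hp0 : 0 ≤ p) (hp : ν Set.univ ≤ ENNReal.ofReal p)
    (hR : ∀ n, ∫⁻ x, ENNReal.ofReal (kernelDet L x) ∂(Measure.pi fun _ : Fin n => ν) ≤
      ENNReal.ofReal (N.descFactorial n)) :
    ∑' n : ℕ, ENNReal.ofReal ((n.factorial : ℝ)⁻¹ * 2 ^ n) *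
      ∫⁻ x, adjWeight N L x ∂(Measure.pi fun _ : Fin n => ν) ≤
        ENNReal.ofReal (2 * p * (N * 3 ^ N)) := by
  have hs := hasSum_sum_of_ne_finset_zero (L := .unconditional ℕ) (s := Finset.range N)
    (f := fun n : ℕ => if ((n + 1 : ℕ) : ℕ∞) ≤ N then
      ((n : ℝ) + 1) * (2 ^ n * N.descFactorial n / n.factorial) else 0) fun n hn => by
      rw [if_neg]
      rw [Nat.cast_le]
      simpa using hn
  refine (tsum_lintegral_adjWeight_le hL hLm hp0 hp (R := fun n => (N.descFactorial n : ℝ))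
    (fun n => by positivity) hR hs).trans (ENNReal.ofReal_le_ofReal ?_)
  refine mul_le_mul_of_nonneg_left ?_ (by positivity)
  have h3 : (3 : ℝ) ^ N = ∑ n ∈ Finset.range (N + 1), 2 ^ n * (N.choose n : ℝ) := by
    have := add_pow (2 : ℝ) 1 N
    norm_num at this
    exact this
  calc _ ≤ ∑ n ∈ Finset.range N, (N : ℝ) * (2 ^ n * (N.choose n : ℝ)) := by
        refine Finset.sum_le_sum fun n hn => ?_
        rw [Finset.mem_range] at hn
        rw [if_pos (by rw [Nat.cast_le]; exact hn), Nat.choose_eq_descFactorial_div_factorial,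
          Nat.cast_div (Nat.factorial_dvd_descFactorial N n) (by positivity), mul_div_assoc]
        exact mul_le_mul_of_nonneg_right (by exact_mod_cast hn) (by positivity)
    _ ≤ ∑ n ∈ Finset.range (N + 1), (N : ℝ) * (2 ^ n * (N.choose n : ℝ)) :=
        Finset.sum_le_sum_of_subset_of_nonneg (Finset.range_mono (Nat.le_succ N))
          fun _ _ _ => by positivity
    _ = N * 3 ^ N := by rw [← Finset.mul_sum, h3]

end PointProcess

end

noncomputable section

/-! ### Mixing coefficients -/

namespace PointProcess

theorem tvDist_map_prodMk_le {Ω Ω₁ Ω₂ : Type*} [MeasurableSpace Ω] [MeasurableSpace Ω₁]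
    [MeasurableSpace Ω₂] {P : Measure Ω} [IsProbabilityMeasure P] {f : Ω → Ω₁} {g : Ω → Ω₂}
    (hf : Measurable f) (hg : Measurable g) {C : ℝ} (hC : 0 ≤ C)
    (h : ∀ S : Set (Ω₁ × Ω₂), MeasurableSet S →
      |∫ w, S.indicator (fun _ => (1 : ℝ)) (f w, g w) ∂P -
        ∫ w, ∫ w', S.indicator (fun _ => (1 : ℝ)) (f w, g w') ∂P ∂P| ≤ C) :
    tvDist (P.map fun w => (f w, g w)) ((P.map f).prod (P.map g)) ≤ C := by
  refine Real.iSup_le (fun S => ?_) hC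
  obtain ⟨S, hS⟩ := S
  have hfP : IsProbabilityMeasure (P.map f) := Measure.isProbabilityMeasure_map hf.aemeasurable
  have hgP : IsProbabilityMeasure (P.map g) := Measure.isProbabilityMeasure_map hg.aemeasurable
  have hind : StronglyMeasurable (S.indicator fun _ => (1 : ℝ)) :=
    stronglyMeasurable_const.indicator hS
  have h1 : (P.map fun w => (f w, g w)).real S =
      ∫ w, S.indicator (fun _ => (1 : ℝ)) (f w, g w) ∂P := by
    rw [← integral_indicator_one hS]
    exact integral_map (hf.prodMk hg).aemeasurable hind.aestronglyMeasurable
  have h2 : ((P.map f).prod (P.map g)).real S =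
      ∫ w, ∫ w', S.indicator (fun _ => (1 : ℝ)) (f w, g w') ∂P ∂P := by
    rw [← integral_indicator_one hS]
    have hi : Integrable (S.indicator fun _ => (1 : ℝ)) ((P.map f).prod (P.map g)) :=
      (integrable_const _).indicator hS
    refine (integral_prod _ hi).trans ?_
    rw [integral_map hf.aemeasurable hind.integral_prod_right'.aestronglyMeasurable]
    refine integral_congr_ae (ae_of_all _ fun w => ?_)
    exact integral_map hg.aemeasurable (hind.comp_measurable
      measurable_prodMk_left).aestronglyMeasurable
  rw [h1, h2]
  exact h S hS

variable {d : ℕ}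

/-- The configuration of the points of a finite tuple. -/
def Config.ofTuple {n : ℕ} (x : Fin n → E d) : Config d :=
  ⟨Set.range x, fun _ _ => (Set.finite_range x).inter_of_left _⟩

theorem Config.measurable_of_count {β : Type*} [MeasurableSpace β] {f : β → Config d}
    (h : ∀ C, MeasurableSet C → Measurable[_, ⊤] fun b => Config.count C (f b)) :
    Measurable f := by
  refine Measurable.of_comap_le ?_
  rw [Config.instMeasurableSpace, MeasurableSpace.comap_iSup]
  refine iSup_le fun C => ?_
  rw [MeasurableSpace.comap_comp]
  exact (h C.1 C.2).comap_le

theorem Config.measurable_ofTuple (n : ℕ) :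
    Measurable (Config.ofTuple : (Fin n → E d) → Config d) := by
  refine Config.measurable_of_count fun C hC => ?_
  induction n with
  | zero =>
    have h : (fun x : Fin 0 → E d => Config.count C (Config.ofTuple x)) =
        fun _ => Config.count C (Config.ofTuple default) :=
      funext fun x => by rw [Subsingleton.elim x default]
    rw [h]
    exact @measurable_const _ _ ⊤ _ _
  | succ n ih =>
    -- The first point is counted if it lies in `C` and is not among the others.
    let T : Set (Fin (n + 1) → E d) := {x | x 0 ∈ C} ∩ ⋂ j : Fin n, {x | x j.succ = x 0}ᶜ
    have hT : MeasurableSet T := by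
      refine MeasurableSet.inter (measurable_pi_apply 0 hC) ?_
      exact MeasurableSet.iInter fun j =>
        (measurableSet_eq_fun (measurable_pi_apply j.succ) (measurable_pi_apply 0)).compl
    have htail : Measurable fun x : Fin (n + 1) → E d => fun j : Fin n => x j.succ :=
      measurable_pi_lambda _ fun j => measurable_pi_apply _
    have h1 : Measurable[_, ⊤] fun x : Fin (n + 1) → E d =>
        Config.count C (Config.ofTuple fun j : Fin n => x j.succ) := ih.comp htail
    have h2 : Measurable[_, ⊤] fun x : Fin (n + 1) → E d =>
        Config.count C (Config.ofTuple fun j : Fin n => x j.succ) + 1 :=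
      (measurable_from_top (f := fun k : ℕ∞ => k + 1)).comp h1
    have heq : (fun x : Fin (n + 1) → E d => Config.count C (Config.ofTuple x)) =
        fun x => @ite _ (x ∈ T) (Classical.dec _)
          (Config.count C (Config.ofTuple fun j : Fin n => x j.succ) + 1)
          (Config.count C (Config.ofTuple fun j : Fin n => x j.succ)) := by
      classical
      funext x
      have hr : Set.range x = insert (x 0) (Set.range fun j : Fin n => x j.succ) := by
        conv_lhs => rw [← Fin.cons_self_tail x, Fin.range_cons]
        rfl
      simp only [Config.count, Config.ofTuple, hr]
      by_cases hC0 : x 0 ∈ C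
      · rw [Set.insert_inter_of_mem hC0]
        by_cases hx : x ∈ T
        · rw [if_pos hx, Set.encard_insert_of_notMem]
          rintro ⟨⟨j, hj⟩, -⟩
          exact Set.mem_iInter.1 hx.2 j hj
        · rw [if_neg hx]
          have : ∃ j : Fin n, x j.succ = x 0 := by
            by_contra hcon
            exact hx ⟨hC0, Set.mem_iInter.2 fun j hj => hcon ⟨j, hj⟩⟩
          obtain ⟨j, hj⟩ := this
          rw [Set.insert_eq_of_mem (show x 0 ∈ (Set.range fun j : Fin n => x j.succ) ∩ C from
            ⟨⟨j, hj⟩, hC0⟩)]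
      · rw [Set.insert_inter_of_notMem hC0, if_neg fun hx => hC0 hx.1]
    rw [heq]
    exact Measurable.ite (mβ := ⊤) hT h2 h1

theorem tvDist_nonneg {β : Type*} [MeasurableSpace β] (μ ν : Measure β) : 0 ≤ tvDist μ ν :=
  Real.iSup_nonneg fun _ => abs_nonneg _

theorem betaMix_nonneg {Ω : Type*} [MeasurableSpace Ω] {P : Measure Ω} {X : Ω → Config d}
    {μ : Measure (E d)} (p q r : ℝ≥0) : 0 ≤ betaMix P μ X p q r := by
  refine Real.sSup_nonneg ?_
  rintro b ⟨A, B, -, -, -, -, -, rfl⟩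
  exact @tvDist_nonneg _ ((localSigma X A).prod (localSigma X B)) _ _

variable {Ω : Type*} [MeasurableSpace Ω] {P : Measure Ω} [IsProbabilityMeasure P]
  {X : Ω → Config d} {A B : Set (E d)}

/-- An event of `ℰ(A) ⊗ ℰ(B)` is determined by one configuration in `A ∪ B`, because `A` and `B` are
disjoint; `H` is its indicator function. -/
theorem betaCoeff_localSigma_le (hX : Measurable X) (hA : MeasurableSet A) (hB : MeasurableSet B)
    (hAB : Disjoint A B) {C : ℝ} (hC : 0 ≤ C)
    (h : ∀ H : Set (E d) → ℝ, (∀ s, |H s| ≤ 1) → TupleMeasurable H →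
      |∫ w, H ((X w).1 ∩ (A ∪ B)) ∂P - ∫ w, ∫ w', H ((X w).1 ∩ A ∪ (X w').1 ∩ B) ∂P ∂P| ≤ C) :
    betaCoeff P (localSigma X A) (localSigma X B) ≤ C := by
  classical
  have hidA : Measurable[_, localSigma X A] (id : Ω → Ω) :=
    measurable_id'' (localSigma_le hX hA)
  have hidB : Measurable[_, localSigma X B] (id : Ω → Ω) :=
    measurable_id'' (localSigma_le hX hB)
  refine @tvDist_map_prodMk_le Ω Ω Ω _ (localSigma X A) (localSigma X B) P _ id id hidA hidB C hC ?_
  intro S hS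
  let Φ : Ω × Ω → Config d × Config d := fun p => ((X p.1).restrict A, (X p.2).restrict B)
  have hle : (localSigma X A).prod (localSigma X B) ≤
      MeasurableSpace.comap Φ Prod.instMeasurableSpace := by
    refine sup_le ?_ ?_
    · rw [MeasurableSpace.comap_comp]
      exact (measurable_fst.comp (comap_measurable Φ)).comap_le
    · rw [MeasurableSpace.comap_comp]
      exact (measurable_snd.comp (comap_measurable Φ)).comap_le
  obtain ⟨T, hT, rfl⟩ := hle S hS
  -- The value on sets that are not locally finite is irrelevant.
  let H : Set (E d) → ℝ := fun s =>
    if hs : ∀ B : Set (E d), Bornology.IsBounded B → (s ∩ B).Finite then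
      T.indicator (fun _ => (1 : ℝ)) (Config.restrict A ⟨s, hs⟩, Config.restrict B ⟨s, hs⟩) else 0
  have hval : ∀ {s s₁ s₂ : Config d}, s.1 ∩ A = s₁.1 ∩ A → s.1 ∩ B = s₂.1 ∩ B →
      H s.1 = T.indicator (fun _ => (1 : ℝ)) (s₁.restrict A, s₂.restrict B) := by
    intro s s₁ s₂ h1 h2
    have e1 : s.restrict A = s₁.restrict A := Subtype.ext h1
    have e2 : s.restrict B = s₂.restrict B := Subtype.ext h2
    rw [← e1, ← e2]
    exact dif_pos s.2
  have hA2 : ∀ s t : Set (E d), (s ∩ A ∪ t ∩ B) ∩ A = s ∩ A := fun s t => by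
    rw [Set.union_inter_distrib_right, Set.inter_assoc t, hAB.symm.inter_eq, Set.inter_assoc]
    simp
  have hB2 : ∀ s t : Set (E d), (s ∩ A ∪ t ∩ B) ∩ B = t ∩ B := fun s t => by
    rw [Set.union_inter_distrib_right, Set.inter_assoc s, hAB.inter_eq, Set.inter_assoc]
    simp
  have h1 : ∀ w, H ((X w).1 ∩ (A ∪ B)) =
      (Φ ⁻¹' T).indicator (fun _ => (1 : ℝ)) (id w, id w) := fun w =>
    hval (s := (X w).restrict (A ∪ B)) (s₁ := X w) (s₂ := X w)
      (by simp [Config.restrict, Set.inter_assoc, Set.union_inter_cancel_left])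
      (by simp [Config.restrict, Set.inter_assoc, Set.union_inter_cancel_right])
  have h2 : ∀ w w', H ((X w).1 ∩ A ∪ (X w').1 ∩ B) =
      (Φ ⁻¹' T).indicator (fun _ => (1 : ℝ)) (id w, id w') := fun w w' =>
    hval (s := ⟨(X w).1 ∩ A ∪ (X w').1 ∩ B, fun D hD => by
        rw [Set.union_inter_distrib_right]
        exact (((X w).restrict A).2 D hD).union (((X w').restrict B).2 D hD)⟩)
      (s₁ := X w) (s₂ := X w') (hA2 _ _) (hB2 _ _)
  simp_rw [← h1, ← h2]
  refine h H (fun s => ?_) fun n => ?_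
  · simp only [H]
    split_ifs
    · by_cases hmem : (Config.restrict A ⟨s, ‹_›⟩, Config.restrict B ⟨s, ‹_›⟩) ∈ T
      · simp [hmem]
      · simp [hmem]
    · simp
  · have : (fun x : Fin n → E d => H (Set.range x)) = fun x =>
        T.indicator (fun _ => (1 : ℝ))
          ((Config.ofTuple x).restrict A, (Config.ofTuple x).restrict B) :=
      funext fun x => hval (s := Config.ofTuple x) rfl rfl
    rw [this]
    exact (measurable_const.indicator hT).comp
      (((Config.measurable_restrict hA).comp (Config.measurable_ofTuple n)).prodMk
        ((Config.measurable_restrict hB).comp (Config.measurable_ofTuple n)))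

theorem betaMix_le {μ : Measure (E d)} (hX : Measurable X) {p q r : ℝ≥0} {C : ℝ} (hC : 0 ≤ C)
    (h : ∀ A B : Set (E d), MeasurableSet A → MeasurableSet B → μ A ≤ p → μ B ≤ q →
      Disjoint A B → (∀ x ∈ A, ∀ y ∈ B, (r : ℝ) ≤ ‖y - x‖) →
      ∀ H : Set (E d) → ℝ, (∀ s, |H s| ≤ 1) → TupleMeasurable H →
      |∫ w, H ((X w).1 ∩ (A ∪ B)) ∂P - ∫ w, ∫ w', H ((X w).1 ∩ A ∪ (X w').1 ∩ B) ∂P ∂P| ≤ C) :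
    betaMix P μ X p q r ≤ C := by
  refine Real.sSup_le ?_ hC
  rintro b ⟨A, B, hA, hB, hAp, hBq, hr, rfl⟩
  have hdist : ∀ x ∈ A, ∀ y ∈ B, (r : ℝ≥0∞) < edist x y := fun x hx y hy =>
    hr.trans_le ((iInf₂_le x hx).trans (iInf₂_le y hy))
  have hAB : Disjoint A B := Set.disjoint_left.2 fun x hx hx' => by
    have := hdist x hx x hx'
    simp at this
  refine betaCoeff_localSigma_le hX hA hB hAB hC (h A B hA hB hAp hBq hAB fun x hx y hy => ?_)
  have h1 := (hdist x hx y hy).le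
  rw [edist_nndist, ENNReal.coe_le_coe] at h1
  rw [← dist_eq_norm, dist_comm]
  exact h1

end PointProcess

end

noncomputable section

/-! ### The integral operator -/

namespace PointProcess

section Hilbert

variable {H : Type*} [NormedAddCommGroup H] [InnerProductSpace ℝ H]

theorem IsTraceClassUnit.inner_comm {H : Type} [NormedAddCommGroup H] [InnerProductSpace ℝ H]
    {T : H →L[ℝ] H} (hT : IsTraceClassUnit T) (f g : H) :
    inner ℝ g (T f) = inner ℝ f (T g) := by
  obtain ⟨ι, b, l, hb, -, -⟩ := hT
  have h : ∀ f g : H, HasSum (fun i => b.repr f i * (l i * b.repr g i)) (inner ℝ g (T f)) := by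
    intro f g
    have h1 := ((b.hasSum_repr f).mapL T).mapL (innerSL ℝ g)
    simpa [hb, b.repr_apply_apply, inner_smul_right, real_inner_comm] using h1
  refine (h f g).unique ?_
  convert h g f using 2
  ring

theorem IsTraceClassUnit.inner_mem_Icc {H : Type} [NormedAddCommGroup H] [InnerProductSpace ℝ H]
    {T : H →L[ℝ] H} (hT : IsTraceClassUnit T) (f : H) :
    inner ℝ f (T f) ∈ Set.Icc 0 (‖f‖ ^ 2) := by
  obtain ⟨ι, b, l, hb, hl, -⟩ := hT
  have h : HasSum (fun i => b.repr f i * (l i * b.repr f i)) (inner ℝ f (T f)) := by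
    have h1 := ((b.hasSum_repr f).mapL T).mapL (innerSL ℝ f)
    simpa [hb, b.repr_apply_apply, inner_smul_right, real_inner_comm] using h1
  have h2 : HasSum (fun i => b.repr f i * b.repr f i) (‖f‖ ^ 2) := by
    have h1 := (b.hasSum_repr f).mapL (innerSL ℝ f)
    simpa [b.repr_apply_apply, inner_smul_right, real_inner_comm] using h1
  refine ⟨h.nonneg fun i => ?_, hasSum_le (fun i => ?_) h h2⟩
  · have := (hl i).1
    nlinarith [mul_self_nonneg (b.repr f i)]
  · have := (hl i).2
    nlinarith [mul_self_nonneg (b.repr f i)]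

/-- A symmetric operator of finite rank with spectrum in `[0, 1]` is `f ↦ ∑ ⟨ψᵢ, f⟩ ψᵢ`, where the
`ψᵢ` are the eigenvectors, scaled by the square roots of their eigenvalues. -/
theorem exists_orthogonal_of_rank_le {T : H →L[ℝ] H} {N : ℕ}
    (hrank : LinearMap.rank (T : H →ₗ[ℝ] H) ≤ N)
    (hsymm : ∀ f g, inner ℝ g (T f) = inner ℝ f (T g))
    (h01 : ∀ f, inner ℝ f (T f) ∈ Set.Icc 0 (‖f‖ ^ 2)) :
    ∃ n ≤ N, ∃ ψ : Fin n → H, (∀ i j, i ≠ j → inner ℝ (ψ i) (ψ j) = 0) ∧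
      (∀ i, inner ℝ (ψ i) (ψ i) ≤ 1) ∧ ∀ f, T f = ∑ i, inner ℝ (ψ i) f • ψ i := by
  let V : Submodule ℝ H := LinearMap.range (T : H →ₗ[ℝ] H)
  have hVrank : Module.rank ℝ V ≤ N := hrank
  have hVfin : FiniteDimensional ℝ V :=
    Module.rank_lt_aleph0_iff.1 (hVrank.trans_lt (Cardinal.natCast_lt_aleph0))
  have hn : Module.finrank ℝ V ≤ N := Module.finrank_le_of_rank_le hVrank
  have hinv : ∀ v ∈ V, (T : H →ₗ[ℝ] H) v ∈ V := fun v _ => ⟨v, rfl⟩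
  have hS : (T : H →ₗ[ℝ] H).IsSymmetric := fun f g => by
    rw [real_inner_comm]; exact hsymm f g
  have hSV := hS.restrict_invariant hinv
  let b := hSV.eigenvectorBasis rfl
  let l := hSV.eigenvalues rfl
  have hb : ∀ i, T (b i : H) = l i • (b i : H) := fun i =>
    congrArg Subtype.val (hSV.apply_eigenvectorBasis rfl i)
  have hin : ∀ i j, inner ℝ (b i : H) (b j) = if i = j then 1 else 0 := fun i j => by
    have := orthonormal_iff_ite.1 b.orthonormal i j
    simpa using this
  have hl : ∀ i, l i ∈ Set.Icc (0 : ℝ) 1 := fun i => by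
    have h := h01 (b i : H)
    rw [hb, inner_smul_right, hin, if_pos rfl, ← real_inner_self_eq_norm_sq, hin, if_pos rfl,
      mul_one] at h
    exact h
  have hsqrt : ∀ i, √(l i) * √(l i) = l i := fun i => Real.mul_self_sqrt (hl i).1
  refine ⟨Module.finrank ℝ V, hn, fun i => √(l i) • (b i : H), fun i j hij => ?_, fun i => ?_,
    fun f => ?_⟩
  · rw [inner_smul_left, inner_smul_right, hin, if_neg hij]
    simp
  · rw [inner_smul_left, inner_smul_right, hin, if_pos rfl]
    simpa [hsqrt] using (hl i).2
  · have h := b.sum_repr' ⟨T f, f, rfl⟩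
    have h2 := congrArg Subtype.val h
    simp only [Submodule.coe_sum, Submodule.coe_smul, Submodule.coe_inner] at h2
    rw [← h2]
    refine Finset.sum_congr rfl fun i _ => ?_
    rw [hsymm, hb, inner_smul_right, inner_smul_left, smul_smul]
    have := hsqrt i
    congr 1
    simp only [RCLike.conj_to_real]
    rw [real_inner_comm]
    linear_combination (-inner ℝ (b i : H) f) * this

end Hilbert

variable {d : ℕ} {μ : Measure (E d)} {K : E d → E d → ℝ}

/-- The pairing `⟨g, T f⟩` is that of the local operator, if `f` and `g` vanish off `D`. -/
theorem IsIntegralOperator.inner_eq_restrict {T : Lp ℝ 2 μ →L[ℝ] Lp ℝ 2 μ}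
    (hT : IsIntegralOperator K μ T) {D : Set (E d)}
    {T' : Lp ℝ 2 (μ.restrict D) →L[ℝ] Lp ℝ 2 (μ.restrict D)}
    (hT' : IsIntegralOperator K (μ.restrict D) T') {f g : Lp ℝ 2 μ}
    (hf : ∀ᵐ x ∂μ, x ∉ D → f x = 0) (hg : ∀ᵐ x ∂μ, x ∉ D → g x = 0) :
    inner ℝ g (T f) = inner ℝ ((Lp.memLp g).restrict D).toLp (T' ((Lp.memLp f).restrict D).toLp) := by
  rw [L2.inner_def, L2.inner_def, ← setIntegral_eq_integral_of_ae_compl_eq_zero (s := D)]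
  · refine integral_congr_ae ?_
    have hfD : ((Lp.memLp f).restrict D).toLp =ᵐ[μ.restrict D] f := MemLp.coeFn_toLp _
    filter_upwards [ae_restrict_of_ae (hT f).2, (hT' ((Lp.memLp f).restrict D).toLp).2,
      ((Lp.memLp g).restrict D).coeFn_toLp] with x h1 h2 h3
    rw [h1, h2, h3, ← setIntegral_eq_integral_of_ae_compl_eq_zero (s := D)]
    · congr 1
      refine integral_congr_ae ?_
      filter_upwards [hfD] with y hy
      rw [hy]
    · filter_upwards [hf] with y hy hyD
      rw [hy hyD, mul_zero]
  · filter_upwards [hg] with y hy hyD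
    rw [hy hyD, inner_zero_left]

theorem IsIntegralOperator.exists_isTraceClassUnit {T : Lp ℝ 2 μ →L[ℝ] Lp ℝ 2 μ}
    (hT : IsIntegralOperator K μ T) (hK : IsDPPKernel μ K) (r : ℝ) :
    ∃ T' : Lp ℝ 2 (μ.restrict (Metric.ball (0 : E d) r)) →L[ℝ]
        Lp ℝ 2 (μ.restrict (Metric.ball (0 : E d) r)), IsTraceClassUnit T' ∧
      ∀ f g : Lp ℝ 2 μ, (∀ᵐ x ∂μ, x ∉ Metric.ball (0 : E d) r → f x = 0) →
        (∀ᵐ x ∂μ, x ∉ Metric.ball (0 : E d) r → g x = 0) →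
        inner ℝ g (T f) = inner ℝ ((Lp.memLp g).restrict _).toLp
          (T' ((Lp.memLp f).restrict _).toLp) := by
  obtain ⟨T', h1, h2⟩ := hK.locallyTraceClass (Metric.ball (0 : E d) r) Metric.isBounded_ball
    measurableSet_ball
  exact ⟨T', h2, fun f g hf hg => hT.inner_eq_restrict h1 hf hg⟩

variable [IsLocallyFiniteMeasure μ]

/-- Square integrable functions of bounded support are dense. -/
theorem dense_boundedSupport :
    Dense {f : Lp ℝ 2 μ | ∃ r : ℝ, ∀ᵐ x ∂μ, x ∉ Metric.ball (0 : E d) r → f x = 0} := by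
  intro f
  rw [EMetric.mem_closure_iff]
  intro ε hε
  obtain ⟨ε', h0, h1⟩ := exists_between hε
  obtain ⟨g, hgs, hg, -, hgm⟩ := (Lp.memLp f).exists_hasCompactSupport_eLpNorm_sub_le
    (by norm_num) h0.ne'
  obtain ⟨r, hr⟩ := hgs.isCompact.isBounded.subset_ball (0 : E d)
  refine ⟨hgm.toLp, ⟨r, ?_⟩, ?_⟩
  · filter_upwards [hgm.coeFn_toLp] with x hx hxr
    rw [hx]
    exact image_eq_zero_of_notMem_tsupport fun h => hxr (hr h)
  · have h2 := Lp.edist_toLp_toLp f g (Lp.memLp f) hgm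
    rw [Lp.toLp_coeFn] at h2
    rw [h2]
    exact hg.trans_lt h1

theorem IsIntegralOperator.inner_comm {T : Lp ℝ 2 μ →L[ℝ] Lp ℝ 2 μ}
    (hT : IsIntegralOperator K μ T) (hK : IsDPPKernel μ K) (f g : Lp ℝ 2 μ) :
    inner ℝ g (T f) = inner ℝ f (T g) := by
  have hc : IsClosed {p : Lp ℝ 2 μ × Lp ℝ 2 μ | inner ℝ p.2 (T p.1) = inner ℝ p.1 (T p.2)} :=
    isClosed_eq (by fun_prop) (by fun_prop)
  refine closure_minimal ?_ hc
    ((dense_boundedSupport (μ := μ)).prod (dense_boundedSupport (μ := μ)) (f, g))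
  rintro ⟨f, g⟩ ⟨⟨r, hf⟩, ⟨s, hg⟩⟩
  obtain ⟨T', hT', h⟩ := hT.exists_isTraceClassUnit hK (max r s)
  have hf' : ∀ᵐ x ∂μ, x ∉ Metric.ball (0 : E d) (max r s) → f x = 0 := by
    filter_upwards [hf] with x hx hxr
    exact hx fun hxb => hxr (Metric.ball_subset_ball (le_max_left _ _) hxb)
  have hg' : ∀ᵐ x ∂μ, x ∉ Metric.ball (0 : E d) (max r s) → g x = 0 := by
    filter_upwards [hg] with x hx hxr
    exact hx fun hxb => hxr (Metric.ball_subset_ball (le_max_right _ _) hxb)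
  change inner ℝ g (T f) = inner ℝ f (T g)
  rw [h f g hf' hg', h g f hg' hf', hT'.inner_comm]

theorem IsIntegralOperator.inner_mem_Icc {T : Lp ℝ 2 μ →L[ℝ] Lp ℝ 2 μ}
    (hT : IsIntegralOperator K μ T) (hK : IsDPPKernel μ K) (f : Lp ℝ 2 μ) :
    inner ℝ f (T f) ∈ Set.Icc 0 (‖f‖ ^ 2) := by
  have hc : IsClosed ({f : Lp ℝ 2 μ | 0 ≤ inner ℝ f (T f)} ∩
      {f : Lp ℝ 2 μ | inner ℝ f (T f) ≤ ‖f‖ ^ 2}) :=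
    (isClosed_le (by fun_prop) (by fun_prop)).inter (isClosed_le (by fun_prop) (by fun_prop))
  refine closure_minimal ?_ hc (dense_boundedSupport f)
  rintro f ⟨r, hf⟩
  obtain ⟨T', hT', h⟩ := hT.exists_isTraceClassUnit hK r
  have h2 := hT'.inner_mem_Icc ((Lp.memLp f).restrict (Metric.ball 0 r)).toLp
  rw [← h f f hf hf] at h2
  refine ⟨h2.1, h2.2.trans (pow_le_pow_left₀ (norm_nonneg _) ?_ 2)⟩
  rw [Lp.norm_toLp, Lp.norm_def]
  exact ENNReal.toReal_mono (Lp.eLpNorm_ne_top f) (eLpNorm_mono_measure _ Measure.restrict_le_self)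

end PointProcess

end

noncomputable section

/-! ### Kernels of finite rank away from and on the diagonal -/

namespace PointProcess

theorem ae_eq_zero_of_setIntegral_prod_eq_zero {α β : Type*} [MeasurableSpace α]
    [MeasurableSpace β] {μ : Measure α} {ν : Measure β} [IsFiniteMeasure μ]
    [IsFiniteMeasure ν] {h : α × β → ℝ} (hh : Integrable h (μ.prod ν))
    (h0 : ∀ C D, MeasurableSet C → MeasurableSet D → ∫ q in C ×ˢ D, h q ∂(μ.prod ν) = 0) :
    h =ᵐ[μ.prod ν] 0 := by
  refine hh.ae_eq_zero_of_forall_setIntegral_eq_zero fun s hs _ => ?_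
  induction s, hs using MeasurableSpace.induction_on_inter generateFrom_prod.symm
    isPiSystem_prod with
  | empty => simp
  | basic t ht =>
    obtain ⟨C, hC, D, hD, rfl⟩ := ht
    exact h0 C D hC hD
  | compl t htm ih =>
    have h1 := integral_add_compl htm hh
    have h2 := h0 Set.univ Set.univ MeasurableSet.univ MeasurableSet.univ
    rw [Set.univ_prod_univ, setIntegral_univ] at h2
    linarith [ih (measure_lt_top _ _)]
  | iUnion f hd hm ih =>
    have h1 := hasSum_integral_iUnion hm hd hh.integrableOn
    simp_rw [fun i => ih i (measure_lt_top _ _)] at h1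
    exact h1.unique hasSum_zero

variable {d : ℕ} {μ : Measure (E d)} {K : E d → E d → ℝ} {M : ℝ} {n : ℕ}

theorem IsIntegralOperator.setIntegral_eq_sum {T : Lp ℝ 2 μ →L[ℝ] Lp ℝ 2 μ}
    (hT : IsIntegralOperator K μ T) {ψ : Fin n → Lp ℝ 2 μ}
    (hψ : ∀ f, T f = ∑ i, inner ℝ (ψ i) f • ψ i) {C D : Set (E d)} (hC : MeasurableSet C)
    (hD : MeasurableSet D) (hCfin : μ C ≠ ∞) (hDfin : μ D ≠ ∞) :
    ∫ x in C, ∫ y in D, K x y ∂μ ∂μ = ∑ i, (∫ x in C, ψ i x ∂μ) * ∫ y in D, ψ i y ∂μ := by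
  have hK : T (indicatorConstLp 2 hD hDfin (1 : ℝ)) =ᵐ[μ] fun x => ∫ y in D, K x y ∂μ := by
    filter_upwards [(hT (indicatorConstLp 2 hD hDfin (1 : ℝ))).2] with x hx
    rw [hx, ← integral_indicator hD]
    refine integral_congr_ae ?_
    filter_upwards [indicatorConstLp_coeFn (p := 2) (hs := hD) (hμs := hDfin) (c := (1 : ℝ))]
      with y hy
    rw [hy]
    by_cases hyD : y ∈ D <;> simp [hyD]
  have h1 := L2.inner_indicatorConstLp_one (𝕜 := ℝ) hC hCfin
    (T (indicatorConstLp 2 hD hDfin (1 : ℝ)))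
  rw [← integral_congr_ae (ae_restrict_of_ae hK), ← h1, hψ, inner_sum]
  refine Finset.sum_congr rfl fun i _ => ?_
  rw [inner_smul_right, L2.inner_indicatorConstLp_one, real_inner_comm,
    L2.inner_indicatorConstLp_one, mul_comm]

/-- A kernel whose operator has finite rank is a finite sum of products almost everywhere. -/
theorem IsIntegralOperator.ae_eq_sum [IsLocallyFiniteMeasure μ] {T : Lp ℝ 2 μ →L[ℝ] Lp ℝ 2 μ}
    (hT : IsIntegralOperator K μ T) (hKm : Measurable (Function.uncurry K))
    (hM : ∀ x y, |K x y| ≤ M) {ψ : Fin n → Lp ℝ 2 μ}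
    (hψ : ∀ f, T f = ∑ i, inner ℝ (ψ i) f • ψ i) :
    ∀ᵐ q ∂μ.prod μ, K q.1 q.2 = ∑ i, ψ i q.1 * ψ i q.2 := by
  have key : ∀ k : ℕ, ∀ᵐ q ∂((μ.prod μ).restrict
      (Metric.ball (0 : E d) k ×ˢ Metric.ball (0 : E d) k)),
        K q.1 q.2 = ∑ i, ψ i q.1 * ψ i q.2 := by
    intro k
    rw [← Measure.prod_restrict]
    set ν := μ.restrict (Metric.ball (0 : E d) k) with hν
    have hb : MeasurableSet (Metric.ball (0 : E d) k) := measurableSet_ball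
    have hbfin : μ (Metric.ball (0 : E d) k) < ∞ := Metric.isBounded_ball.measure_lt_top
    have : IsFiniteMeasure ν := ⟨by simpa [ν] using hbfin⟩
    have hψi : ∀ i, Integrable (ψ i) ν := fun i =>
      ((Lp.memLp (ψ i)).restrict _).integrable one_le_two
    have hKi : Integrable (fun q : E d × E d => K q.1 q.2) (ν.prod ν) :=
      Integrable.of_bound (C := M) hKm.aestronglyMeasurable (ae_of_all _ fun q => hM _ _)
    have hSi : ∀ i, Integrable (fun q : E d × E d => ψ i q.1 * ψ i q.2) (ν.prod ν) := fun i =>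
      (hψi i).mul_prod (hψi i)
    have h := ae_eq_zero_of_setIntegral_prod_eq_zero
      (hKi.sub (integrable_finsetSum Finset.univ fun i _ => hSi i)) ?_
    · filter_upwards [h] with q hq
      exact sub_eq_zero.1 hq
    intro C D hC hD
    have hfin : ∀ C : Set (E d), μ (C ∩ Metric.ball (0 : E d) k) ≠ ∞ := fun C =>
      ((measure_mono Set.inter_subset_right).trans_lt hbfin).ne
    refine (integral_sub hKi.integrableOn
      (integrable_finsetSum Finset.univ fun i _ => hSi i).integrableOn).trans ?_
    rw [integral_finsetSum _ fun i _ => (hSi i).integrableOn,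
      setIntegral_prod _ hKi.integrableOn]
    simp_rw [setIntegral_prod_mul]
    simp only [hν, Measure.restrict_restrict hC, Measure.restrict_restrict hD]
    rw [hT.setIntegral_eq_sum hψ (hC.inter hb) (hD.inter hb) (hfin C) (hfin D), sub_self]
  have hU : (⋃ k : ℕ, Metric.ball (0 : E d) k ×ˢ Metric.ball (0 : E d) k) = Set.univ := by
    refine Set.eq_univ_of_forall fun q => ?_
    obtain ⟨k, hk⟩ := exists_nat_gt (max ‖q.1‖ ‖q.2‖)
    refine Set.mem_iUnion.2 ⟨k, ?_, ?_⟩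
    · simpa using (le_max_left _ _).trans_lt hk
    · simpa using (le_max_right _ _).trans_lt hk
  have h := (ae_restrict_iUnion_iff _ _).2 key
  rwa [hU, Measure.restrict_univ] at h

/-- The diagonal may be a null set, but positivity of `K x x + K y y - 2 K x y` for `y` close
to `x` (in the sense that `Φ y` and `K y y` are close to `Φ x` and `K x x`) still shows that the
diagonal of `K` dominates that of an almost everywhere version `∑ Φᵢ x Φᵢ y` of `K`. -/
theorem ae_sum_sq_le_diag {α : Type*} [MeasurableSpace α] {μ : Measure α} [SFinite μ]
    {K : α → α → ℝ} (hK : IsPSDKernel K) (hKm : Measurable fun x => K x x) {Φ : Fin n → α → ℝ}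
    (hΦ : ∀ i, Measurable (Φ i))
    (h : ∀ᵐ q ∂μ.prod μ, K q.1 q.2 = ∑ i, Φ i q.1 * Φ i q.2) :
    ∀ᵐ x ∂μ, ∑ i, Φ i x * Φ i x ≤ K x x := by
  let g : α → (Fin n → ℝ) × ℝ := fun x => (fun i => Φ i x, K x x)
  have hg : Measurable g := (measurable_pi_lambda _ hΦ).prodMk hKm
  let O : Set ((Fin n → ℝ) × ℝ) := {z | z.2 < ∑ i, z.1 i * z.1 i}
  have hO : IsOpen O := isOpen_lt (by fun_prop) (by fun_prop)
  have h0 : (μ.map g) O = 0 := by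
    refine measure_null_of_locally_null O fun z hz => ?_
    let G : Set (((Fin n → ℝ) × ℝ) × ((Fin n → ℝ) × ℝ)) :=
      {p | p.1.2 + p.2.2 < 2 * ∑ i, p.1.1 i * p.2.1 i}
    have hG : IsOpen G := isOpen_lt (by fun_prop) (by fun_prop)
    have hzG : (z, z) ∈ G := by
      have hz' : z.2 < ∑ i, z.1 i * z.1 i := hz
      change z.2 + z.2 < 2 * ∑ i, z.1 i * z.1 i
      linarith
    obtain ⟨U, hU, hzU, hUG⟩ := exists_nhds_square (hG.mem_nhds hzG)
    refine ⟨U, mem_nhdsWithin_of_mem_nhds (hU.mem_nhds hzU), ?_⟩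
    rw [Measure.map_apply hg hU.measurableSet]
    have hnull : μ.prod μ ((g ⁻¹' U) ×ˢ (g ⁻¹' U)) = 0 := by
      refine measure_mono_null (fun q hq => ?_) (ae_iff.1 h)
      have h1 : K q.1 q.1 + K q.2 q.2 < 2 * ∑ i, Φ i q.1 * Φ i q.2 :=
        hUG (Set.mk_mem_prod hq.1 hq.2)
      have h2 := hK.add_sub_nonneg q.1 q.2
      intro heq
      rw [heq] at h2
      linarith
    rw [Measure.prod_prod] at hnull
    exact mul_self_eq_zero.1 hnull
  rw [Measure.map_apply hg hO.measurableSet] at h0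
  rw [ae_iff]
  refine measure_mono_null (fun x hx => ?_) h0
  exact not_le.1 hx

end PointProcess

end

noncomputable section

/-! ### Determinants of kernels of finite rank -/

namespace PointProcess

section SumKernel

open Matrix

variable {α : Type*} {n m : ℕ} {Φ : Fin n → α → ℝ}

/-- The kernel `∑ Φᵢ(x) Φᵢ(y)`. -/
def sumKernel (Φ : Fin n → α → ℝ) (x y : α) : ℝ := ∑ i, Φ i x * Φ i y

theorem kernelMatrix_sumKernel (z : Fin m → α) :
    kernelMatrix (sumKernel Φ) z =
      (Matrix.of fun a i => Φ i (z a)) * (Matrix.of fun a i => Φ i (z a))ᴴ := by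
  ext a b
  simp [sumKernel, Matrix.mul_apply]

theorem isPSDKernel_sumKernel (Φ : Fin n → α → ℝ) : IsPSDKernel (sumKernel Φ) := fun m z => by
  rw [kernelMatrix_sumKernel]
  exact posSemidef_self_mul_conjTranspose _

theorem kernelDet_sumKernel_eq_zero (h : n < m) (z : Fin m → α) :
    kernelDet (sumKernel Φ) z = 0 := by
  by_contra hne
  have h1 := rank_of_isUnit _ ((isUnit_iff_isUnit_det _).2 (Ne.isUnit hne))
  rw [kernelMatrix_sumKernel] at h1
  have h2 := (rank_mul_le_left (Matrix.of fun a i => Φ i (z a))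
    (Matrix.of fun a i => Φ i (z a))ᴴ).trans (rank_le_width _)
  rw [h1, Fintype.card_fin] at h2
  omega

theorem kernelDet_sumKernel (z : Fin m → α) :
    kernelDet (sumKernel Φ) z = ∑ f : Fin m → Fin n, ∑ σ : Equiv.Perm (Fin m),
      ((Equiv.Perm.sign σ : ℤ) : ℝ) * ∏ a, (Φ (f (σ.symm a)) (z a) * Φ (f a) (z a)) := by
  rw [kernelDet, det_apply', Finset.sum_comm]
  refine Finset.sum_congr rfl fun σ _ => ?_
  simp only [Matrix.of_apply, sumKernel]
  rw [Finset.prod_univ_sum, Fintype.piFinset_univ, Finset.mul_sum]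
  refine Finset.sum_congr rfl fun f _ => ?_
  rw [Finset.prod_mul_distrib, Finset.prod_mul_distrib]
  congr 2
  refine Fintype.prod_equiv σ _ _ fun a => ?_
  simp

variable [MeasurableSpace α] {μ : Measure α} [SigmaFinite μ]

theorem measurable_sumKernel (hΦ : ∀ i, Measurable (Φ i)) :
    Measurable (Function.uncurry (sumKernel Φ)) := by
  unfold Function.uncurry sumKernel
  exact Finset.measurable_fun_sum _ fun i _ =>
    ((hΦ i).comp measurable_fst).mul ((hΦ i).comp measurable_snd)

theorem integrable_kernelDet_sumKernel (hΦ : ∀ i j, Integrable (fun x => Φ i x * Φ j x) μ) :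
    Integrable (fun z => kernelDet (sumKernel Φ) z) (Measure.pi fun _ : Fin m => μ) := by
  simp_rw [kernelDet_sumKernel]
  refine integrable_finsetSum _ fun f _ => integrable_finsetSum _ fun σ _ => ?_
  exact (Integrable.fintype_prod (f := fun a x => Φ (f (σ.symm a)) x * Φ (f a) x)
    fun a => hΦ _ _).const_mul _

/-- The integral is a sum of Gram determinants. -/
theorem integral_kernelDet_sumKernel (hΦ : ∀ i j, Integrable (fun x => Φ i x * Φ j x) μ) :
    ∫ z, kernelDet (sumKernel Φ) z ∂(Measure.pi fun _ : Fin m => μ) =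
      ∑ f : Fin m → Fin n, (Matrix.of fun a b => ∫ x, Φ (f a) x * Φ (f b) x ∂μ).det := by
  have hint : ∀ (f : Fin m → Fin n) (σ : Equiv.Perm (Fin m)), Integrable
      (fun z : Fin m → α => ((Equiv.Perm.sign σ : ℤ) : ℝ) *
        ∏ a, (Φ (f (σ.symm a)) (z a) * Φ (f a) (z a))) (Measure.pi fun _ => μ) := fun f σ =>
    (Integrable.fintype_prod (f := fun a x => Φ (f (σ.symm a)) x * Φ (f a) x)
      fun a => hΦ _ _).const_mul _
  simp_rw [kernelDet_sumKernel]
  rw [integral_finsetSum _ fun f _ => integrable_finsetSum _ fun σ _ => hint f σ]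
  refine Finset.sum_congr rfl fun f _ => ?_
  rw [integral_finsetSum _ fun σ _ => hint f σ, det_apply']
  refine Finset.sum_congr rfl fun σ _ => ?_
  rw [integral_const_mul, integral_fintype_prod_eq_prod
    (f := fun a x => Φ (f (σ.symm a)) x * Φ (f a) x)]
  congr 1
  refine Fintype.prod_equiv σ.symm _ _ fun a => ?_
  simp only [Matrix.of_apply, Equiv.apply_symm_apply, mul_comm]

theorem lintegral_kernelDet_sumKernel_le (hΦ : ∀ i j, Integrable (fun x => Φ i x * Φ j x) μ)
    (horth : ∀ i j, i ≠ j → ∫ x, Φ i x * Φ j x ∂μ = 0) (hone : ∀ i, ∫ x, Φ i x * Φ i x ∂μ ≤ 1) :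
    ∫⁻ z, ENNReal.ofReal (kernelDet (sumKernel Φ) z) ∂(Measure.pi fun _ : Fin m => μ) ≤
      ENNReal.ofReal (n.descFactorial m) := by
  classical
  rw [← ofReal_integral_eq_lintegral_ofReal (integrable_kernelDet_sumKernel hΦ)
    (ae_of_all _ fun z => (isPSDKernel_sumKernel Φ).kernelDet_nonneg z),
    integral_kernelDet_sumKernel hΦ]
  refine ENNReal.ofReal_le_ofReal ?_
  calc _ ≤ ∑ f : Fin m → Fin n, if Function.Injective f then (1 : ℝ) else 0 := by
        refine Finset.sum_le_sum fun f _ => ?_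
        split_ifs with hf
        · have h : (Matrix.of fun a b => ∫ x, Φ (f a) x * Φ (f b) x ∂μ) =
              diagonal fun a => ∫ x, Φ (f a) x * Φ (f a) x ∂μ := by
            ext a b
            by_cases hab : a = b
            · subst hab; simp
            · simp [hab, horth _ _ fun h => hab (hf h)]
          rw [h, det_diagonal]
          exact Finset.prod_le_one (fun a _ => integral_nonneg fun x => mul_self_nonneg _)
            fun a _ => hone _
        · obtain ⟨a, b, hab, hne⟩ : ∃ a b, f a = f b ∧ a ≠ b := by
            simpa [Function.Injective] using hf
          exact (det_zero_of_row_eq hne (by ext c; simp [hab])).le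
    _ = _ := by
        rw [Finset.sum_boole, ← Fintype.card_subtype,
          Fintype.card_congr (Equiv.subtypeInjectiveEquivEmbedding (Fin m) (Fin n)),
          Fintype.card_embedding_eq, Fintype.card_fin, Fintype.card_fin]

end SumKernel

variable {d : ℕ} {Ω : Type*} [MeasurableSpace Ω] {P : Measure Ω} {μ : Measure (E d)}
  [IsLocallyFiniteMeasure μ] {X : Ω → Config d} {K : E d → E d → ℝ}

/-- If the operator has rank at most `N`, then off the diagonal `K` is `∑ Φᵢ(x) Φᵢ(y)` with at most
`N` orthogonal functions of norm at most one. -/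
theorem IsDPP.exists_isOffDiagonalVersion_of_rank (hX : IsDPP P μ X K) {M : ℝ}
    (hM : ∀ x y, |K x y| ≤ M) {N : ℕ} (hN : OperatorRankLE μ K N) :
    ∃ K₀, IsOffDiagonalVersion μ K K₀ ∧
      (∀ m, N < m → ∀ z : Fin m → E d, kernelDet K₀ z = 0) ∧
      ∀ m, ∫⁻ x, ENNReal.ofReal (kernelDet K₀ x) ∂(Measure.pi fun _ : Fin m => μ) ≤
        ENNReal.ofReal (N.descFactorial m) := by
  obtain ⟨T, hT, hrank⟩ := hN
  obtain ⟨n, hnN, ψ, horth, hone, hψ⟩ := exists_orthogonal_of_rank_le hrank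
    (hT.inner_comm hX.kernel) (hT.inner_mem_Icc hX.kernel)
  have hKm := hX.kernel.measurable
  have hdiag : Measurable fun x => K x x := hKm.comp (measurable_id.prodMk measurable_id)
  have hψm : ∀ i, Measurable (ψ i) := fun i => (Lp.stronglyMeasurable (ψ i)).measurable
  have hae := hT.ae_eq_sum hKm hM hψ
  have hle := ae_sum_sq_le_diag hX.isPSDKernel hdiag hψm hae
  -- The functions are set to zero on the null set where the diagonal is too large.
  let G : Set (E d) := {x | ∑ i, ψ i x * ψ i x ≤ K x x}
  have hG : MeasurableSet G :=
    measurableSet_le (Finset.measurable_fun_sum _ fun i _ => (hψm i).mul (hψm i)) hdiag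
  let Φ : Fin n → E d → ℝ := fun i => G.indicator (ψ i)
  have hΦψ : ∀ᵐ x ∂μ, ∀ i, Φ i x = ψ i x := by
    filter_upwards [hle] with x hx i
    exact Set.indicator_of_mem (s := G) hx (ψ i)
  have hinner : ∀ i j, ∫ x, Φ i x * Φ j x ∂μ = inner ℝ (ψ i) (ψ j) := fun i j => by
    rw [L2.inner_def]
    refine integral_congr_ae ?_
    filter_upwards [hΦψ] with x hx
    simp [hx, mul_comm]
  have hΦi : ∀ i j, Integrable (fun x => Φ i x * Φ j x) μ := fun i j => by
    refine (L2.integrable_inner (𝕜 := ℝ) (ψ i) (ψ j)).congr ?_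
    filter_upwards [hΦψ] with x hx
    simp [hx, mul_comm]
  refine ⟨sumKernel Φ, ⟨measurable_sumKernel fun i => (hψm i).indicator hG,
    isPSDKernel_sumKernel Φ, fun x => ?_, ?_⟩, fun m hm z =>
      kernelDet_sumKernel_eq_zero (hnN.trans_lt hm) z, fun m =>
      (lintegral_kernelDet_sumKernel_le hΦi (fun i j hij => (hinner i j).trans (horth i j hij))
        fun i => (hinner i i).trans_le (hone i)).trans (ENNReal.ofReal_le_ofReal ?_)⟩
  · by_cases hx : x ∈ G
    · have h : ∑ i, ψ i x * ψ i x ≤ K x x := hx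
      simpa [sumKernel, Φ, hx] using h
    · simpa [sumKernel, Φ, hx] using hX.isPSDKernel.diag_nonneg x
  · filter_upwards [hae, Measure.quasiMeasurePreserving_fst.ae hΦψ,
      Measure.quasiMeasurePreserving_snd.ae hΦψ] with q hq h1 h2
    simp [hq, sumKernel, h1, h2]
  · exact_mod_cast Nat.descFactorial_le m hnN

end PointProcess

end

noncomputable section

/-! ### The mixing bounds -/

namespace PointProcess

theorem KernelBounded.abs_le_kernelNorm {d : ℕ} {K : E d → E d → ℝ} (hK : KernelBounded K)
    (x y : E d) : |K x y| ≤ kernelNorm K := by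
  obtain ⟨M, hM⟩ := hK
  exact le_ciSup (f := fun z : E d × E d => |K z.1 z.2|)
    ⟨M, by rintro _ ⟨z, rfl⟩; exact hM _ _⟩ (x, y)

theorem KernelBounded.abs_le_omega {d : ℕ} {K : E d → E d → ℝ} (hK : KernelBounded K) {r : ℝ}
    {x y : E d} (h : r ≤ ‖y - x‖) : |K x y| ≤ omega K r := by
  obtain ⟨M, hM⟩ := hK
  exact le_csSup ⟨M, by rintro _ ⟨x, y, -, rfl⟩; exact hM _ _⟩ ⟨x, y, h, rfl⟩

variable {d : ℕ} {Ω : Type*} [MeasurableSpace Ω] {P : Measure Ω} [IsProbabilityMeasure P]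
  {μ : Measure (E d)} [SigmaFinite μ] {X : Ω → Config d} {K K₀ : E d → E d → ℝ}

/-- The estimate common to bounded kernels and kernels of finite rank: `a` and `b` bound the
weighted traces of adjugates on sets of measure at most `p` and `q`. -/
theorem IsDPP.betaMix_le_of_weights (hX : IsDPP P μ X K) (hK : KernelBounded K)
    (h₀ : IsOffDiagonalVersion μ K K₀) {N : ℕ∞}
    (hN : ∀ n : ℕ, N < n → ∀ z : Fin n → E d, kernelDet K₀ z = 0) {p q r : ℝ≥0} {a b : ℝ}
    (ha0 : 0 ≤ a) (hb0 : 0 ≤ b)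
    (ha : ∀ A, MeasurableSet A → μ A ≤ p →
      ∑' n : ℕ, ENNReal.ofReal ((n.factorial : ℝ)⁻¹ * 2 ^ n) *
        ∫⁻ x, adjWeight N K₀ x ∂(Measure.pi fun _ : Fin n => μ.restrict A) ≤ ENNReal.ofReal a)
    (hb : ∀ B, MeasurableSet B → μ B ≤ q →
      ∑' n : ℕ, ENNReal.ofReal ((n.factorial : ℝ)⁻¹ * 2 ^ n) *
        ∫⁻ x, adjWeight N K₀ x ∂(Measure.pi fun _ : Fin n => μ.restrict B) ≤ ENNReal.ofReal b) :
    betaMix P μ X p q r ≤ omega K r ^ 2 * (a * b) := by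
  refine betaMix_le hX.measurable (by positivity)
    fun A B hA hB hAp hBq hAB hr H hH hHm => ?_
  have hAfin : μ A ≠ ∞ := (hAp.trans_lt ENNReal.coe_lt_top).ne
  have hBfin : μ B ≠ ∞ := (hBq.trans_lt ENNReal.coe_lt_top).ne
  have hM0 : 0 ≤ kernelNorm K := Real.iSup_nonneg fun _ => abs_nonneg _
  have h1 := hX.enorm_sub_le hM0 (fun x => (le_abs_self _).trans (hK.abs_le_kernelNorm x x))
    h₀ hA hB hAB hAfin hBfin hH hHm
  have h2 := tsum_lintegral_kernelDet_sub_le h₀ hN hA hB hAB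
    fun x hx y hy => hK.abs_le_omega (hr x hx y hy)
  have h3 := (h1.trans h2).trans (mul_le_mul_right (mul_le_mul' (ha A hA hAp) (hb B hB hBq)) _)
  rwa [← ENNReal.ofReal_mul ha0, ← ENNReal.ofReal_mul (by positivity), Real.enorm_eq_ofReal_abs,
    ENNReal.ofReal_le_ofReal_iff (by positivity)] at h3

theorem IsDPP.betaMix_le_exp (hX : IsDPP P μ X K) (hK : KernelBounded K) (p q r : ℝ≥0) :
    betaMix P μ X p q r ≤
      4 * p * q * (1 + 2 * p * kernelNorm K) * (1 + 2 * q * kernelNorm K) *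
        Real.exp (2 * kernelNorm K * (p + q)) * omega K r ^ 2 := by
  have hM0 : 0 ≤ kernelNorm K := Real.iSup_nonneg fun _ => abs_nonneg _
  have hw : ∀ p : ℝ≥0, ∀ A, MeasurableSet A → μ A ≤ p →
      ∑' n : ℕ, ENNReal.ofReal ((n.factorial : ℝ)⁻¹ * 2 ^ n) *
        ∫⁻ x, adjWeight ⊤ K x ∂(Measure.pi fun _ : Fin n => μ.restrict A) ≤
          ENNReal.ofReal (2 * p * ((1 + 2 * p * kernelNorm K) *
            Real.exp (2 * kernelNorm K * p))) := by
    intro p A hA hAp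
    have : IsFiniteMeasure (μ.restrict A) := ⟨by simpa using hAp.trans_lt ENNReal.coe_lt_top⟩
    exact tsum_lintegral_adjWeight_le_exp hX.isPSDKernel hX.kernel.measurable hM0
      (fun x => (le_abs_self _).trans (hK.abs_le_kernelNorm x x)) p.2 (by simpa using hAp)
  refine (hX.betaMix_le_of_weights hK ⟨hX.kernel.measurable, hX.isPSDKernel, fun _ => le_rfl,
    ae_of_all _ fun _ => rfl⟩ (N := ⊤) (fun n hn => absurd hn not_top_lt) (by positivity)
    (by positivity) (hw p) (hw q)).trans_eq ?_
  rw [mul_add (2 * kernelNorm K), Real.exp_add]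
  ring

theorem IsDPP.betaMix_le_of_rank [IsLocallyFiniteMeasure μ] (hX : IsDPP P μ X K)
    (hK : KernelBounded K) {N : ℕ} (hN : OperatorRankLE μ K N) (p q r : ℝ≥0) :
    betaMix P μ X p q r ≤ 4 * p * q * (N : ℝ) ^ 2 * 9 ^ N * omega K r ^ 2 := by
  obtain ⟨K₀, h₀, hdet, hint⟩ := hX.exists_isOffDiagonalVersion_of_rank hK.abs_le_kernelNorm hN
  have hw : ∀ p : ℝ≥0, ∀ A, MeasurableSet A → μ A ≤ p →
      ∑' n : ℕ, ENNReal.ofReal ((n.factorial : ℝ)⁻¹ * 2 ^ n) *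
        ∫⁻ x, adjWeight N K₀ x ∂(Measure.pi fun _ : Fin n => μ.restrict A) ≤
          ENNReal.ofReal (2 * p * (N * 3 ^ N)) := by
    intro p A hA hAp
    have : IsFiniteMeasure (μ.restrict A) := ⟨by simpa using hAp.trans_lt ENNReal.coe_lt_top⟩
    refine tsum_lintegral_adjWeight_le_of_rank h₀.psd h₀.measurable N p.2 (by simpa using hAp)
      fun n => (lintegral_mono' ?_ le_rfl).trans (hint n)
    rw [← Measure.restrict_pi_pi]
    exact Measure.restrict_le_self
  refine (hX.betaMix_le_of_weights hK h₀ (N := N) (fun n hn => hdet n (by exact_mod_cast hn))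
    (by positivity) (by positivity) (hw p) (hw q)).trans_eq ?_
  rw [show (9 : ℝ) = 3 * 3 by norm_num, mul_pow]
  ring

end PointProcess

end

theorem theorem2 {d : ℕ} {μ : MeasureTheory.Measure (PointProcess.E d)}
    [MeasureTheory.IsLocallyFiniteMeasure μ]
    {Ω : Type*} [MeasurableSpace Ω] {P : MeasureTheory.Measure Ω}
    [MeasureTheory.IsProbabilityMeasure P]
    {X : Ω → PointProcess.Config d} {K : PointProcess.E d → PointProcess.E d → ℝ}
    (hX : PointProcess.IsDPP P μ X K) (hK : PointProcess.KernelBounded K) :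
    (Tendsto (PointProcess.omega K) atTop (𝓝 0) → PointProcess.IsBetaMixing P μ X) ∧
    (∀ p q r : ℝ≥0, PointProcess.betaMix P μ X p q r ≤
      4 * p * q * (1 + 2 * p * PointProcess.kernelNorm K) * (1 + 2 * q * PointProcess.kernelNorm K) *
        Real.exp (2 * PointProcess.kernelNorm K * (p + q)) * PointProcess.omega K r ^ 2) ∧
    (∀ N : ℕ, PointProcess.OperatorRankLE μ K N → ∀ p q r : ℝ≥0,
      PointProcess.betaMix P μ X p q r ≤
        4 * p * q * (N : ℝ) ^ 2 * 9 ^ N * PointProcess.omega K r ^ 2) := by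
  refine ⟨fun hω p q _ _ => ?_, hX.betaMix_le_exp hK, fun N hN => hX.betaMix_le_of_rank hK hN⟩
  refine squeeze_zero (fun r => PointProcess.betaMix_nonneg p q r)
    (fun r => hX.betaMix_le_exp hK p q r) ?_
  have h := ((hω.comp (NNReal.tendsto_coe_atTop.2 tendsto_id)).pow 2).const_mul
    (4 * p * q * (1 + 2 * p * PointProcess.kernelNorm K) * (1 + 2 * q * PointProcess.kernelNorm K) *
        Real.exp (2 * PointProcess.kernelNorm K * (p + q)))
  simpa using h
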